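/- Let $(M,g)$ be a compact connected Hermitian manifold of complex dimension $n$, with $g$ smooth, let $\omega=\sqrt{-1}\sum_{i,j}g_{i\bar j}\,dz^i\wedge d\bar z^j$, and assume $\int_M\omega^n=1$. For a smooth function $F:M\to\mathbb R$ and $0<T\le\infty$, let $\varphi$ be a smooth solution on $M\times[0,T)$ of the parabolic complex Monge–Ampère equation $$\frac{\partial\varphi}{\partial t}=\log\frac{\det(g_{i\bar j}+\partial_i\partial_{\bar j}\varphi)}{\det g_{i\bar j}}-F,\qquad g_{i\bar j}+\partial_i\partial_{\bar j}\varphi>0,\qquad \varphi(\cdot,0)=0$$ (for instance the solution on its maximal interval of existence). Write $g'_{i\bar j}=g_{i\bar j}+\partial_i\partial_{\bar j}\varphi$, $\operatorname{tr}_g g'=g^{i\bar j}g'_{i\bar j}$, $\triangle=g^{i\bar j}\partial_i\partial_{\bar j}$ and $\tilde\varphi=\varphi-\int_M\varphi\,\omega^n$. Then for every real $K$ there are constants $C_1,C_2,A,C>0$, depending only on $(M,g)$ and $K$, such that for all $F$ with $\sup_M|F|\le K$ and $\inf_M\triangle F\ge -K$, all $T$ and all $\varphi$ as above, the function $\tilde\varphi$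 is bounded on $M\times[0,T)$, and at every point of $M\times[0,T)$ $$\operatorname{tr}_g g'\le C_1\,e^{C_2\left(\sup_{M\times[0,T)}\tilde\varphi-\inf_{M\times[0,T)}\tilde\varphi\right)}\exp\!\left(e^{A\left(\sup_{M\times[0,T)}\tilde\varphi-\inf_{M\times[0,T)}\tilde\varphi\right)}-e^{A\left(\sup_{M\times[0,T)}\tilde\varphi-\tilde\varphi\right)}\right),$$ $$\operatorname{tr}_g g'\le C,\qquad \frac1C\,g\le g'\le C\,g .$$ In particular, for each $F$ these constants depend only on $(M,g)$ and $F$. -/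

import Mathlib

open Set MeasureTheory
open scoped Manifold ContDiff ComplexConjugate ComplexOrder

noncomputable section

namespace HermitianFlow

/-- The model space `ℂⁿ` of an `n`-dimensional complex manifold. -/
abbrev Cn (n : ℕ) : Type := Fin n → ℂ

/-- The coordinate vector `e_i` of `ℂⁿ`. -/
def basisVec {n : ℕ} (i : Fin n) : Cn n := Pi.single i 1

/-- The Wirtinger derivative `∂f/∂z^i = (∂f/∂x^i - √-1 ∂f/∂y^i) / 2` of a function on `ℂⁿ`. -/
def dz {n : ℕ} (i : Fin n) (f : Cn n → ℂ) (z : Cn n) : ℂ :=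
  (1 / 2 : ℂ) * (fderiv ℝ f z (basisVec i) - Complex.I * fderiv ℝ f z (Complex.I • basisVec i))

/-- The Wirtinger derivative `∂f/∂z̄^i = (∂f/∂x^i + √-1 ∂f/∂y^i) / 2` of a function on `ℂⁿ`. -/
def dzbar {n : ℕ} (i : Fin n) (f : Cn n → ℂ) (z : Cn n) : ℂ :=
  (1 / 2 : ℂ) * (fderiv ℝ f z (basisVec i) + Complex.I * fderiv ℝ f z (Complex.I • basisVec i))

section Manifold

variable {n : ℕ} {M : Type*} [TopologicalSpace M] [ChartedSpace (Cn n) M]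

/-- The holomorphic coordinate vector field `∂/∂z^i` of the chart centred at `c`, at the point
with coordinates `z`. -/
def coordVec (c : M) (i : Fin n) (z : Cn n) :
    TangentSpace 𝓘(ℂ, Cn n) ((chartAt (Cn n) c).symm z) :=
  mfderiv 𝓘(ℂ, Cn n) 𝓘(ℂ, Cn n) (chartAt (Cn n) c).symm z (basisVec i)

/-- The matrix `g_{i j̄} = g(∂_i, ∂_j)` of a field of sesquilinear forms (linear in the first slot,
conjugate-linear in the second), in the chart centred at `c`, at the point with coordinates `z`. -/
def formMatrix
    (B : ∀ x : M, TangentSpace 𝓘(ℂ, Cn n) x →ₗ[ℂ] TangentSpace 𝓘(ℂ, Cn n) x →ₗ⋆[ℂ] ℂ)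
    (c : M) (z : Cn n) : Matrix (Fin n) (Fin n) ℂ :=
  Matrix.of fun i j => B ((chartAt (Cn n) c).symm z) (coordVec c i z) (coordVec c j z)

variable (n M) in
/-- A smooth Hermitian metric on a complex manifold: positive definite Hermitian forms on the
holomorphic tangent spaces whose coefficients `g_{i j̄}` are smooth in the charts. -/
structure HermitianMetric where
  /-- the form on each tangent space -/
  form : ∀ x : M, TangentSpace 𝓘(ℂ, Cn n) x →ₗ[ℂ] TangentSpace 𝓘(ℂ, Cn n) x →ₗ⋆[ℂ] ℂ
  conj_symm : ∀ (x : M) (v w : TangentSpace 𝓘(ℂ, Cn n) x), conj (form x v w) = form x w v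
  pos : ∀ (x : M) (v : TangentSpace 𝓘(ℂ, Cn n) x), v ≠ 0 → 0 < (form x v v).re
  smooth : ∀ (c : M) (i j : Fin n),
    ContDiffOn ℝ ∞ (fun z => formMatrix form c z i j) (chartAt (Cn n) c).target

namespace HermitianMetric

/-- The coefficients `g_{i j̄}` in the chart centred at `c`, at the point with coordinates `z`. -/
def coeff (g : HermitianMetric n M) (c : M) (z : Cn n) : Matrix (Fin n) (Fin n) ℂ :=
  formMatrix g.form c z

/-- The coefficients `g_{i j̄}(x)` in the preferred chart at `x`. -/
def matrixAt (g : HermitianMetric n M) (x : M) : Matrix (Fin n) (Fin n) ℂ :=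
  g.coeff x (chartAt (Cn n) x x)

/-- The part of the measure `ω^n` carried by the domain of the chart centred at `c`.
With `ω = √-1 ∑ g_{i j̄} dz^i ∧ dz̄^j` one has `ω^n = n! 2^n det(g_{i j̄}) dx^1 dy^1 ⋯ dx^n dy^n`. -/
def chartVolume [MeasurableSpace M] (g : HermitianMetric n M) (c : M) : Measure M :=
  (((volume : Measure (Cn n)).restrict (chartAt (Cn n) c).target).withDensity
    (fun z => ENNReal.ofReal ((n.factorial : ℝ) * 2 ^ n * (g.coeff c z).det.re))).map
      (chartAt (Cn n) c).symm

/-- The measure `ω^n` on `M`. The measures `g.chartVolume c` are the restrictions of `ω^n` to the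
chart domains (they agree on overlaps by the change of variables formula), so `ω^n` is their least
upper bound. -/
def omegaPow [MeasurableSpace M] (g : HermitianMetric n M) : Measure M :=
  ⨆ c : M, g.chartVolume c

end HermitianMetric

variable (n) in
/-- The complex Hessian `∂_i ∂_{j̄} u (x)` of a real function `u`, in the preferred chart at `x`. -/
def complexHessian (u : M → ℝ) (x : M) : Matrix (Fin n) (Fin n) ℂ :=
  Matrix.of fun i j =>
    dz i (dzbar j fun z => ((u ((chartAt (Cn n) x).symm z) : ℝ) : ℂ)) (chartAt (Cn n) x x)

/-- The trace `tr_g h = g^{i j̄} h_{i j̄}` of a Hermitian matrix `h` with respect to `g`. -/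
def trWrt (g h : Matrix (Fin n) (Fin n) ℂ) : ℝ := (g⁻¹ * h).trace.re

namespace HermitianMetric

/-- The complex Laplacian `△ u = g^{i j̄} ∂_i ∂_{j̄} u`. -/
def laplacian (g : HermitianMetric n M) (u : M → ℝ) (x : M) : ℝ :=
  trWrt (g.matrixAt x) (complexHessian n u x)

/-- The coefficients `g'_{i j̄}(x) = g_{i j̄}(x) + ∂_i ∂_{j̄} u (x)`, in the preferred chart at
`x`. -/
def perturbed (g : HermitianMetric n M) (u : M → ℝ) (x : M) : Matrix (Fin n) (Fin n) ℂ :=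
  g.matrixAt x + complexHessian n u x

end HermitianMetric

/-- The time interval `[0,T)`, where `T` may be `∞`. -/
def timeInterval (T : EReal) : Set ℝ := {t | 0 ≤ t ∧ (t : EReal) < T}

/-- `φ` is a smooth solution on `M × [0,T)` of the parabolic complex Monge-Ampère equation
`∂φ/∂t = log (det (g_{i j̄} + ∂_i ∂_{j̄} φ) / det g_{i j̄}) - F`, `g_{i j̄} + ∂_i ∂_{j̄} φ > 0`,
with `φ(·,0) = 0`. The time derivative at `t = 0` is the one-sided one. -/
structure IsSolution (g : HermitianMetric n M) (F : M → ℝ) (T : EReal) (φ : M → ℝ → ℝ) :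
    Prop where
  smooth : ContMDiffOn (𝓘(ℝ, Cn n).prod 𝓘(ℝ, ℝ)) 𝓘(ℝ, ℝ) ∞ (fun p : M × ℝ => φ p.1 p.2)
    (univ ×ˢ timeInterval T)
  initial : ∀ x, φ x 0 = 0
  posDef : ∀ x, ∀ t ∈ timeInterval T, (g.perturbed (fun y => φ y t) x).PosDef
  equation : ∀ x, ∀ t ∈ timeInterval T,
    HasDerivWithinAt (φ x)
      (Real.log ((g.perturbed (fun y => φ y t) x).det / (g.matrixAt x).det).re - F x)
      (timeInterval T) t

/-- The normalization `φ̃ = φ - ∫_M φ ω^n`. -/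
def normalized [MeasurableSpace M] (g : HermitianMetric n M) (φ : M → ℝ → ℝ) (x : M) (t : ℝ) : ℝ :=
  φ x t - ∫ y, φ y t ∂g.omegaPow

/-- The set of values of `u` on `M × [0,T)`. -/
def valuesOn (T : EReal) (u : M → ℝ → ℝ) : Set ℝ := image2 u univ (timeInterval T)

end Manifold

end HermitianFlow

end

open Set MeasureTheory
open scoped Manifold ContDiff ComplexConjugate ComplexOrder

noncomputable section

namespace HermitianFlow

/-! ### Complexified directional derivatives -/

section Cd

variable {F : Type*} [NormedAddCommGroup F] [NormedSpace ℝ F]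

/-! Everything reduces to bounds that depend only on `(M, g)` and `K`. Once `tr_g g' ≤ C` is known,
the double exponential estimate holds with `C₁ = C` and `C₂ = A = 1`: both exponential factors are
at least 1, because `sup φ̃ - φ̃` never exceeds `sup φ̃ - inf φ̃`. The uniform bounds come from
three estimates.

Speed (`IsSolution.abs_speed_le`). Comparison with the stationary solution `0` for the datum `0`
gives `|φ(·,s)| ≤ K s`. A time translate of `φ` solves the same equation, so comparing `φ` with its
translates makes `φ` Lipschitz in time with constant `K`, that is `|∂φ/∂t| ≤ K`. Hence `log (det g'
/ det g) = ∂φ/∂t + F` lies in `[-2K, 2K]`, and every time slice can be treated as an elliptic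
Monge-Ampère problem.

Oscillation (`exists_oscillation_bound`). Let `u` be a slice normalized to have maximum zero. It is
quasi-plurisubharmonic, so the sub-mean value inequality on coordinate polydiscs, carried along
overlapping balls by connectedness, bounds the integral of `-u`. Near a minimum point `a`, the
Alexandrov-Bakelman-Pucci argument is applied to `v = u + ε |z - a|²`. The gradient of `v` maps the
contact set onto a set containing a ball of definite size. On the contact set `g' ≥ g / 2`, so the
determinant bound controls `g'`, hence the Hessian and the Jacobian of the gradient map. The contact
set therefore has definite measure, and `u` is there almost minimal; the integral bound then
controls the minimum.

Trace (`exists_traceAt_bound`). The maximum principle is applied to `log tr_g g' + exp (-A (φ -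
φ(p,t) - C₀))` with a fixed point `p` and the oscillation bound `C₀`, so that the exponential is at
least 1. In `laplacian_trace_ge` the good third order terms dominate `|∂ tr|² / tr` except for the
torsion of `g`. At a maximum the torsion cross term is absorbed by the gradient term created by the
convexity of the exponential, and the other errors by the multiple of `tr_{g'} g` that the
exponential produces (`sum_inv_le_of_isLocalMax`). So `tr_{g'} g` is bounded at the maximum and, the
determinant being bounded, so is `tr_g g'`; the oscillation bound carries this to every point. The
determinant bound finally turns the trace bound into `C⁻¹ g ≤ g' ≤ C g`. -/

/-- The derivative of `f` along the complexified constant vector field `a + √-1 b`. -/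
def cd (a b : F) (f : F → ℂ) (p : F) : ℂ := fderiv ℝ f p a + Complex.I * fderiv ℝ f p b

variable {a b a' b' : F} {f f₁ f₂ : F → ℂ} {p : F} {U : Set F}

lemma cd_congr (h : f₁ =ᶠ[nhds p] f₂) : cd a b f₁ p = cd a b f₂ p := by
  simp only [cd, h.fderiv_eq]

lemma cd_congr_on (hU : IsOpen U) (hp : p ∈ U) (h : ∀ q ∈ U, f₁ q = f₂ q) :
    cd a b f₁ p = cd a b f₂ p :=
  cd_congr (Filter.eventuallyEq_of_mem (hU.mem_nhds hp) h)

lemma cd_const (c : ℂ) : cd a b (fun _ => c) p = 0 := by simp [cd]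

lemma cd_add (h₁ : DifferentiableAt ℝ f₁ p) (h₂ : DifferentiableAt ℝ f₂ p) :
    cd a b (fun q => f₁ q + f₂ q) p = cd a b f₁ p + cd a b f₂ p := by
  simp only [cd, fderiv_fun_add h₁ h₂, add_apply]; ring

lemma cd_sub (h₁ : DifferentiableAt ℝ f₁ p) (h₂ : DifferentiableAt ℝ f₂ p) :
    cd a b (fun q => f₁ q - f₂ q) p = cd a b f₁ p - cd a b f₂ p := by
  simp only [cd, fderiv_fun_sub h₁ h₂, sub_apply]; ring

lemma cd_mul (h₁ : DifferentiableAt ℝ f₁ p) (h₂ : DifferentiableAt ℝ f₂ p) :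
    cd a b (fun q => f₁ q * f₂ q) p = cd a b f₁ p * f₂ p + f₁ p * cd a b f₂ p := by
  simp only [cd, fderiv_fun_mul h₁ h₂, add_apply,
    smul_apply, smul_eq_mul]; ring

lemma cd_const_mul (c : ℂ) (h : DifferentiableAt ℝ f p) :
    cd a b (fun q => c * f q) p = c * cd a b f p := by
  rw [cd_mul (differentiableAt_const c) h, cd_const]; ring

lemma cd_sum {ι : Type*} (s : Finset ι) {f : ι → F → ℂ}
    (h : ∀ i ∈ s, DifferentiableAt ℝ (f i) p) :
    cd a b (fun q => ∑ i ∈ s, f i q) p = ∑ i ∈ s, cd a b (f i) p := by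
  simp only [cd, fderiv_fun_sum h, sum_apply, Finset.sum_add_distrib,
    Finset.mul_sum]

/-- Conjugation reverses the sign of the imaginary direction; it thus exchanges `(1,0)` and `(0,1)`
derivatives. -/
lemma cd_conj : cd a b (fun q => conj (f q)) p = conj (cd a (-b) f p) := by
  have h : fderiv ℝ (fun q => conj (f q)) p
      = (Complex.conjCLE : ℂ →L[ℝ] ℂ).comp (fderiv ℝ f p) :=
    Complex.conjCLE.comp_fderiv (f := f) (x := p)
  simp [cd, h]

lemma cd_ofReal_comp {φ : ℝ → ℝ} {r : F → ℝ} {φ' : ℝ} (hr : DifferentiableAt ℝ r p)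
    (hφ : HasDerivAt φ φ' (r p)) :
    cd a b (fun q => ((φ (r q) : ℝ) : ℂ)) p = φ' * cd a b (fun q => ((r q : ℝ) : ℂ)) p := by
  have h1 : HasFDerivAt (fun q => ((φ (r q) : ℝ) : ℂ))
      (Complex.ofRealCLM.comp (φ' • fderiv ℝ r p)) p :=
    Complex.ofRealCLM.hasFDerivAt.comp p (hφ.comp_hasFDerivAt p hr.hasFDerivAt)
  have h2 : HasFDerivAt (fun q => ((r q : ℝ) : ℂ)) (Complex.ofRealCLM.comp (fderiv ℝ r p)) p :=
    Complex.ofRealCLM.hasFDerivAt.comp p hr.hasFDerivAt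
  simp only [cd, h1.fderiv, h2.fderiv]
  simp; ring

lemma two_le_infty : (2 : WithTop ℕ∞) ≤ ∞ :=
  WithTop.coe_le_coe.2 (le_top : (2 : ℕ∞) ≤ ⊤)

lemma differentiableAt_of_contDiffOn {G : Type*} [NormedAddCommGroup G] [NormedSpace ℝ G]
    {f : F → G} (hU : IsOpen U) (hp : p ∈ U) (hf : ContDiffOn ℝ ∞ f U) :
    DifferentiableAt ℝ f p :=
  (hf.contDiffAt (hU.mem_nhds hp)).differentiableAt (by simp)

lemma contDiffOn_cd (hU : IsOpen U) (hf : ContDiffOn ℝ ∞ f U) :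
    ContDiffOn ℝ ∞ (cd a b f) U := by
  have h : ContDiffOn ℝ ∞ (fderiv ℝ f) U := hf.fderiv_of_isOpen hU (by simp)
  exact (h.clm_apply contDiffOn_const).add
    (contDiffOn_const.mul (h.clm_apply contDiffOn_const))

lemma fderiv_fderiv_apply {G : Type*} [NormedAddCommGroup G] [NormedSpace ℝ G]
    {f : F → G} (hf : ContDiffAt ℝ 2 f p) (v w : F) :
    fderiv ℝ (fun q => fderiv ℝ f q w) p v = fderiv ℝ (fderiv ℝ f) p v w := by
  have h : DifferentiableAt ℝ (fderiv ℝ f) p :=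
    (hf.fderiv_right (m := 1) (by norm_num)).differentiableAt (by simp)
  have := (h.hasFDerivAt.clm_apply (hasFDerivAt_const w p)).fderiv
  rw [this]; simp

/-- The second complexified derivative in terms of the real Hessian. -/
lemma cd_cd_apply (hf : ContDiffAt ℝ 2 f p) :
    cd a b (cd a' b' f) p
      = fderiv ℝ (fderiv ℝ f) p a a' - fderiv ℝ (fderiv ℝ f) p b b'
        + Complex.I * (fderiv ℝ (fderiv ℝ f) p a b' + fderiv ℝ (fderiv ℝ f) p b a') := by
  have h : DifferentiableAt ℝ (fderiv ℝ f) p :=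
    (hf.fderiv_right (m := 1) (by norm_num)).differentiableAt (by simp)
  have hd : ∀ w, DifferentiableAt ℝ (fun q => fderiv ℝ f q w) p := fun w =>
    h.clm_apply (differentiableAt_const w)
  have e : cd a b (cd a' b' f) p
      = cd a b (fun q => fderiv ℝ f q a') p + Complex.I * cd a b (fun q => fderiv ℝ f q b') p := by
    rw [← cd_const_mul _ (hd b'), ← cd_add (hd a') ((hd b').const_mul _)]
    rfl
  rw [e]
  simp only [cd, fderiv_fderiv_apply hf]
  linear_combination (fderiv ℝ (fderiv ℝ f) p b b') * Complex.I_mul_I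

lemma isSymm_fderiv_fderiv {G : Type*} [NormedAddCommGroup G] [NormedSpace ℝ G]
    {f : F → G} (hf : ContDiffAt ℝ 2 f p) (v w : F) :
    fderiv ℝ (fderiv ℝ f) p v w = fderiv ℝ (fderiv ℝ f) p w v :=
  (hf.isSymmSndFDerivAt (by simp)).eq v w

lemma cd_comm (hU : IsOpen U) (hp : p ∈ U) (hf : ContDiffOn ℝ ∞ f U) :
    cd a b (cd a' b' f) p = cd a' b' (cd a b f) p := by
  have h : ContDiffAt ℝ 2 f p := (hf.contDiffAt (hU.mem_nhds hp)).of_le two_le_infty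
  rw [cd_cd_apply h, cd_cd_apply h, isSymm_fderiv_fderiv h a a', isSymm_fderiv_fderiv h b b',
    isSymm_fderiv_fderiv h a b', isSymm_fderiv_fderiv h b a']
  ring

end Cd

/-! ### Matrix valued functions -/

section CdM

variable {F : Type*} [NormedAddCommGroup F] [NormedSpace ℝ F] {n : ℕ}

/-- Entrywise derivative of a matrix valued function along `a + √-1 b`. -/
def cdM (a b : F) (M : F → Matrix (Fin n) (Fin n) ℂ) (p : F) : Matrix (Fin n) (Fin n) ℂ :=
  Matrix.of fun i j => cd a b (fun q => M q i j) p

/-- Smoothness of all entries of a matrix valued function. -/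
def SmoothM (M : F → Matrix (Fin n) (Fin n) ℂ) (U : Set F) : Prop :=
  ∀ i j, ContDiffOn ℝ ∞ (fun q => M q i j) U

variable {a b a' b' : F} {M N : F → Matrix (Fin n) (Fin n) ℂ} {p : F} {U : Set F}

@[simp] lemma cdM_apply (i j : Fin n) : cdM a b M p i j = cd a b (fun q => M q i j) p := rfl

lemma SmoothM.cdM (hU : IsOpen U) (hM : SmoothM M U) : SmoothM (cdM a b M) U := fun i j =>
  contDiffOn_cd hU (hM i j)

lemma SmoothM.mul (hM : SmoothM M U) (hN : SmoothM N U) : SmoothM (fun q => M q * N q) U := by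
  intro i j
  simp only [Matrix.mul_apply]
  exact ContDiffOn.sum fun k _ => (hM i k).mul (hN k j)

lemma SmoothM.add (hM : SmoothM M U) (hN : SmoothM N U) : SmoothM (fun q => M q + N q) U :=
  fun i j => (hM i j).add (hN i j)

lemma SmoothM.trace (hM : SmoothM M U) : ContDiffOn ℝ ∞ (fun q => (M q).trace) U :=
  ContDiffOn.sum fun k _ => hM k k

lemma SmoothM.det (hM : SmoothM M U) : ContDiffOn ℝ ∞ (fun q => (M q).det) U := by
  simp only [Matrix.det_apply']
  exact ContDiffOn.sum fun σ _ =>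
    contDiffOn_const.mul (contDiffOn_prod fun i _ => hM _ _)

lemma SmoothM.inv (hM : SmoothM M U) (hdet : ∀ q ∈ U, (M q).det ≠ 0) :
    SmoothM (fun q => (M q)⁻¹) U := by
  intro i j
  simp only [Matrix.inv_def, Ring.inverse_eq_inv', Matrix.smul_apply, smul_eq_mul]
  refine (hM.det.inv hdet).mul ?_
  simp only [Matrix.adjugate_apply]
  refine SmoothM.det fun i' j' => ?_
  by_cases h : i' = j
  · subst h; simpa using contDiffOn_const
  · simpa [Matrix.updateRow_ne h] using hM i' j'

lemma SmoothM.const (A : Matrix (Fin n) (Fin n) ℂ) : SmoothM (fun _ : F => A) U :=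
  fun _ _ => contDiffOn_const

lemma cdM_congr_on (hU : IsOpen U) (hp : p ∈ U) (h : ∀ q ∈ U, M q = N q) :
    cdM a b M p = cdM a b N p := by
  ext i j
  exact cd_congr_on hU hp fun q hq => by rw [h q hq]

lemma cdM_const (A : Matrix (Fin n) (Fin n) ℂ) : cdM a b (fun _ => A) p = 0 := by
  ext i j; exact cd_const _

lemma cdM_add (hU : IsOpen U) (hp : p ∈ U) (hM : SmoothM M U) (hN : SmoothM N U) :
    cdM a b (fun q => M q + N q) p = cdM a b M p + cdM a b N p := by
  ext i j
  exact cd_add (differentiableAt_of_contDiffOn hU hp (hM i j))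
    (differentiableAt_of_contDiffOn hU hp (hN i j))

lemma cdM_mul (hU : IsOpen U) (hp : p ∈ U) (hM : SmoothM M U) (hN : SmoothM N U) :
    cdM a b (fun q => M q * N q) p = cdM a b M p * N p + M p * cdM a b N p := by
  have dM := fun i j => differentiableAt_of_contDiffOn hU hp (hM i j)
  have dN := fun i j => differentiableAt_of_contDiffOn hU hp (hN i j)
  ext i j
  simp only [cdM_apply, Matrix.mul_apply, Matrix.add_apply]
  rw [cd_sum (f := fun k q => M q i k * N q k j) _ fun k _ => (dM i k).mul (dN k j),
    ← Finset.sum_add_distrib]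
  exact Finset.sum_congr rfl fun k _ => cd_mul (dM i k) (dN k j)

lemma cd_trace (hU : IsOpen U) (hp : p ∈ U) (hM : SmoothM M U) :
    cd a b (fun q => (M q).trace) p = (cdM a b M p).trace :=
  cd_sum _ fun k _ => differentiableAt_of_contDiffOn hU hp (hM k k)

/-- Differentiate `M⁻¹ M = 1`. -/
lemma cdM_inv (hU : IsOpen U) (hp : p ∈ U) (hM : SmoothM M U) (hdet : ∀ q ∈ U, (M q).det ≠ 0) :
    cdM a b (fun q => (M q)⁻¹) p = -((M p)⁻¹ * cdM a b M p * (M p)⁻¹) := by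
  have h1 : ∀ q ∈ U, (M q)⁻¹ * M q = 1 := fun q hq =>
    Matrix.nonsing_inv_mul _ (isUnit_iff_ne_zero.2 (hdet q hq))
  have h2 := cdM_mul (a := a) (b := b) hU hp (hM.inv hdet) hM
  rw [cdM_congr_on hU hp h1, cdM_const] at h2
  have h3 : M p * (M p)⁻¹ = 1 := Matrix.mul_nonsing_inv _ (isUnit_iff_ne_zero.2 (hdet p hp))
  have h4 := congrArg (· * (M p)⁻¹) h2
  simp only [zero_mul, add_mul, mul_assoc, h3, mul_one] at h4
  rw [eq_neg_iff_add_eq_zero, mul_assoc]; exact h4.symm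

/-- Jacobi's formula. -/
lemma cd_det (hU : IsOpen U) (hp : p ∈ U) (hM : SmoothM M U) :
    cd a b (fun q => (M q).det) p = ((M p).adjugate * cdM a b M p).trace := by
  have dM := fun i j => differentiableAt_of_contDiffOn hU hp (hM i j)
  have key : ∀ v, fderiv ℝ (fun q => (M q).det) p v
      = ∑ i, ∑ j, (M p).adjugate j i * fderiv ℝ (fun q => M q i j) p v := by
    intro v
    have hd : ∀ i, HasFDerivAt (fun q => M q i)
        (ContinuousLinearMap.pi fun j => fderiv ℝ (fun q => M q i j) p) p := fun i =>
      hasFDerivAt_pi.2 fun j => (dM i j).hasFDerivAt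
    -- The determinant is multilinear over `ℝ` in the rows, so its derivative replaces one row at a
    -- time; Cramer's rule turns these determinants into adjugate entries.
    let D : ContinuousMultilinearMap ℝ (fun _ : Fin n => Fin n → ℂ) ℂ :=
      { toMultilinearMap :=
          (Matrix.detRowAlternating (R := ℂ) (n := Fin n)).toMultilinearMap.restrictScalars ℝ
        cont := by
          change Continuous fun m : Fin n → Fin n → ℂ => Matrix.det (Matrix.of m)
          exact Continuous.matrix_det continuous_id }
    have hD : HasFDerivAt (fun q => (M q).det)
        ((D.linearDeriv (fun i => M p i)).comp (ContinuousLinearMap.pi fun i =>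
          ContinuousLinearMap.pi fun j => fderiv ℝ (fun q => M q i j) p)) p :=
      (D.hasFDerivAt (fun i => M p i)).comp p (hasFDerivAt_pi.2 hd)
    rw [hD.fderiv]
    simp only [ContinuousLinearMap.comp_apply, ContinuousMultilinearMap.linearDeriv_apply]
    refine Finset.sum_congr rfl fun i _ => ?_
    change Matrix.det (Matrix.updateRow (M p) i _) = _
    rw [← Matrix.cramer_transpose_apply, Matrix.cramer_eq_adjugate_mulVec, Matrix.mulVec,
      dotProduct]
    refine Finset.sum_congr rfl fun j _ => ?_
    rw [← Matrix.adjugate_transpose]; rfl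
  have e : ((M p).adjugate * cdM a b M p).trace
      = ∑ i, ∑ j, (M p).adjugate j i * cd a b (fun q => M q i j) p := by
    simp only [Matrix.trace, Matrix.diag_apply, Matrix.mul_apply, cdM_apply]
    rw [Finset.sum_comm]
  rw [e]
  simp only [cd, key, mul_add, Finset.sum_add_distrib, Finset.mul_sum]
  congr 1
  refine Finset.sum_congr rfl fun i _ => Finset.sum_congr rfl fun j _ => by ring

end CdM

/-! ### Second derivatives of traces, inverses and logarithms of determinants -/

section SecondOrder

variable {F : Type*} [NormedAddCommGroup F] [NormedSpace ℝ F] {n : ℕ}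
variable {a b a' b' : F} {M N : F → Matrix (Fin n) (Fin n) ℂ} {p : F} {U : Set F}

open Matrix

lemma cdM_of_isHermitian (hU : IsOpen U) (hp : p ∈ U) (hM : ∀ q ∈ U, (M q).IsHermitian) :
    cdM a b M p = (cdM a (-b) M p)ᴴ := by
  ext i j
  rw [conjTranspose_apply, cdM_apply, cdM_apply, Complex.star_def, ← cd_conj]
  exact cd_congr_on hU hp fun q hq => ((hM q hq).apply i j).symm

lemma posDef_det_re {A : Matrix (Fin n) (Fin n) ℂ} (hA : A.PosDef) :
    A.det = ((A.det.re : ℝ) : ℂ) ∧ 0 < A.det.re := by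
  have h := hA.det_pos
  rw [Complex.lt_def] at h
  exact ⟨Complex.ext (by simp) (by simpa using h.2.symm), by simpa using h.1⟩

lemma cd_log_det (hU : IsOpen U) (hp : p ∈ U) (hM : SmoothM M U) (hpos : ∀ q ∈ U, (M q).PosDef) :
    cd a b (fun q => ((Real.log (M q).det.re : ℝ) : ℂ)) p = ((M p)⁻¹ * cdM a b M p).trace := by
  obtain ⟨h1, h2⟩ := posDef_det_re (hpos p hp)
  have hd : DifferentiableAt ℝ (fun q => (M q).det) p :=
    differentiableAt_of_contDiffOn hU hp hM.det
  have hr : DifferentiableAt ℝ (fun q => (M q).det.re) p :=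
    Complex.reCLM.differentiableAt.comp p hd
  rw [cd_ofReal_comp hr (Real.hasDerivAt_log h2.ne'),
    cd_congr_on hU hp fun q hq => (posDef_det_re (hpos q hq)).1.symm, cd_det hU hp hM,
    Matrix.inv_def, Ring.inverse_eq_inv', Matrix.smul_mul, Matrix.trace_smul, smul_eq_mul]
  congr 1
  rw [Complex.ofReal_inv, ← h1]

lemma contDiffOn_log_det (hM : SmoothM M U) (hpos : ∀ q ∈ U, (M q).PosDef) :
    ContDiffOn ℝ ∞ (fun q => Real.log (M q).det.re) U :=
  (Complex.reCLM.contDiff.comp_contDiffOn hM.det).log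
    fun q hq => (posDef_det_re (hpos q hq)).2.ne'

lemma contDiffOn_ofReal {r : F → ℝ} (hr : ContDiffOn ℝ ∞ r U) :
    ContDiffOn ℝ ∞ (fun q => ((r q : ℝ) : ℂ)) U :=
  Complex.ofRealCLM.contDiff.comp_contDiffOn hr

lemma cd_cd_trace_mul (hU : IsOpen U) (hp : p ∈ U) (hM : SmoothM M U) (hN : SmoothM N U) :
    cd a b (cd a' b' fun q => (M q * N q).trace) p
      = (cdM a b (cdM a' b' M) p * N p).trace + (cdM a' b' M p * cdM a b N p).trace
        + (cdM a b M p * cdM a' b' N p).trace + (M p * cdM a b (cdM a' b' N) p).trace := by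
  have e : ∀ q ∈ U, cd a' b' (fun q => (M q * N q).trace) q
      = (cdM a' b' M q * N q + M q * cdM a' b' N q).trace := fun q hq => by
    rw [cd_trace hU hq (hM.mul hN), cdM_mul hU hq hM hN]
  have s1 := (hM.cdM (a := a') (b := b') hU).mul hN
  have s2 := hM.mul (hN.cdM (a := a') (b := b') hU)
  rw [cd_congr_on hU hp e, cd_trace hU hp (s1.add s2), cdM_add hU hp s1 s2,
    cdM_mul hU hp (hM.cdM hU) hN, cdM_mul hU hp hM (hN.cdM hU)]
  simp only [Matrix.trace_add]
  ring

lemma cd_cd_log_det (hU : IsOpen U) (hp : p ∈ U) (hM : SmoothM M U)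
    (hpos : ∀ q ∈ U, (M q).PosDef) :
    cd a b (cd a' b' fun q => ((Real.log (M q).det.re : ℝ) : ℂ)) p
      = ((M p)⁻¹ * cdM a b (cdM a' b' M) p).trace
        - ((M p)⁻¹ * cdM a b M p * ((M p)⁻¹ * cdM a' b' M p)).trace := by
  have hdet : ∀ q ∈ U, (M q).det ≠ 0 := fun q hq => (hpos q hq).det_pos.ne'
  rw [cd_congr_on hU hp fun q hq => cd_log_det hU hq hM hpos,
    cd_trace hU hp ((hM.inv hdet).mul (hM.cdM hU)), cdM_mul hU hp (hM.inv hdet) (hM.cdM hU),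
    cdM_inv hU hp hM hdet]
  simp only [Matrix.trace_add, Matrix.neg_mul, Matrix.trace_neg, Matrix.mul_assoc]
  ring

/-- The first derivative formula for the inverse is differentiated once more; at `p` every factor
`M⁻¹` is the identity. -/
lemma cdM_cdM_inv_of_eq_one (hU : IsOpen U) (hp : p ∈ U) (hM : SmoothM M U)
    (hdet : ∀ q ∈ U, (M q).det ≠ 0) (h1 : M p = 1) :
    cdM a b (cdM a' b' fun q => (M q)⁻¹) p
      = cdM a b M p * cdM a' b' M p + cdM a' b' M p * cdM a b M p
        - cdM a b (cdM a' b' M) p := by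
  have hI := hM.inv hdet
  have hD := hM.cdM (a := a') (b := b') hU
  have e : ∀ q ∈ U, cdM a' b' (fun q => (M q)⁻¹) q
      + (M q)⁻¹ * cdM a' b' M q * (M q)⁻¹ = 0 := fun q hq => by
    rw [cdM_inv hU hq hM hdet]; simp
  have h := cdM_congr_on (a := a) (b := b) hU hp e
  rw [cdM_const, cdM_add hU hp (hI.cdM hU) ((hI.mul hD).mul hI),
    cdM_mul hU hp (hI.mul hD) hI, cdM_mul hU hp hI hD, cdM_inv hU hp hM hdet, h1] at h
  simp only [inv_one, one_mul, mul_one, Matrix.neg_mul, Matrix.mul_neg] at h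
  rw [eq_sub_iff_add_eq]
  rw [← sub_eq_zero]
  convert h using 1
  abel

end SecondOrder

/-! ### Holomorphic frames -/

section Frame

variable {n : ℕ}

/-- The derivative along the constant `(1,0)` vector field defined by `v`. -/
def dv (v : Cn n) : (Cn n → ℂ) → Cn n → ℂ :=
  cd ((1 / 2 : ℝ) • v) (-((1 / 2 : ℝ) • (Complex.I • v)))

/-- The derivative along the constant `(0,1)` vector field defined by `v`. -/
def dvb (v : Cn n) : (Cn n → ℂ) → Cn n → ℂ :=
  cd ((1 / 2 : ℝ) • v) ((1 / 2 : ℝ) • (Complex.I • v))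

/-- Entrywise version of `dv`. -/
def dvM (v : Cn n) : (Cn n → Matrix (Fin n) (Fin n) ℂ) → Cn n → Matrix (Fin n) (Fin n) ℂ :=
  cdM ((1 / 2 : ℝ) • v) (-((1 / 2 : ℝ) • (Complex.I • v)))

/-- Entrywise version of `dvb`. -/
def dvbM (v : Cn n) : (Cn n → Matrix (Fin n) (Fin n) ℂ) → Cn n → Matrix (Fin n) (Fin n) ℂ :=
  cdM ((1 / 2 : ℝ) • v) ((1 / 2 : ℝ) • (Complex.I • v))

lemma dz_eq_dv (i : Fin n) : dz i = dv (basisVec i) := by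
  funext f z
  simp [dz, dv, cd]; ring

lemma dzbar_eq_dvb (i : Fin n) : dzbar i = dvb (basisVec i) := by
  funext f z
  simp [dzbar, dvb, cd]; ring

/-- The complex Hessian in the frame `v`. -/
def hessF (v : Fin n → Cn n) (u : Cn n → ℝ) (z : Cn n) : Matrix (Fin n) (Fin n) ℂ :=
  Matrix.of fun i j => dv (v i) (dvb (v j) fun q => ((u q : ℝ) : ℂ)) z

variable {U : Set (Cn n)} {z : Cn n} {u : Cn n → ℝ} {v : Fin n → Cn n}

lemma smoothM_hessF (hU : IsOpen U) (hu : ContDiffOn ℝ ∞ u U) : SmoothM (hessF v u) U :=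
  fun _ _ => contDiffOn_cd hU (contDiffOn_cd hU (contDiffOn_ofReal hu))

/-- For real `u`, conjugation swaps `∂` and `∂̄`, and these commute. -/
lemma isHermitian_hessF (hU : IsOpen U) (hu : ContDiffOn ℝ ∞ u U) (hz : z ∈ U) :
    (hessF v u z).IsHermitian := by
  ext i j
  rw [Matrix.conjTranspose_apply, Complex.star_def]
  change conj (dv (v j) (dvb (v i) _) z) = dv (v i) (dvb (v j) _) z
  have h1 : ∀ q, dvb (v i) (fun q => ((u q : ℝ) : ℂ)) q
      = conj (dv (v i) (fun q => ((u q : ℝ) : ℂ)) q) := fun q => by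
    rw [dv, ← cd_conj]
    simp only [Complex.conj_ofReal]
    rfl
  have h2 : dv (v j) (dvb (v i) fun q => ((u q : ℝ) : ℂ)) z
      = conj (dvb (v j) (dv (v i) fun q => ((u q : ℝ) : ℂ)) z) := by
    rw [funext h1, dv, cd_conj, neg_neg]; rfl
  rw [h2, Complex.conj_conj]
  exact cd_comm hU hz (contDiffOn_ofReal hu)

end Frame

/-! ### Completing the square in the third order terms -/

section LocalEstimate

variable {n : ℕ}

open Matrix

/-- Expanding `‖X + l' b‖²` reproduces exactly the cross term between `X` (a derivative of `m`) and
`b` (a derivative of the inverse of `h`); only the torsion part `τ` needs an estimate. -/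
lemma normSq_div_add_cross (X b τ : ℂ) {l l' : ℝ} (hl : 0 < l) (hl' : 0 < l') :
    ‖X + l' * b‖ ^ 2 / (l * l') - l' / l * ‖b‖ ^ 2 - 2 / l * (‖b‖ * ‖τ‖)
      ≤ ‖X‖ ^ 2 / (l * l') + 2 / l * (b * conj (X + τ)).re := by
  have h1 : ‖X + l' * b‖ ^ 2 = ‖X‖ ^ 2 + 2 * l' * (b * conj X).re + l' ^ 2 * ‖b‖ ^ 2 := by
    simp only [← Complex.normSq_eq_norm_sq, Complex.normSq_apply]
    simp
    ring
  have h2 : -(‖b‖ * ‖τ‖) ≤ (b * conj τ).re := by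
    have := (Complex.abs_re_le_norm (b * conj τ))
    rw [norm_mul, Complex.norm_conj] at this
    exact (abs_le.1 this).1
  have h3 : (b * conj (X + τ)).re = (b * conj X).re + (b * conj τ).re := by
    rw [map_add, mul_add, Complex.add_re]
  have h4 : ‖X + l' * b‖ ^ 2 / (l * l')
      = ‖X‖ ^ 2 / (l * l') + 2 / l * (b * conj X).re + l' / l * ‖b‖ ^ 2 := by
    rw [h1]; field_simp
  rw [h3, h4, mul_add]
  have := mul_le_mul_of_nonneg_left h2 (by positivity : 0 ≤ 2 / l)
  linarith

/-- Completing the square in the third order terms. -/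
lemma sum_completing_square (X b τ : Fin n → Fin n → Fin n → ℂ) (l : Fin n → ℝ)
    (hl : ∀ i, 0 < l i) {B : ℝ} (hB : 0 ≤ B) (hb : ∀ p i j, ‖b p i j‖ ≤ B)
    (hτ : ∀ p i j, ‖τ p i j‖ ≤ 2 * B) :
    (∑ p, ∑ i, ‖X i p i + l i * b p i i‖ ^ 2 / (l p * l i))
        - n * B ^ 2 * ((∑ i, l i) * ∑ i, (l i)⁻¹) - 4 * n ^ 2 * B ^ 2 * ∑ i, (l i)⁻¹
      ≤ (∑ p, ∑ i, ∑ j, ‖X i p j‖ ^ 2 / (l p * l j))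
        + ∑ p, ∑ i, ∑ j, 2 / l p * (b p i j * conj (X i p j + τ p i j)).re := by
  have h1 : ∀ p i j, ‖X i p j + l j * b p i j‖ ^ 2 / (l p * l j)
      - l j / l p * B ^ 2 - 2 / l p * (B * (2 * B))
      ≤ ‖X i p j‖ ^ 2 / (l p * l j) + 2 / l p * (b p i j * conj (X i p j + τ p i j)).re := by
    intro p i j
    refine le_trans ?_ (normSq_div_add_cross _ _ _ (hl p) (hl j))
    have e1 : ‖b p i j‖ ^ 2 ≤ B ^ 2 := pow_le_pow_left₀ (norm_nonneg _) (hb p i j) 2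
    have e2 : ‖b p i j‖ * ‖τ p i j‖ ≤ B * (2 * B) :=
      mul_le_mul (hb p i j) (hτ p i j) (norm_nonneg _) hB
    have e3 := mul_le_mul_of_nonneg_left e1 (div_nonneg (hl j).le (hl p).le)
    have e4 := mul_le_mul_of_nonneg_left e2 (div_nonneg zero_le_two (hl p).le)
    linarith
  have h2 := Finset.sum_le_sum fun p (_ : p ∈ Finset.univ) => Finset.sum_le_sum
    fun i (_ : i ∈ Finset.univ) => Finset.sum_le_sum fun j (_ : j ∈ Finset.univ) => h1 p i j
  simp only [Finset.sum_add_distrib, Finset.sum_sub_distrib] at h2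
  refine le_trans ?_ h2
  -- Only the terms `j = i` are kept: these are the summands that make up the derivative of the
  -- trace.
  have h3 : ∑ p, ∑ i, ‖X i p i + l i * b p i i‖ ^ 2 / (l p * l i)
      ≤ ∑ p, ∑ i, ∑ j, ‖X i p j + l j * b p i j‖ ^ 2 / (l p * l j) :=
    Finset.sum_le_sum fun p _ => Finset.sum_le_sum fun i _ =>
      Finset.single_le_sum (f := fun j => ‖X i p j + l j * b p i j‖ ^ 2 / (l p * l j))
        (fun j _ => div_nonneg (sq_nonneg _) (mul_pos (hl p) (hl j)).le) (Finset.mem_univ i)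
  have h4 : ∑ p, ∑ _i : Fin n, ∑ j, l j / l p * B ^ 2
      = n * B ^ 2 * ((∑ i, l i) * ∑ i, (l i)⁻¹) := by
    simp only [Finset.sum_const, Finset.card_univ, Fintype.card_fin, nsmul_eq_mul,
      Finset.mul_sum, Finset.sum_mul]
    exact Finset.sum_congr rfl fun i _ => Finset.sum_congr rfl fun j _ => by
      simp only [div_eq_mul_inv]; ring
  have h5 : ∑ p, ∑ _i : Fin n, ∑ _j : Fin n, 2 / l p * (B * (2 * B))
      = 4 * n ^ 2 * B ^ 2 * ∑ i, (l i)⁻¹ := by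
    simp only [Finset.sum_const, Finset.card_univ, Fintype.card_fin, nsmul_eq_mul,
      Finset.mul_sum]
    exact Finset.sum_congr rfl fun i _ => by simp only [div_eq_mul_inv]; ring
  rw [h4, h5]
  linarith

/-- Cauchy-Schwarz for the gradient of the trace. -/
lemma sum_norm_sq_le (Z : Fin n → ℂ) (l : Fin n → ℝ) (hl : ∀ i, 0 < l i) :
    ‖∑ i, Z i‖ ^ 2 ≤ (∑ i, l i) * ∑ i, ‖Z i‖ ^ 2 / l i := by
  have h1 : ‖∑ i, Z i‖ ^ 2 ≤ (∑ i, ‖Z i‖) ^ 2 :=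
    pow_le_pow_left₀ (norm_nonneg _) (norm_sum_le _ _) 2
  refine h1.trans ?_
  exact Finset.sum_sq_le_sum_mul_sum_of_sq_le_mul _ (fun i _ => (hl i).le)
    (fun i _ => div_nonneg (sq_nonneg _) (hl i).le)
    (fun i _ => (mul_div_cancel₀ _ (hl i).ne').ge)

variable {U : Set (Cn n)} {z : Cn n} {u f F : Cn n → ℝ} {v : Fin n → Cn n}
  {h : Cn n → Matrix (Fin n) (Fin n) ℂ}

lemma dvbM_eq_conjTranspose {M : Cn n → Matrix (Fin n) (Fin n) ℂ} (hU : IsOpen U) (hz : z ∈ U)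
    (hM : ∀ q ∈ U, (M q).IsHermitian) (w : Cn n) : dvbM w M z = (dvM w M z)ᴴ :=
  cdM_of_isHermitian hU hz hM

/-- The four-fold derivatives of a potential are symmetric. -/
lemma dv_dvb_hessF_swap (hU : IsOpen U) (hz : z ∈ U) (hu : ContDiffOn ℝ ∞ u U) (p i : Fin n) :
    dvM (v p) (dvbM (v p) (hessF v u)) z i i = dvM (v i) (dvbM (v i) (hessF v u)) z p p := by
  set w : Cn n → ℂ := fun q => ((u q : ℝ) : ℂ) with hw
  have sw : ContDiffOn ℝ ∞ w U := contDiffOn_ofReal hu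
  change dv (v p) (dvb (v p) (dv (v i) (dvb (v i) w))) z
    = dv (v i) (dvb (v i) (dv (v p) (dvb (v p) w))) z
  have e1 : ∀ q ∈ U, dvb (v p) (dv (v i) (dvb (v i) w)) q
      = dv (v i) (dvb (v i) (dvb (v p) w)) q := fun q hq => by
    have : ∀ q ∈ U, dvb (v p) (dvb (v i) w) q = dvb (v i) (dvb (v p) w) q := fun q hq =>
      cd_comm hU hq sw
    rw [← show dv (v i) (dvb (v p) (dvb (v i) w)) q = dv (v i) (dvb (v i) (dvb (v p) w)) q from
      cd_congr_on hU hq this]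
    exact cd_comm hU hq (contDiffOn_cd hU sw)
  have e2 : ∀ q ∈ U, dv (v p) (dvb (v i) (dvb (v p) w)) q
      = dvb (v i) (dv (v p) (dvb (v p) w)) q := fun q hq =>
    cd_comm hU hq (contDiffOn_cd hU sw)
  calc dv (v p) (dvb (v p) (dv (v i) (dvb (v i) w))) z
      = dv (v p) (dv (v i) (dvb (v i) (dvb (v p) w))) z := cd_congr_on hU hz e1
    _ = dv (v i) (dv (v p) (dvb (v i) (dvb (v p) w))) z :=
        cd_comm hU hz (contDiffOn_cd hU (contDiffOn_cd hU sw))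
    _ = _ := cd_congr_on hU hz e2

/-- The first derivatives of the Hessian are symmetric. -/
lemma dv_hessF_swap (hU : IsOpen U) (hz : z ∈ U) (hu : ContDiffOn ℝ ∞ u U) (p i j : Fin n) :
    dvM (v p) (hessF v u) z i j = dvM (v i) (hessF v u) z p j :=
  cd_comm hU hz (contDiffOn_cd hU (contDiffOn_ofReal hu))

end LocalEstimate

/-! ### The differential inequality for the trace -/

section LocalEstimate

variable {n : ℕ}

open Matrix

variable {U : Set (Cn n)} {z : Cn n} {u f F : Cn n → ℝ} {v : Fin n → Cn n}
  {h m : Cn n → Matrix (Fin n) (Fin n) ℂ} {l : Fin n → ℝ}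

/-- The complex Laplacian of the trace of `m` with respect to `h` at a point where `h` is the
identity and `m` is diagonal. -/
lemma re_dv_dvb_trace (hU : IsOpen U) (hz : z ∈ U) (sh : SmoothM h U) (sm : SmoothM m U)
    (hh : ∀ q ∈ U, (h q).PosDef) (hm : ∀ q ∈ U, (m q).PosDef) (h1 : h z = 1)
    (hml : m z = diagonal fun i => (l i : ℂ)) (w : Cn n) :
    (dv w (dvb w fun q => ((h q)⁻¹ * m q).trace) z).re
      = ∑ i, l i * (dvM w (dvbM w fun q => (h q)⁻¹) z i i).re
        + ∑ i, ∑ j, 2 * (dvM w (fun q => (h q)⁻¹) z i j * conj (dvM w m z i j)).re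
        + ∑ i, (dvM w (dvbM w m) z i i).re := by
  have hdet : ∀ q ∈ U, (h q).det ≠ 0 := fun q hq => (hh q hq).det_pos.ne'
  have sk := sh.inv hdet
  have e := cd_cd_trace_mul (a := (1 / 2 : ℝ) • w) (b := -((1 / 2 : ℝ) • (Complex.I • w)))
    (a' := (1 / 2 : ℝ) • w) (b' := (1 / 2 : ℝ) • (Complex.I • w)) hU hz sk sm
  have hk : dvbM w (fun q => (h q)⁻¹) z = (dvM w (fun q => (h q)⁻¹) z)ᴴ :=
    dvbM_eq_conjTranspose hU hz (fun q hq => (hh q hq).inv.isHermitian) w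
  have hm' : dvbM w m z = (dvM w m z)ᴴ :=
    dvbM_eq_conjTranspose hU hz (fun q hq => (hm q hq).isHermitian) w
  change dv w (dvb w fun q => ((h q)⁻¹ * m q).trace) z
    = (dvM w (dvbM w fun q => (h q)⁻¹) z * m z).trace
      + (dvbM w (fun q => (h q)⁻¹) z * dvM w m z).trace
      + (dvM w (fun q => (h q)⁻¹) z * dvbM w m z).trace
      + ((h z)⁻¹ * dvM w (dvbM w m) z).trace at e
  rw [e, hk, hm', h1, hml, inv_one, one_mul]
  have t2 : ((dvM w (fun q => (h q)⁻¹) z)ᴴ * dvM w m z).trace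
      = conj ((dvM w (fun q => (h q)⁻¹) z * (dvM w m z)ᴴ).trace) := by
    rw [starRingEnd_apply, ← trace_conjTranspose, conjTranspose_mul, conjTranspose_conjTranspose,
      trace_mul_comm]
  rw [t2]
  simp only [Complex.add_re, Complex.conj_re]
  have t3 : ((dvM w (fun q => (h q)⁻¹) z * (dvM w m z)ᴴ).trace).re
      = ∑ i, ∑ j, (dvM w (fun q => (h q)⁻¹) z i j * conj (dvM w m z i j)).re := by
    simp only [trace, diag_apply, mul_apply, conjTranspose_apply, Complex.re_sum]
    rfl
  have t1 : (dvM w (dvbM w fun q => (h q)⁻¹) z * diagonal fun i => (l i : ℂ)).trace.re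
      = ∑ i, l i * (dvM w (dvbM w fun q => (h q)⁻¹) z i i).re := by
    simp only [trace, diag_apply, mul_diagonal, Complex.re_sum]
    exact Finset.sum_congr rfl fun i _ => by rw [mul_comm, Complex.re_ofReal_mul]
  have t4 : (dvM w (dvbM w m) z).trace.re = ∑ i, (dvM w (dvbM w m) z i i).re := by
    simp only [trace, diag_apply, Complex.re_sum]
  rw [t1, t3, t4]
  simp only [← Finset.mul_sum]
  ring

/-- The complex Hessian of `log det m` at a point where `m` is diagonal. -/
lemma re_dv_dvb_log_det (hU : IsOpen U) (hz : z ∈ U) (sm : SmoothM m U)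
    (hm : ∀ q ∈ U, (m q).PosDef) (hl : ∀ i, 0 < l i)
    (hml : m z = diagonal fun i => (l i : ℂ)) (w : Cn n) :
    (dv w (dvb w fun q => ((Real.log (m q).det.re : ℝ) : ℂ)) z).re
      = ∑ p, (l p)⁻¹ * (dvM w (dvbM w m) z p p).re
        - ∑ p, ∑ j, ‖dvM w m z p j‖ ^ 2 / (l p * l j) := by
  have e := cd_cd_log_det (a := (1 / 2 : ℝ) • w) (b := -((1 / 2 : ℝ) • (Complex.I • w)))
    (a' := (1 / 2 : ℝ) • w) (b' := (1 / 2 : ℝ) • (Complex.I • w)) hU hz sm hm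
  have hm' : dvbM w m z = (dvM w m z)ᴴ :=
    dvbM_eq_conjTranspose hU hz (fun q hq => (hm q hq).isHermitian) w
  change dv w (dvb w fun q => ((Real.log (m q).det.re : ℝ) : ℂ)) z
    = ((m z)⁻¹ * dvM w (dvbM w m) z).trace
      - ((m z)⁻¹ * dvM w m z * ((m z)⁻¹ * dvbM w m z)).trace at e
  have hinv : (m z)⁻¹ = diagonal fun i => (((l i)⁻¹ : ℝ) : ℂ) := by
    rw [hml]
    refine Matrix.inv_eq_left_inv ?_
    rw [diagonal_mul_diagonal, ← diagonal_one]
    congr 1; funext i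
    rw [← Complex.ofReal_mul, inv_mul_cancel₀ (hl i).ne', Complex.ofReal_one]
  rw [e, hm', hinv, Complex.sub_re]
  congr 1
  · simp only [trace, diag_apply, diagonal_mul, Complex.re_sum, Complex.re_ofReal_mul]
  · simp only [trace, diag_apply, Complex.re_sum]
    refine Finset.sum_congr rfl fun p _ => ?_
    rw [mul_apply, Complex.re_sum]
    refine Finset.sum_congr rfl fun j _ => ?_
    rw [diagonal_mul, diagonal_mul, conjTranspose_apply]
    have : (((l p)⁻¹ : ℝ) : ℂ) * dvM w m z p j * ((((l j)⁻¹ : ℝ) : ℂ) * star (dvM w m z p j))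
        = ((((l p)⁻¹ * (l j)⁻¹ * ‖dvM w m z p j‖ ^ 2 : ℝ)) : ℂ) := by
      rw [Complex.star_def]
      push_cast
      rw [← Complex.mul_conj']; ring
    rw [this, Complex.ofReal_re, div_eq_mul_inv, mul_inv]; ring

lemma dv_dvb_sub {f₁ f₂ : Cn n → ℂ} (hU : IsOpen U) (hz : z ∈ U) (h₁ : ContDiffOn ℝ ∞ f₁ U)
    (h₂ : ContDiffOn ℝ ∞ f₂ U) (w w' : Cn n) :
    dv w (dvb w' fun q => f₁ q - f₂ q) z = dv w (dvb w' f₁) z - dv w (dvb w' f₂) z := by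
  have e : ∀ q ∈ U, dvb w' (fun q => f₁ q - f₂ q) q = dvb w' f₁ q - dvb w' f₂ q := fun q hq =>
    cd_sub (differentiableAt_of_contDiffOn hU hq h₁) (differentiableAt_of_contDiffOn hU hq h₂)
  rw [show dv w (dvb w' fun q => f₁ q - f₂ q) z = dv w (fun q => dvb w' f₁ q - dvb w' f₂ q) z from
    cd_congr_on hU hz e]
  exact cd_sub (differentiableAt_of_contDiffOn hU hz (contDiffOn_cd hU h₁))
    (differentiableAt_of_contDiffOn hU hz (contDiffOn_cd hU h₂))

lemma log_det_div_re {A B : Matrix (Fin n) (Fin n) ℂ} (hA : A.PosDef) (hB : B.PosDef) :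
    Real.log (A.det / B.det).re = Real.log A.det.re - Real.log B.det.re := by
  obtain ⟨a1, a2⟩ := posDef_det_re hA
  obtain ⟨b1, b2⟩ := posDef_det_re hB
  rw [a1, b1, ← Complex.ofReal_div, Complex.ofReal_re, Real.log_div a2.ne' b2.ne']
  simp

/-- The basic differential inequality for the trace of `m = h + ∂∂̄u` along the flow. -/
theorem laplacian_trace_ge (hU : IsOpen U) (hz : z ∈ U) (sh : SmoothM h U)
    (hu : ContDiffOn ℝ ∞ u U) (hF : ContDiffOn ℝ ∞ F U)
    (hh : ∀ q ∈ U, (h q).PosDef) (hmdef : ∀ q, m q = h q + hessF v u q)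
    (hm : ∀ q ∈ U, (m q).PosDef)
    (heq : ∀ q ∈ U, f q = Real.log ((m q).det / (h q).det).re - F q)
    (h1 : h z = 1) (hl : ∀ i, 0 < l i) (hml : m z = diagonal fun i => (l i : ℂ))
    {B : ℝ} (hB : 0 ≤ B) (hB1 : ∀ p i j, ‖dvM (v p) h z i j‖ ≤ B)
    (hB2 : ∀ p i j, ‖dvM (v p) (dvbM (v p) h) z i j‖ ≤ B) :
    ∃ (Z : Fin n → Fin n → ℂ) (τ : Fin n → ℂ), (∀ p, ‖τ p‖ ≤ n * (2 * B)) ∧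
      (∀ p, dv (v p) (fun q => ((h q)⁻¹ * m q).trace) z = ∑ i, Z p i + τ p) ∧
      (∑ p, ∑ i, ‖Z p i‖ ^ 2 / (l p * l i))
        - (2 * n * B ^ 2 + B + n * B ^ 2) * ((∑ i, l i) * ∑ i, (l i)⁻¹)
        - (4 * n ^ 2 * B ^ 2 + 2 * n * B) * (∑ i, (l i)⁻¹)
        - (n ^ 2 * B + n ^ 3 * B ^ 2)
        + ∑ i, (dv (v i) (dvb (v i) fun q => ((F q : ℝ) : ℂ)) z).re
      ≤ ∑ p, (l p)⁻¹ * (dv (v p) (dvb (v p) fun q => ((h q)⁻¹ * m q).trace) z).re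
        - ∑ i, (dv (v i) (dvb (v i) fun q => ((f q : ℝ) : ℂ)) z).re := by
  have hdet : ∀ q ∈ U, (h q).det ≠ 0 := fun q hq => (hh q hq).det_pos.ne'
  have sk := sh.inv hdet
  have sH : SmoothM (hessF v u) U := smoothM_hessF hU hu
  have mfun : m = fun q => h q + hessF v u q := funext hmdef
  have sm : SmoothM m U := by rw [mfun]; exact sh.add sH
  have dm : ∀ p, dvM (v p) m z = dvM (v p) h z + dvM (v p) (hessF v u) z := fun p => by
    rw [mfun]; exact cdM_add hU hz sh sH
  have ddm : ∀ p, dvM (v p) (dvbM (v p) m) z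
      = dvM (v p) (dvbM (v p) h) z + dvM (v p) (dvbM (v p) (hessF v u)) z := fun p => by
    have e : ∀ q ∈ U, dvbM (v p) m q = dvbM (v p) h q + dvbM (v p) (hessF v u) q :=
      fun q hq => by rw [mfun]; exact cdM_add hU hq sh sH
    rw [show dvM (v p) (dvbM (v p) m) z
      = dvM (v p) (fun q => dvbM (v p) h q + dvbM (v p) (hessF v u) q) z from
      cdM_congr_on hU hz e]
    exact cdM_add hU hz (sh.cdM hU) (sH.cdM hU)
  -- `X` lists the first derivatives of `m` in the index order produced by the Hessian of `log det
  -- m`. The trace involves the order with `p` and `i` exchanged; the difference is the torsion `t`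
  -- below, which sees only `h` because the part of `m` coming from `u` is symmetric.
  set X : Fin n → Fin n → Fin n → ℂ := fun i p j => dvM (v i) m z p j with hX
  set b : Fin n → Fin n → Fin n → ℂ := fun p i j => dvM (v p) (fun q => (h q)⁻¹) z i j with hb
  set t : Fin n → Fin n → Fin n → ℂ := fun p i j =>
    dvM (v p) h z i j - dvM (v i) h z p j with ht
  have swap : ∀ p i j, dvM (v p) m z i j = X i p j + t p i j := fun p i j => by
    simp only [hX, ht, dm, Matrix.add_apply]
    rw [dv_hessF_swap hU hz hu p i j]; ring
  have hkd : ∀ p, dvM (v p) (fun q => (h q)⁻¹) z = -dvM (v p) h z := fun p => by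
    have := cdM_inv (a := (1 / 2 : ℝ) • v p) (b := -((1 / 2 : ℝ) • (Complex.I • v p))) hU hz sh hdet
    rw [h1, inv_one, one_mul, mul_one] at this
    exact this
  have bB : ∀ p i j, ‖b p i j‖ ≤ B := fun p i j => by
    simp only [hb, hkd, Matrix.neg_apply, norm_neg]; exact hB1 p i j
  have tB : ∀ p i j, ‖t p i j‖ ≤ 2 * B := fun p i j => by
    refine (norm_sub_le _ _).trans ?_
    linarith [hB1 p i j, hB1 i p j]
  have hdb : ∀ p, dvbM (v p) h z = (dvM (v p) h z)ᴴ := fun p =>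
    dvbM_eq_conjTranspose hU hz (fun q hq => (hh q hq).isHermitian) _
  -- Since `h z = 1`, the second derivative of the inverse is `∂h ∂̄h + ∂̄h ∂h - ∂∂̄h`: each product
  -- contributes at most `n B²`, the last term at most `B`.
  have kdd : ∀ p i, -(2 * n * B ^ 2 + B)
      ≤ (dvM (v p) (dvbM (v p) fun q => (h q)⁻¹) z i i).re := fun p i => by
    have e := cdM_cdM_inv_of_eq_one (a := (1 / 2 : ℝ) • v p)
      (b := -((1 / 2 : ℝ) • (Complex.I • v p)))
      (a' := (1 / 2 : ℝ) • v p) (b' := (1 / 2 : ℝ) • (Complex.I • v p)) hU hz sh hdet h1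
    change dvM (v p) (dvbM (v p) fun q => (h q)⁻¹) z = dvM (v p) h z * dvbM (v p) h z
      + dvbM (v p) h z * dvM (v p) h z - dvM (v p) (dvbM (v p) h) z at e
    rw [e, hdb]
    have b1 : ∀ {A A' : Matrix (Fin n) (Fin n) ℂ}, (∀ i j, ‖A i j‖ ≤ B) → (∀ i j, ‖A' i j‖ ≤ B) →
        ‖(A * A') i i‖ ≤ n * B ^ 2 := fun {A A'} hA hA' => by
      rw [Matrix.mul_apply]
      refine (norm_sum_le _ _).trans ?_
      refine (Finset.sum_le_card_nsmul _ _ (B ^ 2) fun j _ => ?_).trans (by simp)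
      rw [norm_mul, sq]
      exact mul_le_mul (hA _ _) (hA' _ _) (norm_nonneg _) hB
    have c1 : ∀ i j, ‖(dvM (v p) h z)ᴴ i j‖ ≤ B := fun i j => by
      rw [conjTranspose_apply, Complex.star_def, Complex.norm_conj]; exact hB1 _ _ _
    have n1 := b1 (hB1 p) c1
    have n2 := b1 c1 (hB1 p)
    have n3 := hB2 p i i
    have := norm_sub_le ((dvM (v p) h z * (dvM (v p) h z)ᴴ) i i
      + ((dvM (v p) h z)ᴴ * dvM (v p) h z) i i) (dvM (v p) (dvbM (v p) h) z i i)
    have n4 := norm_add_le ((dvM (v p) h z * (dvM (v p) h z)ᴴ) i i)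
      (((dvM (v p) h z)ᴴ * dvM (v p) h z) i i)
    have n5 := (abs_le.1 (Complex.abs_re_le_norm ((dvM (v p) h z * (dvM (v p) h z)ᴴ) i i
      + ((dvM (v p) h z)ᴴ * dvM (v p) h z) i i - dvM (v p) (dvbM (v p) h) z i i))).1
    simp only [Matrix.add_apply, Matrix.sub_apply]
    linarith
  refine ⟨fun p i => X i p i + l i * b p i i, fun p => ∑ i, t p i i, ?_, ?_, ?_⟩
  · intro p
    refine (norm_sum_le _ _).trans ?_
    exact (Finset.sum_le_card_nsmul _ _ (2 * B) fun j _ => tB p j j).trans (by simp)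
  · intro p
    have e : dv (v p) (fun q => ((h q)⁻¹ * m q).trace) z
        = (dvM (v p) (fun q => (h q)⁻¹) z * m z + (h z)⁻¹ * dvM (v p) m z).trace := by
      rw [show dv (v p) (fun q => ((h q)⁻¹ * m q).trace) z
        = (dvM (v p) (fun q => (h q)⁻¹ * m q) z).trace from cd_trace hU hz (sk.mul sm)]
      congr 1
      exact cdM_mul hU hz sk sm
    rw [e, h1, hml, inv_one, one_mul, ← Finset.sum_add_distrib]
    simp only [trace, diag_apply, Matrix.add_apply, mul_diagonal, swap]
    refine Finset.sum_congr rfl fun i _ => ?_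
    simp only [hb]
    ring
  · have I1 : ∀ p, (dv (v p) (dvb (v p) fun q => ((h q)⁻¹ * m q).trace) z).re
        = ∑ i, l i * (dvM (v p) (dvbM (v p) fun q => (h q)⁻¹) z i i).re
          + ∑ i, ∑ j, 2 * (b p i j * conj (X i p j + t p i j)).re
          + ∑ i, (dvM (v p) (dvbM (v p) m) z i i).re := fun p => by
      rw [re_dv_dvb_trace hU hz sh sm hh hm h1 hml]
      simp only [swap, hb]
    have sLm : ContDiffOn ℝ ∞ (fun q => ((Real.log (m q).det.re : ℝ) : ℂ)) U :=
      contDiffOn_ofReal (contDiffOn_log_det sm hm)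
    have sLh : ContDiffOn ℝ ∞ (fun q => ((Real.log (h q).det.re : ℝ) : ℂ)) U :=
      contDiffOn_ofReal (contDiffOn_log_det sh hh)
    have sF : ContDiffOn ℝ ∞ (fun q => ((F q : ℝ) : ℂ)) U := contDiffOn_ofReal hF
    have I2 : ∀ i, (dv (v i) (dvb (v i) fun q => ((f q : ℝ) : ℂ)) z).re
        = (∑ p, (l p)⁻¹ * (dvM (v i) (dvbM (v i) m) z p p).re
          - ∑ p, ∑ j, ‖X i p j‖ ^ 2 / (l p * l j))
          - (∑ p, (dvM (v i) (dvbM (v i) h) z p p).re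
            - ∑ p, ∑ j, ‖dvM (v i) h z p j‖ ^ 2)
          - (dv (v i) (dvb (v i) fun q => ((F q : ℝ) : ℂ)) z).re := fun i => by
      have e : ∀ q ∈ U, ((f q : ℝ) : ℂ) = ((Real.log (m q).det.re : ℝ) : ℂ)
          - ((Real.log (h q).det.re : ℝ) : ℂ) - ((F q : ℝ) : ℂ) := fun q hq => by
        rw [heq q hq, log_det_div_re (hm q hq) (hh q hq)]; push_cast; ring
      have e' : dv (v i) (dvb (v i) fun q => ((f q : ℝ) : ℂ)) z
          = dv (v i) (dvb (v i) fun q => ((Real.log (m q).det.re : ℝ) : ℂ)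
          - ((Real.log (h q).det.re : ℝ) : ℂ) - ((F q : ℝ) : ℂ)) z :=
        cd_congr_on hU hz fun q hq => cd_congr_on hU hq e
      have hh1 : h z = diagonal fun _ : Fin n => ((1 : ℝ) : ℂ) := by
        rw [h1, ← diagonal_one]; simp
      rw [e', dv_dvb_sub hU hz (sLm.sub sLh) sF, dv_dvb_sub hU hz sLm sLh, Complex.sub_re,
        Complex.sub_re, re_dv_dvb_log_det hU hz sm hm hl hml,
        re_dv_dvb_log_det hU hz sh hh (fun _ => zero_lt_one) hh1]
      simp [hX]
    -- The fourth derivatives of `u` cancel by symmetry, so only second derivatives of `h` survive.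
    have I3 : ∀ p i, (dvM (v p) (dvbM (v p) m) z i i).re - (dvM (v i) (dvbM (v i) m) z p p).re
        = (dvM (v p) (dvbM (v p) h) z i i).re - (dvM (v i) (dvbM (v i) h) z p p).re := fun p i => by
      rw [ddm, ddm, Matrix.add_apply, Matrix.add_apply, dv_dvb_hessF_swap hU hz hu p i]
      simp
    have sq := sum_completing_square X b t l hl hB bB tB
    set σ := ∑ i, (l i)⁻¹ with hσ
    -- the four groups of error terms
    have J1 : -((2 * n * B ^ 2 + B) * ((∑ i, l i) * σ))
        ≤ ∑ p, (l p)⁻¹ * ∑ i, l i * (dvM (v p) (dvbM (v p) fun q => (h q)⁻¹) z i i).re := by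
      have : ∀ p, (l p)⁻¹ * (-(2 * n * B ^ 2 + B) * ∑ i, l i)
          ≤ (l p)⁻¹ * ∑ i, l i * (dvM (v p) (dvbM (v p) fun q => (h q)⁻¹) z i i).re := fun p => by
        refine mul_le_mul_of_nonneg_left ?_ (inv_pos.2 (hl p)).le
        rw [Finset.mul_sum]
        refine Finset.sum_le_sum fun i _ => ?_
        rw [mul_comm]
        exact mul_le_mul_of_nonneg_left (kdd p i) (hl i).le
      refine le_trans (le_of_eq ?_) (Finset.sum_le_sum fun p _ => this p)
      rw [← Finset.sum_mul]; ring
    have J2 : -(2 * n * B * σ) ≤ ∑ p, ∑ i, (l p)⁻¹ *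
        ((dvM (v p) (dvbM (v p) m) z i i).re - (dvM (v i) (dvbM (v i) m) z p p).re) := by
      have : ∀ p i, (l p)⁻¹ * (-(2 * B)) ≤ (l p)⁻¹ *
          ((dvM (v p) (dvbM (v p) m) z i i).re - (dvM (v i) (dvbM (v i) m) z p p).re) :=
        fun p i => by
          refine mul_le_mul_of_nonneg_left ?_ (inv_pos.2 (hl p)).le
          rw [I3]
          have a1 := (abs_le.1 ((Complex.abs_re_le_norm _).trans (hB2 p i i))).1
          have a2 := (abs_le.1 ((Complex.abs_re_le_norm _).trans (hB2 i p p))).2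
          linarith
      refine le_trans (le_of_eq ?_)
        (Finset.sum_le_sum fun p _ => Finset.sum_le_sum fun i _ => this p i)
      simp only [Finset.sum_const, Finset.card_univ, Fintype.card_fin, nsmul_eq_mul, hσ,
        Finset.mul_sum, ← Finset.sum_neg_distrib]
      exact Finset.sum_congr rfl fun i _ => by ring
    have J3 : -(n ^ 2 * B + n ^ 3 * B ^ 2) ≤ ∑ i, (∑ p, (dvM (v i) (dvbM (v i) h) z p p).re
            - ∑ p, ∑ j, ‖dvM (v i) h z p j‖ ^ 2) := by
      have a1 : ∀ i p, -B ≤ (dvM (v i) (dvbM (v i) h) z p p).re := fun i p =>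
        (abs_le.1 ((Complex.abs_re_le_norm _).trans (hB2 i p p))).1
      have a2 : ∀ i p j, ‖dvM (v i) h z p j‖ ^ 2 ≤ B ^ 2 := fun i p j =>
        pow_le_pow_left₀ (norm_nonneg _) (hB1 i p j) 2
      have := Finset.sum_le_sum fun i (_ : i ∈ Finset.univ) => sub_le_sub
        (Finset.sum_le_sum fun p (_ : p ∈ Finset.univ) => a1 i p)
        (Finset.sum_le_sum fun p (_ : p ∈ Finset.univ) =>
          Finset.sum_le_sum fun j (_ : j ∈ Finset.univ) => a2 i p j)
      refine le_trans (le_of_eq ?_) this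
      simp only [Finset.sum_const, Finset.card_univ, Fintype.card_fin, nsmul_eq_mul]
      ring
    have K1 : ∑ p, (l p)⁻¹ * (dv (v p) (dvb (v p) fun q => ((h q)⁻¹ * m q).trace) z).re
        = ∑ p, (l p)⁻¹ * (∑ i, l i * (dvM (v p) (dvbM (v p) fun q => (h q)⁻¹) z i i).re)
          + ∑ p, ∑ i, ∑ j, 2 / l p * (b p i j * conj (X i p j + t p i j)).re
          + ∑ p, ∑ i, (l p)⁻¹ * (dvM (v p) (dvbM (v p) m) z i i).re := by
      simp only [I1, mul_add, Finset.sum_add_distrib, Finset.mul_sum]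
      congr 2
      refine Finset.sum_congr rfl fun p _ => Finset.sum_congr rfl fun i _ =>
        Finset.sum_congr rfl fun j _ => ?_
      rw [div_eq_mul_inv]; ring
    have K2 : ∑ i, (dv (v i) (dvb (v i) fun q => ((f q : ℝ) : ℂ)) z).re
        = (∑ p, ∑ i, (l p)⁻¹ * (dvM (v i) (dvbM (v i) m) z p p).re
          - ∑ p, ∑ i, ∑ j, ‖X i p j‖ ^ 2 / (l p * l j))
          - ∑ i, (∑ p, (dvM (v i) (dvbM (v i) h) z p p).re
            - ∑ p, ∑ j, ‖dvM (v i) h z p j‖ ^ 2)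
          - ∑ i, (dv (v i) (dvb (v i) fun q => ((F q : ℝ) : ℂ)) z).re := by
      rw [Finset.sum_comm, Finset.sum_comm (f := fun p i => ∑ j, ‖X i p j‖ ^ 2 / (l p * l j))]
      simp only [I2, Finset.sum_sub_distrib]
    have K3 : ∑ p, ∑ i, (l p)⁻¹ *
        ((dvM (v p) (dvbM (v p) m) z i i).re - (dvM (v i) (dvbM (v i) m) z p p).re)
        = ∑ p, ∑ i, (l p)⁻¹ * (dvM (v p) (dvbM (v p) m) z i i).re
          - ∑ p, ∑ i, (l p)⁻¹ * (dvM (v i) (dvbM (v i) m) z p p).re := by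
      simp only [mul_sub, Finset.sum_sub_distrib]
    rw [K1, K2]
    rw [K3] at J2
    linarith

end LocalEstimate

/-! ### Second order conditions at extrema -/

section SecondOrderCondition

variable {F : Type*} [NormedAddCommGroup F] [NormedSpace ℝ F] {q : F → ℝ} {z : F}

/-- The second order necessary condition at a local maximum. -/
lemma fderiv_fderiv_nonpos_of_isLocalMax (hq : ContDiffAt ℝ 2 q z) (hmax : IsLocalMax q z) (v : F) :
    fderiv ℝ (fderiv ℝ q) z v v ≤ 0 := by
  set γ : ℝ → F := fun t => z + t • v with hγ
  have γ0 : γ 0 = z := by simp [hγ]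
  have hγd : ∀ t, HasDerivAt γ v t := fun t => by
    exact (((hasDerivAt_id t).smul_const v).const_add z).congr_deriv (one_smul ℝ v)
  have hγc : Continuous γ := by fun_prop
  have hγt : Filter.Tendsto γ (nhds 0) (nhds z) := by
    have := hγc.tendsto 0; rwa [γ0] at this
  have hdiff : ∀ᶠ y in nhds z, DifferentiableAt ℝ q y := by
    filter_upwards [hq.eventually (by simp)] with y hy using hy.differentiableAt (by simp)
  have hd1 : ∀ᶠ t in nhds (0 : ℝ), HasDerivAt (q ∘ γ) (fderiv ℝ q (γ t) v) t := by
    filter_upwards [hγt.eventually hdiff] with t ht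
    exact ht.hasFDerivAt.comp_hasDerivAt t (hγd t)
  have hder : deriv (q ∘ γ) =ᶠ[nhds 0] fun t => fderiv ℝ q (γ t) v := by
    filter_upwards [hd1] with t ht using ht.deriv
  have hD : DifferentiableAt ℝ (fderiv ℝ q) z :=
    (hq.fderiv_right (m := 1) (by norm_num)).differentiableAt (by simp)
  have hd2 : HasDerivAt (fun t => fderiv ℝ q (γ t) v) (fderiv ℝ (fderiv ℝ q) z v v) 0 := by
    have h1 : HasFDerivAt (fun y => fderiv ℝ q y v)
        ((fderiv ℝ (fderiv ℝ q) z).flip v) (γ 0) := by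
      rw [γ0]
      refine (hD.hasFDerivAt.clm_apply (hasFDerivAt_const v z)).congr_fderiv ?_
      ext w; simp
    exact h1.comp_hasDerivAt 0 (hγd 0)
  have hdd : deriv (deriv (q ∘ γ)) 0 = fderiv ℝ (fderiv ℝ q) z v v := by
    rw [hder.deriv_eq, hd2.deriv]
  have hmaxγ : IsLocalMax (q ∘ γ) 0 := by
    have : ∀ᶠ y in nhds z, q y ≤ q z := hmax
    filter_upwards [hγt.eventually this] with t ht
    simpa [γ0] using ht
  -- A positive second derivative would make `0` a local minimum as well; the function would then be
  -- constant near `0`, with zero second derivative.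
  by_contra hcon
  push Not at hcon
  have hmin : IsLocalMin (q ∘ γ) 0 := by
    refine isLocalMin_of_deriv_deriv_pos (by rw [hdd]; exact hcon) hmaxγ.deriv_eq_zero ?_
    exact hd1.self_of_nhds.continuousAt
  have hconst : (q ∘ γ) =ᶠ[nhds 0] fun _ => (q ∘ γ) 0 := by
    filter_upwards [hmaxγ, hmin] with t h1 h2 using le_antisymm h1 h2
  have h0 : deriv (q ∘ γ) =ᶠ[nhds 0] fun _ => 0 := by
    filter_upwards [hconst.eventuallyEq_nhds] with t ht
    rw [ht.deriv_eq]; simp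
  rw [← hdd, h0.deriv_eq] at hcon
  simp at hcon

lemma fderiv_fderiv_nonneg_of_isLocalMin (hq : ContDiffAt ℝ 2 q z) (hmin : IsLocalMin q z)
    (v : F) : 0 ≤ fderiv ℝ (fderiv ℝ q) z v v := by
  have h := fderiv_fderiv_nonpos_of_isLocalMax hq.neg hmin.neg v
  have e : fderiv ℝ (fun y => -q y) = fun y => -fderiv ℝ q y := by
    funext y; exact fderiv_fun_neg
  have e2 : fderiv ℝ (fderiv ℝ fun y => -q y) z = -fderiv ℝ (fderiv ℝ q) z := by
    rw [e]; exact fderiv_fun_neg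
  change fderiv ℝ (fderiv ℝ fun y => -q y) z v v ≤ 0 at h
  rw [e2] at h
  simpa using h

lemma fderiv_ofReal (hq : DifferentiableAt ℝ q z) (v : F) :
    fderiv ℝ (fun y => ((q y : ℝ) : ℂ)) z v = ((fderiv ℝ q z v : ℝ) : ℂ) := by
  have : HasFDerivAt (fun y => ((q y : ℝ) : ℂ)) (Complex.ofRealCLM.comp (fderiv ℝ q z)) z :=
    Complex.ofRealCLM.hasFDerivAt.comp z hq.hasFDerivAt
  rw [this.fderiv]; simp

lemma fderiv_fderiv_ofReal (hq : ContDiffAt ℝ 2 q z) (v w : F) :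
    fderiv ℝ (fderiv ℝ fun y => ((q y : ℝ) : ℂ)) z v w
      = ((fderiv ℝ (fderiv ℝ q) z v w : ℝ) : ℂ) := by
  have hD : DifferentiableAt ℝ (fderiv ℝ q) z :=
    (hq.fderiv_right (m := 1) (by norm_num)).differentiableAt (by simp)
  have hq' : ContDiffAt ℝ 2 (fun y => ((q y : ℝ) : ℂ)) z :=
    Complex.ofRealCLM.contDiff.contDiffAt.comp z hq
  rw [← fderiv_fderiv_apply hq', ← fderiv_fderiv_apply hq]
  have e : (fun y => fderiv ℝ (fun y => ((q y : ℝ) : ℂ)) y w)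
      =ᶠ[nhds z] fun y => ((fderiv ℝ q y w : ℝ) : ℂ) := by
    filter_upwards [hq.eventually (by simp)] with y hy
    exact fderiv_ofReal (hy.differentiableAt (by simp)) w
  rw [e.fderiv_eq]
  exact fderiv_ofReal (hD.clm_apply (differentiableAt_const w)) v

end SecondOrderCondition

/-! ### The Levi form of a real function -/

section Levi

variable {n : ℕ} {q : Cn n → ℝ} {z : Cn n}

/-- The Levi form sums the real Hessian over the directions `w` and `√-1 w`. This lets real second
order conditions imply complex ones, and conversely feeds complex Hessian bounds into the mean value
and contact set arguments. -/
lemma re_dv_dvb_ofReal (hq : ContDiffAt ℝ 2 q z) (w : Cn n) :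
    (dv w (dvb w fun y => ((q y : ℝ) : ℂ)) z).re
      = (1 / 4) * (fderiv ℝ (fderiv ℝ q) z w w
        + fderiv ℝ (fderiv ℝ q) z (Complex.I • w) (Complex.I • w)) := by
  have hq' : ContDiffAt ℝ 2 (fun y => ((q y : ℝ) : ℂ)) z :=
    Complex.ofRealCLM.contDiff.contDiffAt.comp z hq
  rw [dv, dvb, cd_cd_apply hq']
  simp only [fderiv_fderiv_ofReal hq, ← Complex.ofReal_add, ← Complex.ofReal_sub, Complex.add_re,
    Complex.ofReal_re, Complex.I_mul_re, Complex.ofReal_im]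
  simp only [map_smul, map_neg, neg_apply, smul_apply, smul_eq_mul]
  ring

lemma re_dv_dvb_nonpos_of_isLocalMax (hq : ContDiffAt ℝ 2 q z) (hmax : IsLocalMax q z)
    (w : Cn n) : (dv w (dvb w fun y => ((q y : ℝ) : ℂ)) z).re ≤ 0 := by
  rw [re_dv_dvb_ofReal hq]
  have h1 := fderiv_fderiv_nonpos_of_isLocalMax hq hmax w
  have h2 := fderiv_fderiv_nonpos_of_isLocalMax hq hmax (Complex.I • w)
  linarith

lemma dv_eq_zero_of_isLocalMax (hq : DifferentiableAt ℝ q z) (hmax : IsLocalMax q z)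
    (w : Cn n) : dv w (fun y => ((q y : ℝ) : ℂ)) z = 0 := by
  simp [dv, cd, fderiv_ofReal hq, hmax.fderiv_eq_zero]

lemma dvb_ofReal (r : Cn n → ℝ) (w : Cn n) :
    dvb w (fun y => ((r y : ℝ) : ℂ)) z = conj (dv w (fun y => ((r y : ℝ) : ℂ)) z) := by
  rw [dv, ← cd_conj]
  simp only [Complex.conj_ofReal]
  rfl

/-- Second order chain rule for a real function of a real function. -/
lemma re_dv_dvb_comp {U : Set (Cn n)} (hU : IsOpen U) (hz : z ∈ U) {r : Cn n → ℝ}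
    (hr : ContDiffOn ℝ ∞ r U) {φ φ' : ℝ → ℝ} {φ'' : ℝ}
    (h1 : ∀ y ∈ U, HasDerivAt φ (φ' (r y)) (r y)) (h2 : HasDerivAt φ' φ'' (r z)) (w : Cn n) :
    (dv w (dvb w fun y => ((φ (r y) : ℝ) : ℂ)) z).re
      = φ'' * ‖dv w (fun y => ((r y : ℝ) : ℂ)) z‖ ^ 2
        + φ' (r z) * (dv w (dvb w fun y => ((r y : ℝ) : ℂ)) z).re := by
  have hrz : DifferentiableAt ℝ r z := differentiableAt_of_contDiffOn hU hz hr
  have hrC := contDiffOn_ofReal hr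
  have e : ∀ y ∈ U, dvb w (fun y => ((φ (r y) : ℝ) : ℂ)) y
      = ((φ' (r y) : ℝ) : ℂ) * dvb w (fun y => ((r y : ℝ) : ℂ)) y := fun y hy =>
    cd_ofReal_comp (differentiableAt_of_contDiffOn hU hy hr) (h1 y hy)
  have hd : DifferentiableAt ℝ (fun y => ((φ' (r y) : ℝ) : ℂ)) z :=
    Complex.ofRealCLM.differentiableAt.comp z (h2.differentiableAt.comp z hrz)
  have e2 : dv w (dvb w fun y => ((φ (r y) : ℝ) : ℂ)) z
      = (φ'' : ℂ) * dv w (fun y => ((r y : ℝ) : ℂ)) z * dvb w (fun y => ((r y : ℝ) : ℂ)) z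
        + ((φ' (r z) : ℝ) : ℂ) * dv w (dvb w fun y => ((r y : ℝ) : ℂ)) z := by
    rw [show dv w (dvb w fun y => ((φ (r y) : ℝ) : ℂ)) z
      = dv w (fun y => ((φ' (r y) : ℝ) : ℂ) * dvb w (fun y => ((r y : ℝ) : ℂ)) y) z from
      cd_congr_on hU hz e]
    rw [← show dv w (fun y => ((φ' (r y) : ℝ) : ℂ)) z
      = (φ'' : ℂ) * dv w (fun y => ((r y : ℝ) : ℂ)) z from cd_ofReal_comp hrz h2]
    exact cd_mul hd (differentiableAt_of_contDiffOn hU hz (contDiffOn_cd hU hrC))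
  rw [e2, dvb_ofReal, mul_assoc, Complex.mul_conj', Complex.add_re, Complex.re_ofReal_mul,
    Complex.re_ofReal_mul]
  norm_cast

end Levi

/-! ### The maximum point estimate in an adapted frame -/

section LocalBound

variable {n : ℕ}

/-- Here `s` stands for the trace, `D` for its derivative, `T` for the torsion part and `Y` for the
part controlled by Cauchy-Schwarz. The critical point equation `hD` rewrites the cross term `‖D‖
‖T‖`, and `2xy ≤ x² + y²` splits it into `A² Ψ y²`, which the convexity of the exponential
compensates, and a bounded multiple of `Ψ`. -/
lemma gradient_term_le {D T Y : ℂ} {s A Ψ y E N W : ℝ} (hs : 0 < s) (hΨ : 0 ≤ Ψ)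
    (hE : s⁻¹ ≤ E) (hD : ‖D‖ = s * A * Ψ * y) (hDe : D = Y + T) (hT : ‖T‖ ≤ N)
    (hY : ‖Y‖ ^ 2 ≤ s * W) :
    (s ^ 2)⁻¹ * ‖D‖ ^ 2 ≤ s⁻¹ * W + A ^ 2 * Ψ * y ^ 2 + Ψ * (N ^ 2 * E ^ 2) := by
  have hE0 : 0 ≤ E := (inv_pos.2 hs).le.trans hE
  have c1 : ‖D‖ ^ 2 ≤ ‖Y‖ ^ 2 + 2 * (‖D‖ * ‖T‖) := by
    have : Y = D - T := by rw [hDe]; ring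
    rw [this]
    have k1 : ‖D‖ - ‖T‖ ≤ ‖D - T‖ := norm_sub_norm_le _ _
    -- When `‖T‖` exceeds `‖D‖`, the bound `‖D‖² ≤ ‖D‖ ‖T‖` is already enough.
    by_cases hc : ‖T‖ ≤ ‖D‖
    · have := pow_le_pow_left₀ (sub_nonneg.2 hc) k1 2
      nlinarith [sq_nonneg ‖T‖]
    · push Not at hc
      nlinarith [norm_nonneg D, norm_nonneg T, sq_nonneg ‖D - T‖]
  have c3 : (s ^ 2)⁻¹ * ‖D‖ ^ 2 ≤ (s ^ 2)⁻¹ * (s * W + 2 * (‖D‖ * ‖T‖)) :=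
    mul_le_mul_of_nonneg_left (c1.trans (by linarith)) (by positivity)
  refine c3.trans ?_
  have c4 : (s ^ 2)⁻¹ * (s * W + 2 * (‖D‖ * ‖T‖))
      = s⁻¹ * W + Ψ * (2 * (A * y) * (s⁻¹ * ‖T‖)) := by
    rw [hD]; field_simp
  have c5 : s⁻¹ * ‖T‖ ≤ E * N := mul_le_mul hE hT (norm_nonneg _) hE0
  have c6 : 2 * (A * y) * (s⁻¹ * ‖T‖) ≤ (A * y) ^ 2 + (s⁻¹ * ‖T‖) ^ 2 := by
    nlinarith [sq_nonneg (A * y - s⁻¹ * ‖T‖)]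
  have c7 : (s⁻¹ * ‖T‖) ^ 2 ≤ (E * N) ^ 2 := pow_le_pow_left₀ (by positivity) c5 2
  have c8 := mul_le_mul_of_nonneg_left (c6.trans (add_le_add_right c7 _)) hΨ
  rw [c4]
  calc _ ≤ s⁻¹ * W + Ψ * ((A * y) ^ 2 + (E * N) ^ 2) := by linarith
    _ = _ := by ring

/-- The final absorption argument in the trace estimate. -/
lemma absorption_le {s σ L fL W N1 N2 N3 N4 K E A Ψ ft ν : ℝ} (hs : 0 < s) (hσ : 0 ≤ σ)
    (hsσ : 1 ≤ s * σ) (hE : s⁻¹ ≤ E) (hΨ : 1 ≤ Ψ) (h1 : 0 ≤ N1) (h2 : 0 ≤ N2) (h3 : 0 ≤ N3)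
    (h4 : 0 ≤ N4) (hK : 0 ≤ K) (hA : A = N1 + N2 * E + N3 + K + N4 + 1) (hft : -(2 * K) ≤ ft)
    (ht : 0 ≤ fL / s - A * Ψ * ft)
    (hmain : W - N1 * (s * σ) - N2 * σ - N3 - K ≤ L - fL)
    (hsum : s⁻¹ * L ≤ s⁻¹ * W + σ * (Ψ * N4) + (ν * (A * Ψ) - σ * (A * Ψ))) :
    σ ≤ A * (ν + 2 * K) := by
  have hs' := inv_pos.2 hs
  have hE0 : 0 ≤ E := hs'.le.trans hE
  have hA0 : 0 ≤ A := by rw [hA]; positivity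
  have hΨ0 : 0 < Ψ := zero_lt_one.trans_le hΨ
  have main2 := mul_le_mul_of_nonneg_left hmain hs'.le
  have b1 : s⁻¹ * (s * σ) = σ := by rw [← mul_assoc, inv_mul_cancel₀ hs.ne', one_mul]
  have b2 : s⁻¹ ≤ σ := by
    have := mul_le_mul_of_nonneg_left hsσ hs'.le
    rwa [b1, mul_one] at this
  have b3 : N2 * σ * s⁻¹ ≤ N2 * σ * E := mul_le_mul_of_nonneg_left hE (by positivity)
  have b4 : (N3 + K) * s⁻¹ ≤ (N3 + K) * σ := mul_le_mul_of_nonneg_left b2 (by positivity)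
  have b5 : A * Ψ * -(2 * K) ≤ A * Ψ * ft := mul_le_mul_of_nonneg_left hft (by positivity)
  rw [div_eq_mul_inv, mul_comm fL] at ht
  have b7 : s⁻¹ * (W - N1 * (s * σ) - N2 * σ - N3 - K)
      = s⁻¹ * W - N1 * σ - N2 * σ * s⁻¹ - (N3 + K) * s⁻¹ := by
    linear_combination (-N1) * b1
  rw [b7, mul_sub] at main2
  have b8 : A * Ψ * σ ≤ Ψ * N4 * σ + (N1 + N2 * E + N3 + K) * σ + A * Ψ * (ν + 2 * K) := by
    linarith
  have b9 : (N1 + N2 * E + N3 + K) * σ ≤ Ψ * ((N1 + N2 * E + N3 + K) * σ) :=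
    le_mul_of_one_le_left (by positivity) hΨ
  have b10 : Ψ * σ ≤ Ψ * (A * (ν + 2 * K)) := by
    -- The summand `1` in `A` is what leaves `Ψ σ` after all error terms have cancelled.
    have : A * Ψ * σ = Ψ * ((N1 + N2 * E + N3 + K) * σ) + Ψ * N4 * σ + Ψ * σ := by
      conv_lhs => rw [hA]
      ring
    linarith
  exact le_of_mul_le_mul_left b10 hΨ0

open Matrix

variable {U : Set (Cn n)} {z : Cn n} {u f F : Cn n → ℝ} {v : Fin n → Cn n}
  {h m : Cn n → Matrix (Fin n) (Fin n) ℂ} {l : Fin n → ℝ}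

/-- The estimate at a maximum point of `log tr_h m + exp (-A w)`, in a frame adapted to the
point. -/
theorem sum_inv_le_of_isLocalMax (hU : IsOpen U) (hz : z ∈ U) (sh : SmoothM h U)
    (hu : ContDiffOn ℝ ∞ u U) (hF : ContDiffOn ℝ ∞ F U)
    (hh : ∀ q ∈ U, (h q).PosDef) (hmdef : ∀ q, m q = h q + hessF v u q)
    (hm : ∀ q ∈ U, (m q).PosDef)
    (heq : ∀ q ∈ U, f q = Real.log ((m q).det / (h q).det).re - F q)
    (h1 : h z = 1) (hl : ∀ i, 0 < l i) (hml : m z = diagonal fun i => (l i : ℂ))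
    {B : ℝ} (hB : 0 ≤ B) (hB1 : ∀ p i j, ‖dvM (v p) h z i j‖ ≤ B)
    (hB2 : ∀ p i j, ‖dvM (v p) (dvbM (v p) h) z i j‖ ≤ B)
    {S : Cn n → ℝ} (hS : ∀ q ∈ U, ((h q)⁻¹ * m q).trace = (S q : ℂ)) (hSpos : ∀ q ∈ U, 0 < S q)
    {E K A c ft : ℝ} (hK : 0 ≤ K) (hE : (S z)⁻¹ ≤ E)
    (hFl : -K ≤ ∑ i, (dv (v i) (dvb (v i) fun q => ((F q : ℝ) : ℂ)) z).re)
    (hA : A = (2 * n * B ^ 2 + B + n * B ^ 2) + (4 * n ^ 2 * B ^ 2 + 2 * n * B) * E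
      + (n ^ 2 * B + n ^ 3 * B ^ 2) + K + (n * (2 * B)) ^ 2 * E ^ 2 + 1)
    (huc : u z ≤ c) (hn : 0 < n)
    (hmax : IsLocalMax (fun q => Real.log (S q) + Real.exp (-A * (u q - c))) z)
    (hft : -(2 * K) ≤ ft)
    (ht : 0 ≤ (∑ i, (dv (v i) (dvb (v i) fun q => ((f q : ℝ) : ℂ)) z).re) / S z
      - A * Real.exp (-A * (u z - c)) * ft) :
    ∑ i, (l i)⁻¹ ≤ A * (n + 2 * K) := by
  obtain ⟨Z, τ, hτ, hdS, hmain⟩ :=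
    laplacian_trace_ge hU hz sh hu hF hh hmdef hm heq h1 hl hml hB hB1 hB2
  have hdet : ∀ q ∈ U, (h q).det ≠ 0 := fun q hq => (hh q hq).det_pos.ne'
  have sm : SmoothM m U := by rw [funext hmdef]; exact sh.add (smoothM_hessF hU hu)
  have sS : ContDiffOn ℝ ∞ S U := by
    refine (Complex.reCLM.contDiff.comp_contDiffOn ((sh.inv hdet).mul sm).trace).congr ?_
    intro q hq
    simp [hS q hq]
  set σ := ∑ i, (l i)⁻¹ with hσ
  set s := S z with hs
  set Ψ := Real.exp (-A * (u z - c)) with hΨ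
  have hspos : 0 < s := hSpos z hz
  have hsl : s = ∑ i, l i := by
    have := hS z hz
    rw [h1, hml, inv_one, one_mul, trace_diagonal] at this
    exact_mod_cast this.symm
  have hE0 : 0 ≤ E := (inv_pos.2 hspos).le.trans hE
  have hA1 : 1 ≤ A := by rw [hA]; exact le_add_of_nonneg_left (by positivity)
  have hΨ1 : 1 ≤ Ψ := by
    rw [hΨ]; apply Real.one_le_exp; nlinarith
  have hσ0 : 0 ≤ σ := Finset.sum_nonneg fun i _ => (inv_pos.2 (hl i)).le
  have hsσ : 1 ≤ s * σ := by
    let i₀ : Fin n := ⟨0, hn⟩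
    have a1 : l i₀ ≤ s := by
      rw [hsl]; exact Finset.single_le_sum (fun i _ => (hl i).le) (Finset.mem_univ i₀)
    have a2 : (l i₀)⁻¹ ≤ σ :=
      Finset.single_le_sum (f := fun i => (l i)⁻¹) (fun i _ => (inv_pos.2 (hl i)).le)
        (Finset.mem_univ i₀)
    calc 1 = l i₀ * (l i₀)⁻¹ := (mul_inv_cancel₀ (hl i₀).ne').symm
      _ ≤ s * σ := mul_le_mul a1 a2 (inv_pos.2 (hl i₀)).le hspos.le
  -- derivatives of `S` and `u`
  have eS : ∀ w, dv w (fun q => ((h q)⁻¹ * m q).trace) z = dv w (fun q => ((S q : ℝ) : ℂ)) z :=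
    fun w => cd_congr_on hU hz hS
  have eSS : ∀ w, dv w (dvb w fun q => ((h q)⁻¹ * m q).trace) z
      = dv w (dvb w fun q => ((S q : ℝ) : ℂ)) z :=
    fun w => cd_congr_on hU hz fun q hq => cd_congr_on hU hq hS
  have sL : ContDiffOn ℝ ∞ (fun q => Real.log (S q)) U := sS.log fun q hq => (hSpos q hq).ne'
  have sΨ : ContDiffOn ℝ ∞ (fun q => Real.exp (-A * (u q - c))) U :=
    (contDiffOn_const.mul (hu.sub contDiffOn_const)).exp
  have dL : ∀ x, 0 < x → HasDerivAt Real.log x⁻¹ x := fun x hx => Real.hasDerivAt_log hx.ne'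
  have dΨ : ∀ x, HasDerivAt (fun x => Real.exp (-A * (x - c)))
      (-A * Real.exp (-A * (x - c))) x := fun x => by
    have := (((hasDerivAt_id x).sub_const c).const_mul (-A)).exp
    simpa [mul_comm] using this
  have dΨ' : HasDerivAt (fun x => -A * Real.exp (-A * (x - c))) (A ^ 2 * Ψ) (u z) := by
    refine ((dΨ (u z)).const_mul (-A)).congr_deriv ?_
    rw [← hΨ]; ring
  -- The critical point equation `∂S / S = A Ψ ∂u`, multiplied by `S`.
  have Q1 : ∀ p, dv (v p) (fun q => ((S q : ℝ) : ℂ)) z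
      = (s * A * Ψ : ℝ) * dv (v p) (fun q => ((u q : ℝ) : ℂ)) z := fun p => by
    have h0 := dv_eq_zero_of_isLocalMax
      (differentiableAt_of_contDiffOn hU hz (sL.add sΨ)) hmax (v p)
    have e : dv (v p) (fun q => ((Real.log (S q) + Real.exp (-A * (u q - c)) : ℝ) : ℂ)) z
        = ((s⁻¹ : ℝ) : ℂ) * dv (v p) (fun q => ((S q : ℝ) : ℂ)) z
          + ((-A * Ψ : ℝ) : ℂ) * dv (v p) (fun q => ((u q : ℝ) : ℂ)) z := by
      rw [← show dv (v p) (fun q => ((Real.log (S q) : ℝ) : ℂ)) z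
          = ((s⁻¹ : ℝ) : ℂ) * dv (v p) (fun q => ((S q : ℝ) : ℂ)) z from
          cd_ofReal_comp (differentiableAt_of_contDiffOn hU hz sS) (dL s hspos),
        ← show dv (v p) (fun q => ((Real.exp (-A * (u q - c)) : ℝ) : ℂ)) z
          = ((-A * Ψ : ℝ) : ℂ) * dv (v p) (fun q => ((u q : ℝ) : ℂ)) z from
          cd_ofReal_comp (φ := fun x => Real.exp (-A * (x - c)))
            (differentiableAt_of_contDiffOn hU hz hu) (dΨ (u z))]
      simp only [Complex.ofReal_add]
      exact cd_add (differentiableAt_of_contDiffOn hU hz (contDiffOn_ofReal sL))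
        (differentiableAt_of_contDiffOn hU hz (contDiffOn_ofReal sΨ))
    rw [e] at h0
    have hsc : (s : ℂ) ≠ 0 := by exact_mod_cast hspos.ne'
    have h0' := congrArg (fun x => (s : ℂ) * x) h0
    simp only [mul_zero, mul_add, ← mul_assoc] at h0'
    push_cast at h0' ⊢
    rw [mul_inv_cancel₀ hsc] at h0'
    linear_combination h0'
  -- The second order condition along `v p`. The complex Hessian of `u` contributes `l p - 1`,
  -- because `h z` is the identity and `m z` is diagonal.
  have Q2 : ∀ p, -(s ^ 2)⁻¹ * ‖dv (v p) (fun q => ((S q : ℝ) : ℂ)) z‖ ^ 2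
      + s⁻¹ * (dv (v p) (dvb (v p) fun q => ((S q : ℝ) : ℂ)) z).re
      + (A ^ 2 * Ψ * ‖dv (v p) (fun q => ((u q : ℝ) : ℂ)) z‖ ^ 2
        - A * Ψ * (l p - 1)) ≤ 0 := fun p => by
    have hC2 : ContDiffAt ℝ 2 (fun q => Real.log (S q) + Real.exp (-A * (u q - c))) z :=
      ((sL.add sΨ).contDiffAt (hU.mem_nhds hz)).of_le two_le_infty
    have h0 := re_dv_dvb_nonpos_of_isLocalMax hC2 hmax (v p)
    have e : dv (v p) (dvb (v p)
          fun q => ((Real.log (S q) + Real.exp (-A * (u q - c)) : ℝ) : ℂ)) z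
        = dv (v p) (dvb (v p) fun q => ((Real.log (S q) : ℝ) : ℂ)) z
          + dv (v p) (dvb (v p) fun q => ((Real.exp (-A * (u q - c)) : ℝ) : ℂ)) z := by
      simp only [Complex.ofReal_add]
      have := contDiffOn_ofReal sL
      have := contDiffOn_ofReal sΨ
      rw [show dv (v p) (dvb (v p) fun q => ((Real.log (S q) : ℝ) : ℂ)
          + ((Real.exp (-A * (u q - c)) : ℝ) : ℂ)) z
        = dv (v p) (fun q => dvb (v p) (fun q => ((Real.log (S q) : ℝ) : ℂ)) q
          + dvb (v p) (fun q => ((Real.exp (-A * (u q - c)) : ℝ) : ℂ)) q) z from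
        cd_congr_on hU hz fun q hq => cd_add
          (differentiableAt_of_contDiffOn hU hq (contDiffOn_ofReal sL))
          (differentiableAt_of_contDiffOn hU hq (contDiffOn_ofReal sΨ))]
      exact cd_add
        (differentiableAt_of_contDiffOn hU hz (contDiffOn_cd hU (contDiffOn_ofReal sL)))
        (differentiableAt_of_contDiffOn hU hz (contDiffOn_cd hU (contDiffOn_ofReal sΨ)))
    rw [e, Complex.add_re,
      re_dv_dvb_comp hU hz sS (φ := Real.log) (φ' := fun x => x⁻¹)
        (fun y hy => dL _ (hSpos y hy)) (hasDerivAt_inv hspos.ne') (v p),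
      re_dv_dvb_comp hU hz hu (φ := fun x => Real.exp (-A * (x - c)))
        (φ' := fun x => -A * Real.exp (-A * (x - c))) (fun y _ => dΨ (u y)) dΨ' (v p)] at h0
    have e2 : (dv (v p) (dvb (v p) fun q => ((u q : ℝ) : ℂ)) z).re = l p - 1 := by
      have := congrFun (congrFun (hmdef z) p) p
      rw [h1, hml, Matrix.add_apply, diagonal_apply_eq, one_apply_eq] at this
      have h3 : hessF v u z p p = dv (v p) (dvb (v p) fun q => ((u q : ℝ) : ℂ)) z := rfl
      rw [← h3, show hessF v u z p p = ((l p - 1 : ℝ) : ℂ) by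
        push_cast; linear_combination -this, Complex.ofReal_re]
    rw [e2, ← hΨ] at h0
    linarith
  -- the gradient term
  have G : ∀ p, (s ^ 2)⁻¹ * ‖dv (v p) (fun q => ((S q : ℝ) : ℂ)) z‖ ^ 2
      ≤ s⁻¹ * (∑ i, ‖Z p i‖ ^ 2 / l i)
        + A ^ 2 * Ψ * ‖dv (v p) (fun q => ((u q : ℝ) : ℂ)) z‖ ^ 2
        + Ψ * ((n * (2 * B)) ^ 2 * E ^ 2) := fun p => by
    set D := dv (v p) (fun q => ((S q : ℝ) : ℂ)) z with hD
    set y := ‖dv (v p) (fun q => ((u q : ℝ) : ℂ)) z‖ with hy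
    have hDn : ‖D‖ = s * A * Ψ * y := by
      rw [hD, Q1, norm_mul, Complex.norm_real, Real.norm_of_nonneg (by positivity)]
    have c2 := sum_norm_sq_le (Z p) l hl
    rw [← hsl] at c2
    exact gradient_term_le hspos (zero_le_one.trans hΨ1) hE hDn
      (by rw [hD, ← eS, hdS]) (hτ p) c2
  -- sum over the frame
  have P : ∀ p, (l p)⁻¹ * (s⁻¹ * (dv (v p) (dvb (v p) fun q => ((S q : ℝ) : ℂ)) z).re)
      ≤ s⁻¹ * (∑ i, ‖Z p i‖ ^ 2 / (l p * l i))
        + (l p)⁻¹ * (Ψ * ((n * (2 * B)) ^ 2 * E ^ 2)) + (A * Ψ - (l p)⁻¹ * (A * Ψ)) := fun p => by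
    have hlp := inv_pos.2 (hl p)
    have a1 : s⁻¹ * (dv (v p) (dvb (v p) fun q => ((S q : ℝ) : ℂ)) z).re
        ≤ s⁻¹ * (∑ i, ‖Z p i‖ ^ 2 / l i) + Ψ * ((n * (2 * B)) ^ 2 * E ^ 2)
          + A * Ψ * (l p - 1) := by linarith [Q2 p, G p]
    have a2 := mul_le_mul_of_nonneg_left a1 hlp.le
    have a3 : s⁻¹ * (∑ i, ‖Z p i‖ ^ 2 / (l p * l i))
        = (l p)⁻¹ * (s⁻¹ * (∑ i, ‖Z p i‖ ^ 2 / l i)) := by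
      rw [mul_left_comm, Finset.mul_sum (a := (l p)⁻¹)]
      congr 1
      exact Finset.sum_congr rfl fun i _ => by rw [div_eq_mul_inv, mul_inv, div_eq_mul_inv]; ring
    have a4 : (l p)⁻¹ * (A * Ψ * (l p - 1)) = A * Ψ - (l p)⁻¹ * (A * Ψ) := by
      rw [mul_sub, mul_sub, mul_left_comm, inv_mul_cancel₀ (hl p).ne']; ring
    rw [a3, ← a4]
    linarith
  have PS := Finset.sum_le_sum fun p (_ : p ∈ Finset.univ) => P p
  simp only [Finset.sum_add_distrib, Finset.sum_sub_distrib, ← Finset.sum_mul, ← Finset.mul_sum,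
    Finset.sum_const, Finset.card_univ, Fintype.card_fin, nsmul_eq_mul, ← hσ] at PS
  set L := ∑ p, (l p)⁻¹ * (dv (v p) (dvb (v p) fun q => ((S q : ℝ) : ℂ)) z).re with hL
  have PL : ∑ p, (l p)⁻¹ * (s⁻¹ * (dv (v p) (dvb (v p) fun q => ((S q : ℝ) : ℂ)) z).re)
      = s⁻¹ * L := by
    rw [hL, Finset.mul_sum]; exact Finset.sum_congr rfl fun p _ => by ring
  rw [PL] at PS
  simp only [eSS, ← hL] at hmain
  rw [← hsl] at hmain
  set fL := ∑ i, (dv (v i) (dvb (v i) fun q => ((f q : ℝ) : ℂ)) z).re with hfL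
  set W := ∑ p, ∑ i, ‖Z p i‖ ^ 2 / (l p * l i) with hW
  rw [mul_assoc (n : ℝ)] at PS
  refine absorption_le hspos hσ0 hsσ hE hΨ1 ?_ ?_ ?_ ?_ hK hA hft ht (L := L) (W := W) ?_ PS
  · positivity
  · positivity
  · positivity
  · positivity
  · linarith

end LocalBound

/-! ### Simultaneous diagonalization and relative eigenvalues -/

section LinearAlgebra

open Matrix

variable {n : ℕ} {g m W : Matrix (Fin n) (Fin n) ℂ} {l : Fin n → ℝ}

/-- Unitary diagonalization of Hermitian matrices. -/
lemma exists_unitary_diagonal (hm : m.IsHermitian) :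
    ∃ (W : Matrix (Fin n) (Fin n) ℂ) (l : Fin n → ℝ), Wᴴ * W = 1 ∧ W * Wᴴ = 1 ∧
      Wᴴ * m * W = diagonal fun i => (l i : ℂ) := by
  set V := hm.eigenvectorUnitary
  have h1 : (V : Matrix (Fin n) (Fin n) ℂ)ᴴ * (V : Matrix (Fin n) (Fin n) ℂ) = 1 :=
    Unitary.coe_star_mul_self V
  have h2 : (V : Matrix (Fin n) (Fin n) ℂ) * (V : Matrix (Fin n) (Fin n) ℂ)ᴴ = 1 :=
    Unitary.coe_mul_star_self V
  refine ⟨V, hm.eigenvalues, h1, h2, ?_⟩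
  have h3 := hm.conjStarAlgAut_star_eigenvectorUnitary
  rw [Unitary.conjStarAlgAut_apply, Unitary.coe_star, star_star] at h3
  exact h3

/-- Simultaneous diagonalization of a positive definite and a Hermitian matrix. -/
lemma exists_simultaneous_diagonal (hg : g.PosDef) (hm : m.IsHermitian) :
    ∃ (W : Matrix (Fin n) (Fin n) ℂ) (l : Fin n → ℝ), IsUnit W ∧ Wᴴ * g * W = 1 ∧
      Wᴴ * m * W = diagonal fun i => (l i : ℂ) := by
  obtain ⟨V, d, hV1, hV2, hVg⟩ := exists_unitary_diagonal hg.isHermitian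
  have hVu : IsUnit V := ⟨⟨V, Vᴴ, hV2, hV1⟩, rfl⟩
  have hd : ∀ i, 0 < d i := by
    have : (Vᴴ * g * V).PosDef := (IsUnit.posDef_star_left_conjugate_iff hVu).2 hg
    rw [hVg, posDef_diagonal_iff] at this
    intro i; exact_mod_cast this i
  -- Scaling the eigenvectors of `g` by `d ^ (-1/2)` turns `g` into the identity; the later unitary
  -- change `Q` diagonalizes `m` and preserves that.
  set D : Matrix (Fin n) (Fin n) ℂ := diagonal fun i => (((Real.sqrt (d i))⁻¹ : ℝ) : ℂ) with hD
  have hDH : Dᴴ = D := by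
    rw [hD, diagonal_conjTranspose]; congr 1; funext i; simp
  have hDD : D * (diagonal fun i => (d i : ℂ)) * D = 1 := by
    rw [hD, diagonal_mul_diagonal, diagonal_mul_diagonal, ← diagonal_one]
    congr 1; funext i
    have h0 := Real.sqrt_pos.2 (hd i)
    have : (Real.sqrt (d i))⁻¹ * d i * (Real.sqrt (d i))⁻¹ = 1 := by
      have h1 := Real.mul_self_sqrt (hd i).le
      field_simp
      nlinarith
    exact_mod_cast this
  have hDu : IsUnit D := by
    rw [hD, isUnit_diagonal, Pi.isUnit_iff]
    intro i
    exact isUnit_iff_ne_zero.2 (by exact_mod_cast (inv_pos.2 (Real.sqrt_pos.2 (hd i))).ne')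
  have hg1 : (V * D)ᴴ * g * (V * D) = 1 := by
    rw [conjTranspose_mul, hDH]
    calc D * Vᴴ * g * (V * D) = D * (Vᴴ * g * V) * D := by simp only [Matrix.mul_assoc]
      _ = 1 := by rw [hVg, hDD]
  have hm1 : ((V * D)ᴴ * m * (V * D)).IsHermitian := isHermitian_conjTranspose_mul_mul _ hm
  obtain ⟨Q, l, hQ1, hQ2, hQm⟩ := exists_unitary_diagonal hm1
  have hQu : IsUnit Q := ⟨⟨Q, Qᴴ, hQ2, hQ1⟩, rfl⟩
  refine ⟨V * D * Q, l, (hVu.mul hDu).mul hQu, ?_, ?_⟩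
  · rw [conjTranspose_mul (V * D) Q]
    calc Qᴴ * (V * D)ᴴ * g * (V * D * Q) = Qᴴ * ((V * D)ᴴ * g * (V * D)) * Q := by
          simp only [Matrix.mul_assoc]
      _ = 1 := by rw [hg1, mul_one, hQ1]
  · rw [conjTranspose_mul (V * D) Q, ← hQm]
    simp only [Matrix.mul_assoc]

lemma isUnit_conjTranspose_det (hW : IsUnit W) : IsUnit Wᴴ.det ∧ IsUnit W.det := by
  have := (isUnit_iff_isUnit_det W).1 hW
  refine ⟨?_, this⟩
  rw [det_conjTranspose]
  exact this.star

lemma inv_mul_conj (hW : IsUnit W) :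
    (Wᴴ * g * W)⁻¹ * (Wᴴ * m * W) = W⁻¹ * (g⁻¹ * m) * W := by
  obtain ⟨h1, h2⟩ := isUnit_conjTranspose_det hW
  rw [Matrix.mul_inv_rev, Matrix.mul_inv_rev]
  calc W⁻¹ * (g⁻¹ * Wᴴ⁻¹) * (Wᴴ * m * W) = W⁻¹ * (g⁻¹ * ((Wᴴ⁻¹ * Wᴴ) * (m * W))) := by
        simp only [Matrix.mul_assoc]
    _ = _ := by rw [Matrix.nonsing_inv_mul _ h1, one_mul]; simp only [Matrix.mul_assoc]

lemma trace_inv_mul_conj (hW : IsUnit W) :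
    ((Wᴴ * g * W)⁻¹ * (Wᴴ * m * W)).trace = (g⁻¹ * m).trace := by
  rw [inv_mul_conj hW, trace_mul_comm, ← Matrix.mul_assoc,
    Matrix.mul_nonsing_inv _ (isUnit_conjTranspose_det hW).2, one_mul]

lemma trWrt_conj (hW : IsUnit W) :
    trWrt (Wᴴ * g * W) (Wᴴ * m * W) = trWrt g m := by
  rw [trWrt, trWrt, trace_inv_mul_conj hW]

lemma det_div_conj (hW : IsUnit W) :
    (Wᴴ * m * W).det / (Wᴴ * g * W).det = m.det / g.det := by
  obtain ⟨h1, h2⟩ := isUnit_conjTranspose_det hW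
  simp only [det_mul]
  have e : ∀ x : ℂ, Wᴴ.det * x * W.det = (Wᴴ.det * W.det) * x := fun x => by ring
  rw [e, e, mul_div_mul_left _ _ (mul_ne_zero h1.ne_zero h2.ne_zero)]

/-- The relative eigenvalues of a positive definite matrix. -/
lemma exists_relative_eigenvalues (hg : g.PosDef) (hm : m.IsHermitian) :
    ∃ (W : Matrix (Fin n) (Fin n) ℂ) (l : Fin n → ℝ), IsUnit W ∧ Wᴴ * g * W = 1 ∧
      (Wᴴ * m * W = diagonal fun i => (l i : ℂ)) ∧ (g⁻¹ * m).trace = ((∑ i, l i : ℝ) : ℂ) ∧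
      trWrt g m = ∑ i, l i ∧ m.det / g.det = ((∏ i, l i : ℝ) : ℂ) ∧
      (∀ c : ℝ, (m - (c : ℂ) • g).PosSemidef ↔ ∀ i, c ≤ l i) ∧
      (∀ c : ℝ, ((c : ℂ) • g - m).PosSemidef ↔ ∀ i, l i ≤ c) ∧
      (m.PosDef → ∀ i, 0 < l i) := by
  obtain ⟨W, l, hW, h1, h2⟩ := exists_simultaneous_diagonal hg hm
  have ht : (g⁻¹ * m).trace = ((∑ i, l i : ℝ) : ℂ) := by
    rw [← trace_inv_mul_conj hW, h1, h2]; simp [trace_diagonal]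
  refine ⟨W, l, hW, h1, h2, ht, ?_, ?_, ?_, ?_, ?_⟩
  · rw [trWrt, ht, Complex.ofReal_re]
  · rw [← det_div_conj hW, h1, h2]; simp [det_diagonal]
  · intro c
    rw [← IsUnit.posSemidef_star_left_conjugate_iff hW, star_eq_conjTranspose,
      Matrix.mul_sub, Matrix.sub_mul, Matrix.mul_smul, Matrix.smul_mul, h1, h2,
      smul_one_eq_diagonal, diagonal_sub, posSemidef_diagonal_iff]
    refine forall_congr' fun i => ?_
    rw [← Complex.ofReal_sub, Complex.zero_le_real, sub_nonneg]
  · intro c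
    rw [← IsUnit.posSemidef_star_left_conjugate_iff hW, star_eq_conjTranspose,
      Matrix.mul_sub, Matrix.sub_mul, Matrix.mul_smul, Matrix.smul_mul, h1, h2,
      smul_one_eq_diagonal, diagonal_sub, posSemidef_diagonal_iff]
    refine forall_congr' fun i => ?_
    rw [← Complex.ofReal_sub, Complex.zero_le_real, sub_nonneg]
  · intro hmp
    rw [← IsUnit.posDef_star_left_conjugate_iff hW, star_eq_conjTranspose, h2,
      posDef_diagonal_iff] at hmp
    intro i; exact_mod_cast hmp i

lemma trace_inv_mul_eq (hg : g.PosDef) (hm : m.PosDef) :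
    (g⁻¹ * m).trace = ((trWrt g m : ℝ) : ℂ) := by
  obtain ⟨W, l, -, -, -, h1, h2, -⟩ := exists_relative_eigenvalues hg hm.isHermitian
  rw [h1, h2]

lemma trWrt_pos (hg : g.PosDef) (hm : m.PosDef) (hn : 0 < n) : 0 < trWrt g m := by
  obtain ⟨W, l, -, -, -, h1, h2, -, -, -, hl⟩ := exists_relative_eigenvalues hg hm.isHermitian
  rw [h2]
  exact Finset.sum_pos (fun i _ => hl hm i) ⟨⟨0, hn⟩, Finset.mem_univ _⟩

/-- All relative eigenvalues are at least 1. This monotonicity is what the comparison principle uses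
in place of linearizing the operator. -/
lemma log_det_div_nonneg (hg : g.PosDef) (hm : m.PosDef) (h : (m - g).PosSemidef) :
    0 ≤ Real.log (m.det / g.det).re := by
  obtain ⟨W, l, -, -, -, -, -, h1, h2, -⟩ := exists_relative_eigenvalues hg hm.isHermitian
  rw [h1, Complex.ofReal_re]
  refine Real.log_nonneg ?_
  have := (h2 1).1 (by simpa using h)
  calc (1 : ℝ) = ∏ _i : Fin n, 1 := by simp
    _ ≤ _ := Finset.prod_le_prod (fun _ _ => zero_le_one) fun i _ => this i

/-- Each factor is controlled by the product and an upper bound for the inverses of the others. -/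
lemma le_prod_mul_pow {l : Fin n → ℝ} (hl : ∀ i, 0 < l i) {σ : ℝ} (hσ : ∀ i, (l i)⁻¹ ≤ σ)
    (i : Fin n) : l i ≤ (∏ j, l j) * σ ^ (n - 1) := by
  rw [← Finset.mul_prod_erase Finset.univ l (Finset.mem_univ i), mul_assoc]
  refine le_mul_of_one_le_right (hl i).le ?_
  have hc : (Finset.univ.erase i).card = n - 1 := by
    rw [Finset.card_erase_of_mem (Finset.mem_univ i)]; simp
  rw [← hc, ← Finset.prod_const, ← Finset.prod_mul_distrib]
  calc (1 : ℝ) = ∏ _j ∈ Finset.univ.erase i, 1 := by simp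
    _ ≤ _ := Finset.prod_le_prod (fun _ _ => zero_le_one) fun j _ => by
        rw [← mul_inv_cancel₀ (hl j).ne']
        exact mul_le_mul_of_nonneg_left (hσ j) (hl j).le

end LinearAlgebra

/-! ### Changes of frame and holomorphic changes of variables -/

section FrameLinear

variable {n : ℕ}

lemma eq_sum_basisVec (v : Cn n) : v = ∑ k, v k • (basisVec k : Cn n) := by
  funext i
  simp [basisVec, Finset.sum_apply, Pi.single_apply]

lemma clm_eq_sum (L : Cn n →L[ℝ] ℂ) (v : Cn n) :
    L v = ∑ k, ((v k).re * L (basisVec k) + (v k).im * L (Complex.I • basisVec k)) := by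
  conv_lhs => rw [eq_sum_basisVec v, map_sum]
  refine Finset.sum_congr rfl fun k _ => ?_
  have : v k • (basisVec k : Cn n)
      = (v k).re • (basisVec k : Cn n) + (v k).im • (Complex.I • (basisVec k : Cn n)) := by
    conv_lhs => rw [← Complex.re_add_im (v k), add_smul, mul_smul]
    simp
  rw [this, map_add, map_smul, map_smul]
  simp

lemma dv_eq_sum (v : Cn n) (f : Cn n → ℂ) (z : Cn n) :
    dv v f z = ∑ k, v k * dz k f z := by
  have h1 := clm_eq_sum (fderiv ℝ f z) v
  have h2 := clm_eq_sum (fderiv ℝ f z) (Complex.I • v)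
  simp only [dv, cd, map_smul, map_neg]
  rw [h1, h2]
  simp only [Pi.smul_apply, smul_eq_mul, Complex.I_mul_re, Complex.I_mul_im, dz,
    Complex.real_smul, Finset.mul_sum, ← Finset.sum_neg_distrib, ← Finset.sum_add_distrib]
  refine Finset.sum_congr rfl fun k _ => ?_
  conv_rhs => rw [← Complex.re_add_im (v k)]
  push_cast
  linear_combination ((1 / 2 : ℂ) * (v k).im * fderiv ℝ f z (Complex.I • basisVec k))
    * Complex.I_mul_I

lemma dvb_eq_sum (v : Cn n) (f : Cn n → ℂ) (z : Cn n) :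
    dvb v f z = ∑ k, conj (v k) * dzbar k f z := by
  have h1 := clm_eq_sum (fderiv ℝ f z) v
  have h2 := clm_eq_sum (fderiv ℝ f z) (Complex.I • v)
  simp only [dvb, cd, map_smul]
  rw [h1, h2]
  simp only [Pi.smul_apply, smul_eq_mul, Complex.I_mul_re, Complex.I_mul_im, dzbar,
    Complex.real_smul, Finset.mul_sum, ← Finset.sum_add_distrib]
  refine Finset.sum_congr rfl fun k _ => ?_
  have : conj (v k) = (v k).re - (v k).im * Complex.I := by
    apply Complex.ext <;> simp
  rw [this]
  push_cast
  linear_combination ((1 / 2 : ℂ) * (v k).im * fderiv ℝ f z (Complex.I • basisVec k))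
    * Complex.I_mul_I

lemma differentiableAt_cd {F : Type*} [NormedAddCommGroup F] [NormedSpace ℝ F] {a b p : F}
    {f : F → ℂ} (hf : ContDiffAt ℝ 2 f p) : DifferentiableAt ℝ (cd a b f) p := by
  have h : DifferentiableAt ℝ (fderiv ℝ f) p :=
    (hf.fderiv_right (m := 1) (by norm_num)).differentiableAt (by simp)
  exact (h.clm_apply (differentiableAt_const a)).add
    ((differentiableAt_const _).mul (h.clm_apply (differentiableAt_const b)))

lemma dv_dvb_eq_sum (v w : Cn n) {f : Cn n → ℂ} {z : Cn n} (hf : ContDiffAt ℝ 2 f z) :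
    dv v (dvb w f) z = ∑ l, conj (w l) * dv v (dzbar l f) z := by
  have hd : ∀ l, DifferentiableAt ℝ (dzbar l f) z := fun l => by
    rw [dzbar_eq_dvb]; exact differentiableAt_cd hf
  have e : dvb w f = fun q => ∑ l, conj (w l) * dzbar l f q := funext fun q => dvb_eq_sum w f q
  rw [e, dv, cd_sum (f := fun l q => conj (w l) * dzbar l f q) _
    fun l _ => (hd l).const_mul _]
  exact Finset.sum_congr rfl fun l _ => cd_const_mul _ (hd l)

open Matrix in
/-- The complex Hessian in a frame, in terms of the coordinate Hessian. -/
lemma hessF_eq_conj (v : Fin n → Cn n) {u : Cn n → ℝ} {z : Cn n} (hu : ContDiffAt ℝ 2 u z) :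
    hessF v u z = (Matrix.of fun k i => conj (v i k))ᴴ * hessF basisVec u z
      * Matrix.of fun k i => conj (v i k) := by
  have hu' : ContDiffAt ℝ 2 (fun q => ((u q : ℝ) : ℂ)) z :=
    Complex.ofRealCLM.contDiff.contDiffAt.comp z hu
  ext i j
  change dv (v i) (dvb (v j) _) z = _
  rw [dv_dvb_eq_sum _ _ hu']
  simp only [mul_apply, conjTranspose_apply, of_apply, hessF, ← dz_eq_dv, ← dzbar_eq_dvb,
    Finset.sum_mul]
  refine Finset.sum_congr rfl fun l _ => ?_
  rw [dv_eq_sum, Finset.mul_sum]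
  refine Finset.sum_congr rfl fun k _ => ?_
  rw [Complex.star_def, Complex.conj_conj]; ring

/-- First order chain rule for holomorphic maps. -/
lemma dv_comp_holomorphic {Φ : Cn n → Cn n} {f : Cn n → ℂ} {z : Cn n}
    (hΦ : DifferentiableAt ℂ Φ z) (hf : DifferentiableAt ℝ f (Φ z)) (v : Cn n) :
    dv v (fun q => f (Φ q)) z = dv (fderiv ℂ Φ z v) f (Φ z) ∧
      dvb v (fun q => f (Φ q)) z = dvb (fderiv ℂ Φ z v) f (Φ z) := by
  have h1 : HasFDerivAt (fun q => f (Φ q))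
      ((fderiv ℝ f (Φ z)).comp ((fderiv ℂ Φ z).restrictScalars ℝ)) z :=
    hf.hasFDerivAt.comp z (hΦ.hasFDerivAt.restrictScalars ℝ)
  constructor <;> simp [dv, dvb, cd, h1.fderiv]

/-- The derivative of `h` is complex linear, so its `(0,1)` derivative vanishes. For this reason the
second order chain rule below contains no first order term. -/
lemma dv_conj_holomorphic {h : Cn n → ℂ} {z : Cn n} (hh : DifferentiableAt ℂ h z) (v : Cn n) :
    dv v (fun q => conj (h q)) z = 0 := by
  have h1 : HasFDerivAt h ((fderiv ℂ h z).restrictScalars ℝ) z :=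
    hh.hasFDerivAt.restrictScalars ℝ
  rw [dv, cd_conj]
  simp only [cd, h1.fderiv, neg_neg]
  simp only [ContinuousLinearMap.coe_restrictScalars', map_smul]
  rw [← map_zero (starRingEnd ℂ)]
  congr 1
  simp only [Complex.real_smul, smul_eq_mul]
  push_cast
  linear_combination ((1 / 2 : ℂ) * fderiv ℂ h z v) * Complex.I_mul_I

/-- Second order chain rule for holomorphic maps. -/
lemma dv_dvb_comp_holomorphic {Φ : Cn n → Cn n} {f : Cn n → ℂ} {z : Cn n}
    (hΦ : ContDiffAt ℂ ω Φ z) (hf : ContDiffAt ℝ 2 f (Φ z)) (v w : Cn n) :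
    dv v (dvb w fun q => f (Φ q)) z
      = dv (fderiv ℂ Φ z v) (dvb (fderiv ℂ Φ z w) f) (Φ z) := by
  have hΦd : DifferentiableAt ℂ Φ z := hΦ.differentiableAt (by simp)
  have hΦe : ∀ᶠ q in nhds z, DifferentiableAt ℂ Φ q := by
    filter_upwards [(hΦ.of_le (m := 1) le_top).eventually (by simp)] with q hq
    exact hq.differentiableAt (by simp)
  have hfe : ∀ᶠ q in nhds z, DifferentiableAt ℝ f (Φ q) := by
    have := hΦd.continuousAt.eventually (hf.eventually (by simp))
    filter_upwards [this] with q hq using hq.differentiableAt (by simp)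
  have hD : DifferentiableAt ℂ (fun q => fderiv ℂ Φ q w) z :=
    ((hΦ.fderiv_right (m := 1) le_top).differentiableAt (by simp)).clm_apply
      (differentiableAt_const w)
  have hDl : ∀ l, DifferentiableAt ℂ (fun q => fderiv ℂ Φ q w l) z := fun l =>
    (differentiableAt_pi.1 hD) l
  have e : dvb w (fun q => f (Φ q)) =ᶠ[nhds z]
      fun q => ∑ l, conj (fderiv ℂ Φ q w l) * dzbar l f (Φ q) := by
    filter_upwards [hΦe, hfe] with q h1 h2
    rw [(dv_comp_holomorphic h1 h2 w).2, dvb_eq_sum]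
  have d1 : ∀ l, DifferentiableAt ℝ (fun q => conj (fderiv ℂ Φ q w l)) z := fun l =>
    Complex.conjCLE.differentiableAt.comp z ((hDl l).restrictScalars ℝ)
  have d2' : ∀ l, DifferentiableAt ℝ (dzbar l f) (Φ z) := fun l => by
    rw [dzbar_eq_dvb]; exact differentiableAt_cd hf
  have d2 : ∀ l, DifferentiableAt ℝ (fun q => dzbar l f (Φ q)) z := fun l =>
    (d2' l).comp z (hΦd.restrictScalars ℝ)
  rw [dv_dvb_eq_sum _ _ hf, show dv v (dvb w fun q => f (Φ q)) z
      = dv v (fun q => ∑ l, conj (fderiv ℂ Φ q w l) * dzbar l f (Φ q)) z from cd_congr e,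
    dv, cd_sum (f := fun l q => conj (fderiv ℂ Φ q w l) * dzbar l f (Φ q)) _
      fun l _ => (d1 l).mul (d2 l)]
  refine Finset.sum_congr rfl fun l _ => ?_
  rw [cd_mul (d1 l) (d2 l)]
  change dv v (fun q => conj (fderiv ℂ Φ q w l)) z * _
    + _ * dv v (fun q => dzbar l f (Φ q)) z = _
  rw [dv_conj_holomorphic (hDl l), (dv_comp_holomorphic hΦd (d2' l) v).1]
  ring

end FrameLinear

/-! ### Coordinate changes on the manifold -/

section Charts

variable {n : ℕ} {M : Type*} [TopologicalSpace M] [ChartedSpace (Cn n) M]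

lemma isManifold_real [IsManifold 𝓘(ℂ, Cn n) ω M] : IsManifold 𝓘(ℝ, Cn n) ∞ M := by
  refine isManifold_of_contDiffOn _ _ _ fun e e' he he' => ?_
  have h := (contDiffGroupoid ω 𝓘(ℂ, Cn n)).compatible he he'
  rw [contDiffGroupoid, mem_groupoid_of_pregroupoid] at h
  have h1 : ContDiffOn ℂ ω (𝓘(ℂ, Cn n) ∘ (e.symm.trans e') ∘ 𝓘(ℂ, Cn n).symm)
    (𝓘(ℂ, Cn n).symm ⁻¹' (e.symm.trans e').source ∩ range 𝓘(ℂ, Cn n)) := h.1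
  exact (h1.restrict_scalars ℝ).of_le le_top

/-- The change of coordinates from the chart at `c` to the chart at `y`. -/
def coordChange (c y : M) (w : Cn n) : Cn n := chartAt (Cn n) y ((chartAt (Cn n) c).symm w)

lemma contDiffAt_coordChange [IsManifold 𝓘(ℂ, Cn n) ω M] {c y : M} {z : Cn n}
    (hz : z ∈ (chartAt (Cn n) c).target)
    (hy : (chartAt (Cn n) c).symm z ∈ (chartAt (Cn n) y).source) :
    ContDiffAt ℂ ω (coordChange c y) z := by
  have h := (contDiffGroupoid ω 𝓘(ℂ, Cn n)).compatible (chart_mem_atlas (Cn n) c)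
    (chart_mem_atlas (Cn n) y)
  rw [contDiffGroupoid, mem_groupoid_of_pregroupoid] at h
  have h1 : ContDiffOn ℂ ω (𝓘(ℂ, Cn n) ∘ ((chartAt (Cn n) c).symm.trans (chartAt (Cn n) y))
      ∘ 𝓘(ℂ, Cn n).symm) (𝓘(ℂ, Cn n).symm ⁻¹'
      ((chartAt (Cn n) c).symm.trans (chartAt (Cn n) y)).source ∩ range 𝓘(ℂ, Cn n)) := h.1
  have h2 : ContDiffOn ℂ ω (coordChange c y)
      ((chartAt (Cn n) c).symm.trans (chartAt (Cn n) y)).source := by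
    have h3 : coordChange c y = chartAt (Cn n) y ∘ (chartAt (Cn n) c).symm := rfl
    rw [h3]
    simpa using h1
  refine h2.contDiffAt (((chartAt (Cn n) c).symm.trans (chartAt (Cn n) y)).open_source.mem_nhds ?_)
  simp [hz, hy]

/-- The tangent space at a point is modelled on the preferred chart there, so the derivative of the
inverse of another chart is the Jacobian of a change of coordinates. -/
lemma coordVec_eq [IsManifold 𝓘(ℂ, Cn n) ω M] {c : M} {z : Cn n}
    (hz : z ∈ (chartAt (Cn n) c).target) (i : Fin n) :
    (coordVec c i z : Cn n)
      = fderiv ℂ (coordChange c ((chartAt (Cn n) c).symm z)) z (basisVec i) := by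
  have : IsManifold 𝓘(ℂ, Cn n) 1 M := IsManifold.of_le (n := ω) le_top
  have hd : MDifferentiableAt 𝓘(ℂ, Cn n) 𝓘(ℂ, Cn n) (chartAt (Cn n) c).symm z :=
    mdifferentiableAt_atlas_symm (chart_mem_atlas (Cn n) c) hz
  rw [coordVec, hd.mfderiv]
  simp only [writtenInExtChartAt, extChartAt, mfld_simps]
  rw [fderivWithin_univ]
  rfl

/-- The conjugate Jacobian matrix of the change of coordinates from the chart at `c` to the
preferred chart. -/
def jacW (c : M) (z : Cn n) : Matrix (Fin n) (Fin n) ℂ :=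
  Matrix.of fun k i =>
    conj (fderiv ℂ (coordChange c ((chartAt (Cn n) c).symm z)) z (basisVec i) k)

lemma matrix_form_apply (L : Cn n →ₗ[ℂ] Cn n →ₗ⋆[ℂ] ℂ) (v w : Cn n) :
    L v w = ∑ k, ∑ l, v k * conj (w l) * L (basisVec k) (basisVec l) := by
  conv_lhs => rw [eq_sum_basisVec v, eq_sum_basisVec w]
  simp only [map_sum, LinearMap.sum_apply, LinearMap.smul_apply,
    LinearMap.map_smulₛₗ, smul_eq_mul, Finset.mul_sum, RingHom.id_apply]
  rw [Finset.sum_comm]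
  refine Finset.sum_congr rfl fun k _ => Finset.sum_congr rfl fun l _ => by ring

lemma fderiv_coordChange_self [IsManifold 𝓘(ℂ, Cn n) ω M] (x : M) :
    fderiv ℂ (coordChange (n := n) x x) (chartAt (Cn n) x x) = ContinuousLinearMap.id ℂ _ := by
  have : coordChange (n := n) x x =ᶠ[nhds (chartAt (Cn n) x x)] id := by
    filter_upwards [(chartAt (Cn n) x).open_target.mem_nhds (mem_chart_target (Cn n) x)] with w hw
    exact (chartAt (Cn n) x).right_inv hw
  rw [this.fderiv_eq, fderiv_id]

/-- The metric at a point as a form on the model space. -/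
def formAt (g : HermitianMetric n M) (x : M) : Cn n →ₗ[ℂ] Cn n →ₗ⋆[ℂ] ℂ := g.form x

lemma coeff_apply_aux (g : HermitianMetric n M) (c : M) (z : Cn n) (i j : Fin n) :
    g.coeff c z i j
      = formAt g ((chartAt (Cn n) c).symm z) (coordVec c i z) (coordVec c j z) := rfl

lemma matrixAt_apply [IsManifold 𝓘(ℂ, Cn n) ω M] (g : HermitianMetric n M) (x : M) (i j : Fin n) :
    g.matrixAt x i j = formAt g x (basisVec i) (basisVec j) := by
  have hx : (chartAt (Cn n) x).symm (chartAt (Cn n) x x) = x :=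
    (chartAt (Cn n) x).left_inv (mem_chart_source (Cn n) x)
  rw [HermitianMetric.matrixAt, coeff_apply_aux, coordVec_eq (mem_chart_target (Cn n) x),
    coordVec_eq (mem_chart_target (Cn n) x), hx, fderiv_coordChange_self]
  rfl

open Matrix in
lemma coeff_eq_conj [IsManifold 𝓘(ℂ, Cn n) ω M] (g : HermitianMetric n M) {c : M} {z : Cn n}
    (hz : z ∈ (chartAt (Cn n) c).target) :
    g.coeff c z
      = (jacW c z)ᴴ * g.matrixAt ((chartAt (Cn n) c).symm z) * jacW c z := by
  ext i j
  rw [coeff_apply_aux, coordVec_eq hz, coordVec_eq hz, matrix_form_apply]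
  simp only [mul_apply, conjTranspose_apply, jacW, of_apply, matrixAt_apply, Finset.sum_mul]
  rw [Finset.sum_comm]
  refine Finset.sum_congr rfl fun k _ => Finset.sum_congr rfl fun l _ => ?_
  rw [Complex.star_def, Complex.conj_conj]; ring

/-- The opposite change of coordinates provides a left inverse. -/
lemma isUnit_jacW [IsManifold 𝓘(ℂ, Cn n) ω M] {c : M} {z : Cn n}
    (hz : z ∈ (chartAt (Cn n) c).target) :
    IsUnit (jacW c z) := by
  set y := (chartAt (Cn n) c).symm z with hy
  have hyc : y ∈ (chartAt (Cn n) c).source := (chartAt (Cn n) c).map_target hz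
  have hyy := mem_chart_source (Cn n) y
  have hzy : coordChange c y z = chartAt (Cn n) y y := rfl
  have h1 : DifferentiableAt ℂ (coordChange c y) z :=
    (contDiffAt_coordChange hz hyy).differentiableAt (by simp)
  have h2 : DifferentiableAt ℂ (coordChange y c) (coordChange c y z) := by
    refine (contDiffAt_coordChange (mem_chart_target (Cn n) y) ?_).differentiableAt (by simp)
    rwa [(chartAt (Cn n) y).left_inv hyy]
  have h3 : (fun w => coordChange y c (coordChange c y w)) =ᶠ[nhds z] id := by
    have o : z ∈ ((chartAt (Cn n) c).symm.trans (chartAt (Cn n) y)).source := by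
      simp [hz, ← hy]
    filter_upwards [((chartAt (Cn n) c).symm.trans (chartAt (Cn n) y)).open_source.mem_nhds o]
      with w hw
    simp only [mfld_simps] at hw
    simp [coordChange, (chartAt (Cn n) y).left_inv hw.2, (chartAt (Cn n) c).right_inv hw.1]
  have h4 : (fderiv ℂ (coordChange y c) (coordChange c y z)).comp
      (fderiv ℂ (coordChange c y) z) = ContinuousLinearMap.id ℂ _ := by
    rw [← fderiv_comp z h2 h1, ← fderiv_id (𝕜 := ℂ) (x := z)]
    exact h3.fderiv_eq
  set J := fderiv ℂ (coordChange c y) z with hJ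
  set J' := fderiv ℂ (coordChange y c) (coordChange c y z) with hJ'
  refine (Matrix.isUnit_iff_isUnit_det _).2 (Matrix.isUnit_det_of_left_inverse
    (B := Matrix.of fun k i => conj (J' (basisVec i) k)) ?_)
  ext i j
  simp only [Matrix.mul_apply, jacW, Matrix.of_apply]
  have e : J' (J (basisVec j)) = (basisVec j : Cn n) := by
    have := congrArg (fun L : Cn n →L[ℂ] Cn n => L (basisVec j)) h4
    simpa using this
  have e2 : J' (J (basisVec j)) = ∑ k, J (basisVec j) k • J' (basisVec k) := by
    conv_lhs => rw [eq_sum_basisVec (J (basisVec j)), map_sum]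
    simp only [map_smul]
  have e3 := congrArg (fun v : Cn n => conj (v i)) (e2.symm.trans e)
  simp only [Finset.sum_apply, Pi.smul_apply, smul_eq_mul, map_sum, map_mul] at e3
  simp only [← hy, ← hJ]
  rw [Finset.sum_congr rfl fun k _ => mul_comm _ _, e3]
  simp [basisVec, Pi.single_apply, Matrix.one_apply, apply_ite]

-- Changes of coordinates are holomorphic, so the complex Hessian transforms as a tensor, with the
-- same matrix as the metric. Traces and determinant ratios, defined in preferred charts, can thus
-- be computed in any chart, which is needed before they can be differentiated.
open Matrix in
lemma hessF_chart_eq_conj [IsManifold 𝓘(ℂ, Cn n) ω M] {c : M} {z : Cn n}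
    (hz : z ∈ (chartAt (Cn n) c).target) {u : M → ℝ}
    (hu : ContDiffAt ℝ 2 (fun w => u ((chartAt (Cn n) ((chartAt (Cn n) c).symm z)).symm w))
      (chartAt (Cn n) ((chartAt (Cn n) c).symm z) ((chartAt (Cn n) c).symm z))) :
    hessF basisVec (fun w => u ((chartAt (Cn n) c).symm w)) z
      = (jacW c z)ᴴ * complexHessian n u ((chartAt (Cn n) c).symm z) * jacW c z := by
  set y := (chartAt (Cn n) c).symm z with hy
  have hyy := mem_chart_source (Cn n) y
  set f : Cn n → ℝ := fun w => u ((chartAt (Cn n) y).symm w) with hf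
  have hzy : coordChange c y z = chartAt (Cn n) y y := rfl
  have o : z ∈ ((chartAt (Cn n) c).symm.trans (chartAt (Cn n) y)).source := by
    simp [hz, ← hy]
  have e : ∀ w ∈ ((chartAt (Cn n) c).symm.trans (chartAt (Cn n) y)).source,
      ((u ((chartAt (Cn n) c).symm w) : ℝ) : ℂ) = ((f (coordChange c y w) : ℝ) : ℂ) := by
    intro w hw
    simp only [mfld_simps] at hw
    simp [hf, coordChange, (chartAt (Cn n) y).left_inv hw.2]
  have oo := ((chartAt (Cn n) c).symm.trans (chartAt (Cn n) y)).open_source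
  have hfC : ContDiffAt ℝ 2 (fun q => ((f q : ℝ) : ℂ)) (coordChange c y z) :=
    Complex.ofRealCLM.contDiff.contDiffAt.comp _ hu
  have h1 : hessF basisVec (fun w => u ((chartAt (Cn n) c).symm w)) z
      = hessF (fun i => fderiv ℂ (coordChange c y) z (basisVec i)) f (coordChange c y z) := by
    ext i j
    change dv _ (dvb _ _) z = dv _ (dvb _ _) _
    rw [← dv_dvb_comp_holomorphic (contDiffAt_coordChange hz hyy) hfC]
    exact cd_congr_on oo o fun w hw => cd_congr_on oo hw e
  rw [h1, hessF_eq_conj _ (z := coordChange c y z) hu]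
  have h2 : hessF basisVec f (coordChange c y z) = complexHessian n u y := by
    ext i j
    simp only [hessF, complexHessian, Matrix.of_apply, ← dz_eq_dv, ← dzbar_eq_dvb]
    rfl
  rw [h2]
  rfl

end Charts

/-! ### The metric and functions in a fixed chart -/

section ChartExpressions

variable {n : ℕ} {M : Type*} [TopologicalSpace M] [ChartedSpace (Cn n) M]

lemma contDiffOn_chart [IsManifold 𝓘(ℂ, Cn n) ω M] {u : M → ℝ}
    (hu : ContMDiff 𝓘(ℝ, Cn n) 𝓘(ℝ, ℝ) ∞ u) (c : M) :
    ContDiffOn ℝ ∞ (fun z => u ((chartAt (Cn n) c).symm z)) (chartAt (Cn n) c).target := by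
  have : IsManifold 𝓘(ℝ, Cn n) ∞ M := isManifold_real
  rw [← contMDiffOn_iff_contDiffOn]
  exact hu.comp_contMDiffOn (contMDiffOn_chart_symm (n := ∞))

lemma contDiffOn_chart_prod [IsManifold 𝓘(ℂ, Cn n) ω M] {φ : M → ℝ → ℝ} {I : Set ℝ}
    (hφ : ContMDiffOn (𝓘(ℝ, Cn n).prod 𝓘(ℝ, ℝ)) 𝓘(ℝ, ℝ) ∞ (fun p : M × ℝ => φ p.1 p.2)
      (univ ×ˢ I)) (c : M) :
    ContDiffOn ℝ ∞ (fun p : Cn n × ℝ => φ ((chartAt (Cn n) c).symm p.1) p.2)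
      ((chartAt (Cn n) c).target ×ˢ I) := by
  have : IsManifold 𝓘(ℝ, Cn n) ∞ M := isManifold_real
  rw [← contMDiffOn_iff_contDiffOn, modelWithCornersSelf_prod, ← chartedSpaceSelf_prod]
  have h1 : ContMDiffOn (𝓘(ℝ, Cn n).prod 𝓘(ℝ, ℝ)) (𝓘(ℝ, Cn n).prod 𝓘(ℝ, ℝ)) ∞
      (Prod.map (chartAt (Cn n) c).symm id : Cn n × ℝ → M × ℝ)
      ((chartAt (Cn n) c).target ×ˢ I) :=
    (contMDiffOn_chart_symm (n := ∞)).prodMap (contMDiff_id.contMDiffOn)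
  exact hφ.comp h1 fun p hp => ⟨mem_univ _, hp.2⟩

lemma contMDiff_slice {φ : M → ℝ → ℝ} {I : Set ℝ}
    (hφ : ContMDiffOn (𝓘(ℝ, Cn n).prod 𝓘(ℝ, ℝ)) 𝓘(ℝ, ℝ) ∞ (fun p : M × ℝ => φ p.1 p.2)
      (univ ×ˢ I)) {t : ℝ} (ht : t ∈ I) :
    ContMDiff 𝓘(ℝ, Cn n) 𝓘(ℝ, ℝ) ∞ (fun x => φ x t) := by
  rw [← contMDiffOn_univ]
  have h1 : ContMDiffOn 𝓘(ℝ, Cn n) (𝓘(ℝ, Cn n).prod 𝓘(ℝ, ℝ)) ∞ (fun x : M => (x, t)) univ :=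
    (contMDiff_id.prodMk contMDiff_const).contMDiffOn
  exact hφ.comp h1 fun x _ => ⟨mem_univ _, ht⟩

lemma contDiffAt_chart_self [IsManifold 𝓘(ℂ, Cn n) ω M] {u : M → ℝ}
    (hu : ContMDiff 𝓘(ℝ, Cn n) 𝓘(ℝ, ℝ) ∞ u) (c : M) {z : Cn n}
    (hz : z ∈ (chartAt (Cn n) c).target) :
    ContDiffAt ℝ 2 (fun z => u ((chartAt (Cn n) c).symm z)) z :=
  ((contDiffOn_chart hu c).contDiffAt ((chartAt (Cn n) c).open_target.mem_nhds hz)).of_le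
    two_le_infty

open Matrix in
lemma posDef_matrixAt [IsManifold 𝓘(ℂ, Cn n) ω M] (g : HermitianMetric n M) (x : M) :
    (g.matrixAt x).PosDef := by
  refine PosDef.of_dotProduct_mulVec_pos ?_ ?_
  · ext i j
    rw [conjTranspose_apply, matrixAt_apply, matrixAt_apply, Complex.star_def]
    exact g.conj_symm x _ _
  · intro v hv
    -- The dot product conjugates its left vector, whereas the form is conjugate-linear in its
    -- second slot; hence the conjugate vector.
    set w : Cn n := fun i => conj (v i) with hw
    have hw0 : w ≠ 0 := fun h => hv <| funext fun i => by
      have := congrFun h i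
      simpa [hw] using this
    have e : star v ⬝ᵥ g.matrixAt x *ᵥ v = formAt g x w w := by
      rw [matrix_form_apply, dotProduct]
      refine Finset.sum_congr rfl fun i _ => ?_
      rw [mulVec, dotProduct, Finset.mul_sum]
      refine Finset.sum_congr rfl fun j _ => ?_
      rw [matrixAt_apply]
      simp only [hw, Complex.conj_conj, Pi.star_apply, Complex.star_def]
      ring
    rw [e, Complex.lt_def]
    refine ⟨g.pos x w hw0, ?_⟩
    have h2 : conj (formAt g x w w) = formAt g x w w := g.conj_symm x w w
    exact (Complex.conj_eq_iff_im.1 h2).symm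

lemma posDef_coeff [IsManifold 𝓘(ℂ, Cn n) ω M] (g : HermitianMetric n M) {c : M} {z : Cn n}
    (hz : z ∈ (chartAt (Cn n) c).target) : (g.coeff c z).PosDef := by
  rw [coeff_eq_conj g hz]
  exact (Matrix.IsUnit.posDef_star_left_conjugate_iff (isUnit_jacW hz)).2 (posDef_matrixAt g _)

/-- The matrix `g_{i j̄} + ∂_i ∂_{j̄} u` in the chart centred at `c`. -/
def pertC (g : HermitianMetric n M) (c : M) (u : M → ℝ) (z : Cn n) :
    Matrix (Fin n) (Fin n) ℂ :=
  g.coeff c z + hessF basisVec (fun w => u ((chartAt (Cn n) c).symm w)) z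

variable [IsManifold 𝓘(ℂ, Cn n) ω M] (g : HermitianMetric n M) {c : M} {z : Cn n} {u : M → ℝ}

open Matrix in
lemma hessF_chart (hu : ContMDiff 𝓘(ℝ, Cn n) 𝓘(ℝ, ℝ) ∞ u)
    (hz : z ∈ (chartAt (Cn n) c).target) :
    hessF basisVec (fun w => u ((chartAt (Cn n) c).symm w)) z
      = (jacW c z)ᴴ * complexHessian n u ((chartAt (Cn n) c).symm z) * jacW c z :=
  hessF_chart_eq_conj hz (contDiffAt_chart_self hu _ (mem_chart_target _ _))

open Matrix in
lemma pertC_eq_conj (hu : ContMDiff 𝓘(ℝ, Cn n) 𝓘(ℝ, ℝ) ∞ u)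
    (hz : z ∈ (chartAt (Cn n) c).target) :
    pertC g c u z
      = (jacW c z)ᴴ * g.perturbed u ((chartAt (Cn n) c).symm z) * jacW c z := by
  rw [pertC, HermitianMetric.perturbed, coeff_eq_conj g hz, hessF_chart hu hz, Matrix.mul_add,
    Matrix.add_mul]

lemma trWrt_pertC (hu : ContMDiff 𝓘(ℝ, Cn n) 𝓘(ℝ, ℝ) ∞ u)
    (hz : z ∈ (chartAt (Cn n) c).target) :
    trWrt (g.coeff c z) (pertC g c u z) = trWrt (g.matrixAt ((chartAt (Cn n) c).symm z))
      (g.perturbed u ((chartAt (Cn n) c).symm z)) := by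
  rw [pertC_eq_conj g hu hz, coeff_eq_conj g hz, trWrt_conj (isUnit_jacW hz)]

lemma trWrt_hessF (hu : ContMDiff 𝓘(ℝ, Cn n) 𝓘(ℝ, ℝ) ∞ u)
    (hz : z ∈ (chartAt (Cn n) c).target) :
    trWrt (g.coeff c z) (hessF basisVec (fun w => u ((chartAt (Cn n) c).symm w)) z)
      = g.laplacian u ((chartAt (Cn n) c).symm z) := by
  rw [hessF_chart hu hz, coeff_eq_conj g hz, trWrt_conj (isUnit_jacW hz),
    HermitianMetric.laplacian]

lemma det_div_pertC (hu : ContMDiff 𝓘(ℝ, Cn n) 𝓘(ℝ, ℝ) ∞ u)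
    (hz : z ∈ (chartAt (Cn n) c).target) :
    (pertC g c u z).det / (g.coeff c z).det
      = (g.perturbed u ((chartAt (Cn n) c).symm z)).det
        / (g.matrixAt ((chartAt (Cn n) c).symm z)).det := by
  rw [pertC_eq_conj g hu hz, coeff_eq_conj g hz, det_div_conj (isUnit_jacW hz)]

lemma posDef_pertC (hu : ContMDiff 𝓘(ℝ, Cn n) 𝓘(ℝ, ℝ) ∞ u)
    (hpos : ∀ x, (g.perturbed u x).PosDef)
    (hz : z ∈ (chartAt (Cn n) c).target) : (pertC g c u z).PosDef := by
  rw [pertC_eq_conj g hu hz]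
  exact (Matrix.IsUnit.posDef_star_left_conjugate_iff (isUnit_jacW hz)).2 (hpos _)

end ChartExpressions

/-! ### Derivatives in space and time -/

section SpaceTime

variable {E : Type*} [NormedAddCommGroup E] [NormedSpace ℝ E]

lemma cd_slice {G : E × ℝ → ℂ} {z : E} {t : ℝ} (hG : DifferentiableAt ℝ G (z, t)) (a b : E) :
    cd a b (fun q => G (q, t)) z = cd (a, (0 : ℝ)) (b, (0 : ℝ)) G (z, t) := by
  have h1 : HasFDerivAt (fun q : E => (q, t)) (ContinuousLinearMap.inl ℝ E ℝ) z :=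
    hasFDerivAt_prodMk_left z t
  have h2 : HasFDerivAt (fun q => G (q, t))
      ((fderiv ℝ G (z, t)).comp (ContinuousLinearMap.inl ℝ E ℝ)) z :=
    hG.hasFDerivAt.comp z h1
  simp [cd, h2.fderiv]

lemma hasDerivAt_slice {G : E × ℝ → ℂ} {z : E} {t : ℝ} (hG : DifferentiableAt ℝ G (z, t)) :
    HasDerivAt (fun s => G (z, s)) (cd ((0 : E), (1 : ℝ)) 0 G (z, t)) t := by
  have h1 : HasDerivAt (fun s : ℝ => (z, s)) ((0 : E), (1 : ℝ)) t :=
    (hasDerivAt_const t z).prodMk (hasDerivAt_id t)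
  exact (hG.hasFDerivAt.comp_hasDerivAt t h1).congr_deriv (by simp [cd])

/-- Time derivatives commute with second order space derivatives. -/
lemma hasDerivAt_cd_cd {G : E × ℝ → ℂ} {U : Set E} {I : Set ℝ} (hU : IsOpen U) (hI : IsOpen I)
    (hG : ContDiffOn ℝ ∞ G (U ×ˢ I)) {f : E → ℂ} {z : E} {t : ℝ} (hz : z ∈ U) (ht : t ∈ I)
    (hf : ∀ q ∈ U, HasDerivAt (fun s => G (q, s)) (f q) t) (a b a' b' : E) :
    HasDerivAt (fun s => cd a b (cd a' b' fun q => G (q, s)) z) (cd a b (cd a' b' f) z) t := by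
  have hO : IsOpen (U ×ˢ I) := hU.prod hI
  have dG : ∀ q ∈ U, ∀ s ∈ I, DifferentiableAt ℝ G (q, s) := fun q hq s hs =>
    differentiableAt_of_contDiffOn hO (mk_mem_prod hq hs) hG
  have hG1 : ContDiffOn ℝ ∞ (cd (a', (0 : ℝ)) (b', (0 : ℝ)) G) (U ×ˢ I) := contDiffOn_cd hO hG
  have hG2 : ContDiffOn ℝ ∞ (cd (a, (0 : ℝ)) (b, (0 : ℝ)) (cd (a', (0 : ℝ)) (b', (0 : ℝ)) G))
    (U ×ˢ I) := contDiffOn_cd hO hG1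
  have hGt : ContDiffOn ℝ ∞ (cd ((0 : E), (1 : ℝ)) 0 G) (U ×ˢ I) := contDiffOn_cd hO hG
  have e1 : ∀ {H : E × ℝ → ℂ}, ContDiffOn ℝ ∞ H (U ×ˢ I) → ∀ s ∈ I,
      cd a b (cd a' b' fun q => H (q, s)) z
        = cd (a, (0 : ℝ)) (b, (0 : ℝ)) (cd (a', (0 : ℝ)) (b', (0 : ℝ)) H) (z, s) := by
    intro H hH s hs
    have dH : ∀ q ∈ U, DifferentiableAt ℝ H (q, s) := fun q hq =>
      differentiableAt_of_contDiffOn hO (mk_mem_prod hq hs) hH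
    rw [cd_congr_on hU hz fun q hq => cd_slice (dH q hq) a' b']
    exact cd_slice (differentiableAt_of_contDiffOn hO (mk_mem_prod hz hs)
      (contDiffOn_cd hO hH)) a b
  have h2 := hasDerivAt_slice (differentiableAt_of_contDiffOn hO (mk_mem_prod hz ht) hG2)
  have e2 : cd a b (cd a' b' f) z = cd ((0 : E), (1 : ℝ)) 0
      (cd (a, (0 : ℝ)) (b, (0 : ℝ)) (cd (a', (0 : ℝ)) (b', (0 : ℝ)) G)) (z, t) := by
    have k1 : ∀ q ∈ U, f q = cd ((0 : E), (1 : ℝ)) 0 G (q, t) := fun q hq =>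
      (hf q hq).unique (hasDerivAt_slice (dG q hq t ht))
    have k2 : cd a b (cd a' b' f) z
        = cd a b (cd a' b' fun q => cd ((0 : E), (1 : ℝ)) 0 G (q, t)) z :=
      cd_congr_on hU hz fun q hq => cd_congr_on hU hq k1
    rw [k2, e1 hGt t ht, cd_comm hO (mk_mem_prod hz ht) hG1]
    exact cd_congr_on hO (mk_mem_prod hz ht) fun p hp => cd_comm hO hp hG
  rw [e2]
  refine h2.congr_of_eventuallyEq ?_
  filter_upwards [hI.mem_nhds ht] with s hs
  exact e1 hG s hs

/-- Space derivatives of a function which is smooth on `U × I`, up to the boundary of `I`. -/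
lemma contDiffOn_cd_slice {G : E × ℝ → ℂ} {U : Set E} {I : Set ℝ} (hU : IsOpen U)
    (hI : UniqueDiffOn ℝ I) (hG : ContDiffOn ℝ ∞ G (U ×ˢ I)) (a b : E) :
    ContDiffOn ℝ ∞ (fun p : E × ℝ => cd a b (fun q => G (q, p.2)) p.1) (U ×ˢ I) := by
  have hs : UniqueDiffOn ℝ (U ×ˢ I) := hU.uniqueDiffOn.prod hI
  -- At an endpoint of `I` only the derivative within `U ×ˢ I` is available. In space directions it
  -- agrees with the ordinary derivative of the slice, because `U` is open.
  have h1 : ContDiffOn ℝ ∞ (fderivWithin ℝ G (U ×ˢ I)) (U ×ˢ I) :=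
    hG.fderivWithin hs (by simp)
  have h2 : ContDiffOn ℝ ∞ (fun p : E × ℝ => fderivWithin ℝ G (U ×ˢ I) p (a, (0 : ℝ))
      + Complex.I * fderivWithin ℝ G (U ×ˢ I) p (b, (0 : ℝ))) (U ×ˢ I) :=
    (h1.clm_apply contDiffOn_const).add (contDiffOn_const.mul (h1.clm_apply contDiffOn_const))
  refine h2.congr ?_
  rintro ⟨z, t⟩ ⟨hz, ht⟩
  have d : DifferentiableWithinAt ℝ G (U ×ˢ I) (z, t) :=
    (hG (z, t) ⟨hz, ht⟩).differentiableWithinAt (by simp)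
  have h3 : HasFDerivWithinAt (fun q : E => (q, t)) (ContinuousLinearMap.inl ℝ E ℝ) U z :=
    (hasFDerivAt_prodMk_left z t).hasFDerivWithinAt
  have h4 : HasFDerivWithinAt (fun q => G (q, t))
      ((fderivWithin ℝ G (U ×ˢ I) (z, t)).comp (ContinuousLinearMap.inl ℝ E ℝ)) U z :=
    d.hasFDerivWithinAt.comp z h3 fun q hq => mk_mem_prod hq ht
  have h5 := (h4.hasFDerivAt (hU.mem_nhds hz)).fderiv
  simp [cd, h5]

end SpaceTime

/-! ### Maximum and comparison principles -/

section MaxPrinciple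

/-- Left difference quotients at `t` are nonnegative. Only earlier times are compared, so a maximum
at the final time is allowed. -/
lemma deriv_nonneg_of_max_left {f : ℝ → ℝ} {d t : ℝ} {s : Set ℝ} (ht : 0 < t)
    (hs : Icc 0 t ⊆ s) (hd : HasDerivWithinAt f d s t) (hmax : ∀ r ∈ Icc 0 t, f r ≤ f t) :
    0 ≤ d := by
  have h := (hasDerivWithinAt_iff_tendsto_slope.1 (hd.mono hs))
  rw [Icc_sdiff_right] at h
  have hne : (nhdsWithin t (Ico 0 t)).NeBot := by
    rw [nhdsWithin_Ico_eq_nhdsLT ht]; infer_instance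
  refine ge_of_tendsto h ?_
  filter_upwards [self_mem_nhdsWithin] with r hr
  rw [slope_def_field]
  exact div_nonneg_of_nonpos (sub_nonpos.2 (hmax r ⟨hr.1, hr.2.le⟩)) (sub_nonpos.2 hr.2.le)

lemma abs_deriv_le_of_lipschitz_right {f : ℝ → ℝ} {d t t₁ K : ℝ} {s : Set ℝ} (ht : t < t₁)
    (hs : Ico t t₁ ⊆ s) (hd : HasDerivWithinAt f d s t)
    (hlip : ∀ r ∈ Ico t t₁, |f r - f t| ≤ K * (r - t)) : |d| ≤ K := by
  have h := (hasDerivWithinAt_iff_tendsto_slope.1 (hd.mono hs)).abs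
  rw [show Ico t t₁ \ {t} = Ioo t t₁ from by
    ext r; simp only [mem_sdiff, mem_Ico, mem_singleton_iff, mem_Ioo]
    constructor
    · rintro ⟨⟨h1, h2⟩, h3⟩; exact ⟨lt_of_le_of_ne h1 (Ne.symm h3), h2⟩
    · rintro ⟨h1, h2⟩; exact ⟨⟨h1.le, h2⟩, h1.ne'⟩] at h
  have hne : (nhdsWithin t (Ioo t t₁)).NeBot := by
    rw [nhdsWithin_Ioo_eq_nhdsGT ht]; infer_instance
  refine le_of_tendsto h ?_
  filter_upwards [self_mem_nhdsWithin] with r hr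
  have hr0 : 0 < r - t := sub_pos.2 hr.1
  rw [slope_def_field, abs_div, abs_of_pos hr0, div_le_iff₀ hr0]
  exact hlip r ⟨hr.1.le, hr.2⟩

variable {M : Type*} [TopologicalSpace M] [CompactSpace M]

/-- Subtracting `ε t` makes the inequality strict: a maximum at a positive time would force `d - ε ≥
0` with `d ≤ 0`. -/
lemma parabolic_max_principle {w : M → ℝ → ℝ} {t₀ B : ℝ}
    (hc : ContinuousOn (fun p : M × ℝ => w p.1 p.2) (univ ×ˢ Icc 0 t₀))
    (hB : ∀ x, w x 0 ≤ B)
    (hd : ∀ t ∈ Ioc 0 t₀, ∀ x, (∀ y, w y t ≤ w x t) →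
      ∃ d ≤ 0, HasDerivWithinAt (w x) d (Icc 0 t₀) t) :
    ∀ x, ∀ t ∈ Icc 0 t₀, w x t ≤ B := by
  intro x t ht
  have key : ∀ ε > 0, w x t ≤ B + ε * t := by
    intro ε hε
    have hK : IsCompact ((univ : Set M) ×ˢ Icc (0 : ℝ) t₀) := isCompact_univ.prod isCompact_Icc
    have hc' : ContinuousOn (fun p : M × ℝ => w p.1 p.2 - ε * p.2) (univ ×ˢ Icc 0 t₀) :=
      hc.sub (by fun_prop)
    obtain ⟨⟨x₁, t₁⟩, ⟨-, ht₁⟩, hmax⟩ := hK.exists_isMaxOn ⟨(x, t), mem_univ _, ht⟩ hc'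
    simp only at ht₁
    have hm : ∀ y, ∀ s ∈ Icc 0 t₀, w y s - ε * s ≤ w x₁ t₁ - ε * t₁ := fun y s hs =>
      hmax (show (y, s) ∈ univ ×ˢ Icc 0 t₀ from ⟨mem_univ _, hs⟩)
    have h1 := hm x t ht
    rcases ht₁.1.eq_or_lt with h0 | h0
    · rw [← h0] at h1
      linarith [hB x₁]
    · exfalso
      obtain ⟨d, hd0, hdd⟩ := hd t₁ ⟨h0, ht₁.2⟩ x₁ fun y => by linarith [hm y t₁ ht₁]
      have h2 : HasDerivWithinAt (fun s => w x₁ s - ε * s) (d - ε * 1) (Icc 0 t₀) t₁ :=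
        hdd.sub ((hasDerivWithinAt_id _ _).const_mul ε)
      have := deriv_nonneg_of_max_left h0 (Icc_subset_Icc_right ht₁.2) h2
        fun r hr => hm x₁ r ⟨hr.1, hr.2.trans ht₁.2⟩
      linarith
  by_contra hcon
  push Not at hcon
  -- This `ε` is small enough that `ε t < w x t - B`.
  have h1 := key ((w x t - B) / (2 * (t + 1))) (div_pos (by linarith) (by linarith [ht.1]))
  have ht0 := ht.1
  have h2 : (w x t - B) / (2 * (t + 1)) * t < w x t - B := by
    rw [div_mul_eq_mul_div, div_lt_iff₀ (by linarith)]
    nlinarith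
  linarith

end MaxPrinciple

/-! ### Comparison of solutions and the speed bound -/

section Comparison

open Matrix

variable {n : ℕ}

lemma dotProduct_hessF {u : Cn n → ℝ} {z : Cn n} (hu : ContDiffAt ℝ 2 u z) (ζ : Cn n) :
    star ζ ⬝ᵥ (hessF basisVec u z *ᵥ ζ)
      = dv (star ζ) (dvb (star ζ) fun q => ((u q : ℝ) : ℂ)) z := by
  have hu' : ContDiffAt ℝ 2 (fun q => ((u q : ℝ) : ℂ)) z :=
    Complex.ofRealCLM.contDiff.contDiffAt.comp z hu
  rw [dv_dvb_eq_sum _ _ hu']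
  simp only [dv_eq_sum, Finset.mul_sum, dotProduct, mulVec]
  rw [Finset.sum_comm]
  refine Finset.sum_congr rfl fun l _ => Finset.sum_congr rfl fun k _ => ?_
  simp only [hessF, of_apply, ← dz_eq_dv, ← dzbar_eq_dvb, Pi.star_apply, Complex.star_def,
    Complex.conj_conj]
  ring

lemma posSemidef_hessF {U : Set (Cn n)} {u : Cn n → ℝ} {z : Cn n} (hU : IsOpen U) (hz : z ∈ U)
    (hu : ContDiffOn ℝ ∞ u U)
    (h : ∀ w, 0 ≤ (dv w (dvb w fun q => ((u q : ℝ) : ℂ)) z).re) :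
    (hessF basisVec u z).PosSemidef := by
  have hu2 : ContDiffAt ℝ 2 u z := (hu.contDiffAt (hU.mem_nhds hz)).of_le two_le_infty
  have hH := isHermitian_hessF (v := basisVec) hU hu hz
  refine PosSemidef.of_dotProduct_mulVec_nonneg hH fun ζ => ?_
  have him : (star ζ ⬝ᵥ (hessF basisVec u z *ᵥ ζ)).im = 0 := hH.im_star_dotProduct_mulVec_self ζ
  rw [Complex.le_def]
  refine ⟨?_, him.symm⟩
  rw [dotProduct_hessF hu2]
  exact h _

lemma hessF_sub {U : Set (Cn n)} {u₁ u₂ : Cn n → ℝ} {z : Cn n} (hU : IsOpen U) (hz : z ∈ U)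
    (h₁ : ContDiffOn ℝ ∞ u₁ U) (h₂ : ContDiffOn ℝ ∞ u₂ U) (v : Fin n → Cn n) :
    hessF v (fun q => u₁ q - u₂ q) z = hessF v u₁ z - hessF v u₂ z := by
  ext i j
  simp only [hessF, of_apply, Matrix.sub_apply, Complex.ofReal_sub]
  exact dv_dvb_sub hU hz (contDiffOn_ofReal h₁) (contDiffOn_ofReal h₂) _ _

variable {M : Type*} [TopologicalSpace M] [ChartedSpace (Cn n) M]

lemma complexHessian_eq (u : M → ℝ) (x : M) : complexHessian n u x
    = hessF basisVec (fun w => u ((chartAt (Cn n) x).symm w)) (chartAt (Cn n) x x) := by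
  ext i j
  simp only [hessF, complexHessian, Matrix.of_apply, ← dz_eq_dv, ← dzbar_eq_dvb]

lemma posSemidef_hessian_sub_of_max [IsManifold 𝓘(ℂ, Cn n) ω M] {u₁ u₂ : M → ℝ}
    (h₁ : ContMDiff 𝓘(ℝ, Cn n) 𝓘(ℝ, ℝ) ∞ u₁) (h₂ : ContMDiff 𝓘(ℝ, Cn n) 𝓘(ℝ, ℝ) ∞ u₂) {x : M}
    (hmax : ∀ y, u₁ y - u₂ y ≤ u₁ x - u₂ x) :
    (complexHessian n u₂ x - complexHessian n u₁ x).PosSemidef := by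
  have s₁ := contDiffOn_chart h₁ x
  have s₂ := contDiffOn_chart h₂ x
  have hU := (chartAt (Cn n) x).open_target
  have hz := mem_chart_target (Cn n) x
  rw [complexHessian_eq, complexHessian_eq, ← hessF_sub hU hz s₂ s₁]
  refine posSemidef_hessF hU hz (s₂.sub s₁) fun w => ?_
  have hC2 : ContDiffAt ℝ 2 (fun q => u₂ ((chartAt (Cn n) x).symm q)
      - u₁ ((chartAt (Cn n) x).symm q)) (chartAt (Cn n) x x) :=
    ((s₂.sub s₁).contDiffAt (hU.mem_nhds hz)).of_le two_le_infty
  have hmin : IsLocalMin (fun q => u₂ ((chartAt (Cn n) x).symm q)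
      - u₁ ((chartAt (Cn n) x).symm q)) (chartAt (Cn n) x x) := by
    refine Filter.Eventually.of_forall fun q => ?_
    simp only [(chartAt (Cn n) x).left_inv (mem_chart_source (Cn n) x)]
    linarith [hmax ((chartAt (Cn n) x).symm q)]
  rw [re_dv_dvb_ofReal hC2]
  have a1 := fderiv_fderiv_nonneg_of_isLocalMin hC2 hmin w
  have a2 := fderiv_fderiv_nonneg_of_isLocalMin hC2 hmin (Complex.I • w)
  linarith

/-- The logarithm of the relative volume density. -/
def logRatio (g : HermitianMetric n M) (u : M → ℝ) (x : M) : ℝ :=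
  Real.log ((g.perturbed u x).det / (g.matrixAt x).det).re

lemma logRatio_le_of_max [IsManifold 𝓘(ℂ, Cn n) ω M] (g : HermitianMetric n M) {u₁ u₂ : M → ℝ}
    (h₁ : ContMDiff 𝓘(ℝ, Cn n) 𝓘(ℝ, ℝ) ∞ u₁) (h₂ : ContMDiff 𝓘(ℝ, Cn n) 𝓘(ℝ, ℝ) ∞ u₂) {x : M}
    (p₁ : (g.perturbed u₁ x).PosDef) (p₂ : (g.perturbed u₂ x).PosDef)
    (hmax : ∀ y, u₁ y - u₂ y ≤ u₁ x - u₂ x) : logRatio g u₁ x ≤ logRatio g u₂ x := by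
  have h := posSemidef_hessian_sub_of_max h₁ h₂ hmax
  have e : g.perturbed u₂ x - g.perturbed u₁ x
      = complexHessian n u₂ x - complexHessian n u₁ x := by
    simp [HermitianMetric.perturbed]
  rw [← e] at h
  have h3 := log_det_div_nonneg p₁ p₂ h
  rw [log_det_div_re p₂ p₁] at h3
  rw [logRatio, logRatio, log_det_div_re p₁ (posDef_matrixAt g x),
    log_det_div_re p₂ (posDef_matrixAt g x)]
  linarith

/-- Smooth solutions of the flow on a compact time interval, without initial condition. -/
structure FlowOn (g : HermitianMetric n M) (F : M → ℝ) (t₀ : ℝ) (φ : M → ℝ → ℝ) : Prop where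
  cont : ContinuousOn (fun p : M × ℝ => φ p.1 p.2) (univ ×ˢ Icc 0 t₀)
  smooth : ∀ t ∈ Icc 0 t₀, ContMDiff 𝓘(ℝ, Cn n) 𝓘(ℝ, ℝ) ∞ fun x => φ x t
  posDef : ∀ x, ∀ t ∈ Icc 0 t₀, (g.perturbed (fun y => φ y t) x).PosDef
  deriv : ∀ x, ∀ t ∈ Icc 0 t₀,
    HasDerivWithinAt (φ x) (logRatio g (fun y => φ y t) x - F x) (Icc 0 t₀) t

/-- At a spatial maximum of `φ₁ - φ₂ - k t` the logarithms of the volume ratios are ordered by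
`logRatio_le_of_max`, so the time derivative is at most `F₂ - F₁ - k ≤ 0`. -/
lemma FlowOn.comparison [IsManifold 𝓘(ℂ, Cn n) ω M] [CompactSpace M] {g : HermitianMetric n M}
    {F₁ F₂ : M → ℝ} {t₀ : ℝ} {φ₁ φ₂ : M → ℝ → ℝ} (h₁ : FlowOn g F₁ t₀ φ₁)
    (h₂ : FlowOn g F₂ t₀ φ₂) {k B : ℝ} (hk : ∀ x, F₂ x - F₁ x ≤ k)
    (hB : ∀ x, φ₁ x 0 - φ₂ x 0 ≤ B) :
    ∀ x, ∀ t ∈ Icc 0 t₀, φ₁ x t - φ₂ x t ≤ B + k * t := by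
  have key := parabolic_max_principle (w := fun x t => φ₁ x t - φ₂ x t - k * t) (t₀ := t₀) (B := B)
    ((h₁.cont.sub h₂.cont).sub (by fun_prop)) (fun x => by simpa using hB x) ?_
  · intro x t ht
    linarith [key x t ht]
  · intro t ht x hx
    have ht' : t ∈ Icc 0 t₀ := ⟨ht.1.le, ht.2⟩
    refine ⟨_, ?_, ((h₁.deriv x t ht').sub (h₂.deriv x t ht')).sub
      ((hasDerivWithinAt_id _ _).const_mul k)⟩
    have := logRatio_le_of_max g (h₁.smooth t ht') (h₂.smooth t ht') (h₁.posDef x t ht')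
      (h₂.posDef x t ht') fun y => by linarith [hx y]
    linarith [hk x]

lemma logRatio_zero [IsManifold 𝓘(ℂ, Cn n) ω M] (g : HermitianMetric n M) (x : M) :
    g.perturbed (fun _ => 0) x = g.matrixAt x ∧ logRatio g (fun _ => 0) x = 0 := by
  have h0 : complexHessian n (fun _ : M => (0 : ℝ)) x = 0 := by
    ext i j
    have e : dzbar j (fun _ : Cn n => ((0 : ℝ) : ℂ)) = fun _ => 0 := by
      funext z; simp [dzbar]
    simp only [complexHessian, Matrix.of_apply, e]
    simp [dz]
  have h1 : g.perturbed (fun _ => 0) x = g.matrixAt x := by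
    rw [HermitianMetric.perturbed, h0, add_zero]
  refine ⟨h1, ?_⟩
  rw [logRatio, h1, log_det_div_re (posDef_matrixAt g x) (posDef_matrixAt g x), sub_self]

lemma flowOn_zero [IsManifold 𝓘(ℂ, Cn n) ω M] (g : HermitianMetric n M) (t₀ : ℝ) :
    FlowOn g (fun _ => 0) t₀ fun _ _ => 0 where
  cont := continuousOn_const
  smooth _ _ := contMDiff_const
  posDef x _ _ := by rw [(logRatio_zero g x).1]; exact posDef_matrixAt g x
  deriv x t _ := by
    rw [(logRatio_zero g x).2]
    simpa using hasDerivWithinAt_const t (Icc 0 t₀) (0 : ℝ)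

variable {g : HermitianMetric n M} {F : M → ℝ} {T : EReal} {φ : M → ℝ → ℝ}

lemma Icc_subset_timeInterval {t₀ s : ℝ} (hs : 0 ≤ s) (h : ((t₀ + s : ℝ) : EReal) < T) {t : ℝ}
    (ht : t ∈ Icc 0 t₀) : t + s ∈ timeInterval T :=
  ⟨by linarith [ht.1], lt_of_le_of_lt (EReal.coe_le_coe_iff.2 (by linarith [ht.2])) h⟩

lemma IsSolution.flowOn (h : IsSolution g F T φ) {t₀ s : ℝ} (hs : 0 ≤ s)
    (hT : ((t₀ + s : ℝ) : EReal) < T) : FlowOn g F t₀ fun x t => φ x (t + s) where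
  cont := by
    refine h.smooth.continuousOn.comp (f := fun p : M × ℝ => (p.1, p.2 + s)) (by fun_prop) ?_
    rintro ⟨x, t⟩ ⟨-, ht⟩
    exact ⟨mem_univ _, Icc_subset_timeInterval hs hT ht⟩
  smooth t ht := contMDiff_slice h.smooth (Icc_subset_timeInterval hs hT ht)
  posDef x t ht := h.posDef x _ (Icc_subset_timeInterval hs hT ht)
  deriv x t ht := by
    have h1 := h.equation x _ (Icc_subset_timeInterval hs hT ht)
    have h2 : HasDerivWithinAt (fun r : ℝ => r + s) 1 (Icc 0 t₀) t :=
      (hasDerivWithinAt_id t _).add_const s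
    have h3 := h1.scomp t h2 fun r hr => Icc_subset_timeInterval hs hT hr
    exact h3.congr_deriv (one_smul ℝ _)

/-- The flow moves with bounded speed. -/
lemma IsSolution.abs_speed_le [IsManifold 𝓘(ℂ, Cn n) ω M] [CompactSpace M]
    (h : IsSolution g F T φ) {K : ℝ} (hF : ∀ x, |F x| ≤ K) (x : M) {t : ℝ}
    (ht : t ∈ timeInterval T) : |logRatio g (fun y => φ y t) x - F x| ≤ K := by
  -- Comparison with the zero solution, which is the flow for the datum `0`.
  have b1 : ∀ s : ℝ, 0 ≤ s → (s : EReal) < T → ∀ y, |φ y s| ≤ K * s := by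
    intro s hs hsT y
    have f1 : FlowOn g F s φ := by
      have := h.flowOn (t₀ := s) (s := 0) le_rfl (by simpa using hsT)
      simpa using this
    have c1 := f1.comparison (flowOn_zero g s) (k := K) (B := 0)
      (fun x => by linarith [(abs_le.1 (hF x)).1]) (fun x => by simp [h.initial x]) y s ⟨hs, le_rfl⟩
    have c2 := (flowOn_zero g s).comparison f1 (k := K) (B := 0)
      (fun x => by linarith [(abs_le.1 (hF x)).2]) (fun x => by simp [h.initial x]) y s ⟨hs, le_rfl⟩
    exact abs_le.2 ⟨by linarith, by linarith⟩
  obtain ⟨t₁, ht₁, ht₁T⟩ : ∃ t₁ : ℝ, t < t₁ ∧ (t₁ : EReal) < T := by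
    obtain ⟨q, hq1, hq2⟩ := EReal.exists_rat_btwn_of_lt ht.2
    exact ⟨q, EReal.coe_lt_coe_iff.1 hq1, hq2⟩
  refine abs_deriv_le_of_lipschitz_right ht₁ (s := timeInterval T) ?_ (h.equation x t ht) ?_
  · intro r hr
    exact ⟨ht.1.trans hr.1, lt_trans (EReal.coe_lt_coe_iff.2 hr.2) ht₁T⟩
  · intro r hr
    have hr0 : 0 ≤ r - t := sub_nonneg.2 hr.1
    have hrT : (r : EReal) < T := lt_trans (EReal.coe_lt_coe_iff.2 hr.2) ht₁T
    -- The equation is autonomous, so this translate is a flow with the same `F`. Its initial gap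
    -- from `φ`, at most `K (r - t)` by `b1`, cannot grow.
    have f1 : FlowOn g F t fun x s => φ x (s + (r - t)) := h.flowOn hr0 (by simpa using hrT)
    have f2 : FlowOn g F t φ := by
      have := h.flowOn (t₀ := t) (s := 0) le_rfl (by simpa using ht.2)
      simpa using this
    have hrt : ((r - t : ℝ) : EReal) < T :=
      lt_of_le_of_lt (EReal.coe_le_coe_iff.2 (by linarith [ht.1])) hrT
    have i1 := fun y => abs_le.1 (b1 (r - t) hr0 hrt y)
    have c1 := f1.comparison f2 (k := 0) (B := K * (r - t)) (fun x => by simp)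
      (fun y => by simpa [h.initial y] using (i1 y).2) x t ⟨ht.1, le_rfl⟩
    have c2 := f2.comparison f1 (k := 0) (B := K * (r - t)) (fun x => by simp)
      (fun y => by simp only [h.initial y, zero_add]; linarith [(i1 y).1]) x t ⟨ht.1, le_rfl⟩
    simp only [add_sub_cancel, zero_mul, add_zero] at c1 c2
    exact abs_le.2 ⟨by linarith, by linarith⟩

end Comparison

/-! ### The sub-mean value inequality -/

section MeanValue

/-- Differentiation under the integral sign for functions which are continuous together with
their derivative. -/
lemma hasDerivAt_intervalIntegral {G G' : ℝ → ℝ → ℝ} {J : Set ℝ} (hJ : IsOpen J) {α β r₀ : ℝ}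
    (hr₀ : r₀ ∈ J)
    (hG : ContinuousOn (fun p : ℝ × ℝ => G p.1 p.2) (J ×ˢ univ))
    (hG' : ContinuousOn (fun p : ℝ × ℝ => G' p.1 p.2) (J ×ˢ univ))
    (hd : ∀ r ∈ J, ∀ θ, HasDerivAt (fun r => G r θ) (G' r θ) r) :
    HasDerivAt (fun r => ∫ θ in α..β, G r θ) (∫ θ in α..β, G' r₀ θ) r₀ := by
  obtain ⟨ε, hε, hball⟩ := Metric.isOpen_iff.1 hJ r₀ hr₀
  have hcb : Metric.closedBall r₀ (ε / 2) ⊆ J :=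
    (Metric.closedBall_subset_ball (by linarith)).trans hball
  have hslice : ∀ {H : ℝ → ℝ → ℝ}, ContinuousOn (fun p : ℝ × ℝ => H p.1 p.2) (J ×ˢ univ) →
      ∀ r ∈ J, Continuous (H r) := fun {H} hH r hr => by
    have : ContinuousOn (fun θ : ℝ => H r θ) univ :=
      hH.comp (f := fun θ : ℝ => (r, θ)) (by fun_prop) fun θ _ => ⟨hr, mem_univ _⟩
    rwa [continuousOn_univ] at this
  have hK : IsCompact (Metric.closedBall r₀ (ε / 2) ×ˢ uIcc α β) :=
    (isCompact_closedBall _ _).prod isCompact_uIcc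
  obtain ⟨C, hC⟩ := hK.exists_bound_of_continuousOn
    (hG'.mono (prod_mono hcb (subset_univ _)))
  have hs : Metric.ball r₀ (ε / 2) ∈ nhds r₀ := Metric.ball_mem_nhds _ (by linarith)
  refine (intervalIntegral.hasDerivAt_integral_of_dominated_loc_of_deriv_le (F := G) (F' := G')
    (bound := fun _ => C) hs ?_ ?_ ?_ ?_ ?_ ?_).2
  · filter_upwards [hJ.mem_nhds hr₀] with r hr
    exact (hslice hG r hr).aestronglyMeasurable
  · exact (hslice hG r₀ hr₀).intervalIntegrable _ _
  · exact (hslice hG' r₀ hr₀).aestronglyMeasurable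
  · refine Filter.Eventually.of_forall fun θ hθ r hr => ?_
    exact hC (r, θ) ⟨Metric.ball_subset_closedBall hr, uIoc_subset_uIcc hθ⟩
  · exact intervalIntegrable_const
  · refine Filter.Eventually.of_forall fun θ hθ r hr => ?_
    exact hd r (hcb (Metric.ball_subset_closedBall hr)) θ

/-- The sub-mean value inequality on the unit circle for smooth subharmonic functions. -/
lemma circle_mean_value {f : ℂ → ℝ} {R : ℝ} (hR : 1 < R)
    (hf : ContDiffOn ℝ ∞ f (Metric.ball 0 R))
    (hsub : ∀ z ∈ Metric.ball (0 : ℂ) R, ∀ e : ℂ, 0 ≤ fderiv ℝ (fderiv ℝ f) z e e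
      + fderiv ℝ (fderiv ℝ f) z (Complex.I * e) (Complex.I * e)) :
    2 * Real.pi * f 0 ≤ ∫ θ in (0 : ℝ)..(2 * Real.pi), f (Complex.exp (θ * Complex.I)) := by
  set B := Metric.ball (0 : ℂ) R with hB
  have hBo : IsOpen B := Metric.isOpen_ball
  set e : ℝ → ℂ := fun θ => Complex.exp (θ * Complex.I) with he
  have hen : ∀ θ, ‖e θ‖ = 1 := fun θ => Complex.norm_exp_ofReal_mul_I θ
  have hed : ∀ θ, HasDerivAt e (Complex.I * e θ) θ := fun θ => by
    have h1 : HasDerivAt (fun t : ℝ => (t : ℂ) * Complex.I) Complex.I θ := by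
      simpa using (Complex.ofRealCLM.hasDerivAt (x := θ)).mul_const Complex.I
    exact h1.cexp.congr_deriv (mul_comm _ _)
  have hec : Continuous e := continuous_iff_continuousAt.2 fun θ => (hed θ).continuousAt
  set J := Ioo (-R) R with hJ
  have hmem : ∀ r ∈ J, ∀ θ, (r : ℂ) * e θ ∈ B := fun r hr θ => by
    rw [hB, mem_ball_zero_iff, norm_mul, hen, mul_one, Complex.norm_real]
    exact abs_lt.2 hr
  have hcp : Continuous fun p : ℝ × ℝ => (p.1 : ℂ) * e p.2 := by fun_prop
  have hmaps : MapsTo (fun p : ℝ × ℝ => (p.1 : ℂ) * e p.2) (J ×ˢ univ) B := fun p hp =>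
    hmem p.1 hp.1 p.2
  have hf1 : ContDiffOn ℝ ∞ (fderiv ℝ f) B := hf.fderiv_of_isOpen hBo (by simp)
  have hf2 : ContDiffOn ℝ ∞ (fderiv ℝ (fderiv ℝ f)) B := hf1.fderiv_of_isOpen hBo (by simp)
  have cf : ContinuousOn (fun p : ℝ × ℝ => f ((p.1 : ℂ) * e p.2)) (J ×ˢ univ) :=
    hf.continuousOn.comp hcp.continuousOn hmaps
  have cf1 : ContinuousOn (fun p : ℝ × ℝ => fderiv ℝ f ((p.1 : ℂ) * e p.2)) (J ×ˢ univ) :=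
    hf1.continuousOn.comp hcp.continuousOn hmaps
  have cf2 : ContinuousOn (fun p : ℝ × ℝ => fderiv ℝ (fderiv ℝ f) ((p.1 : ℂ) * e p.2))
    (J ×ˢ univ) := hf2.continuousOn.comp hcp.continuousOn hmaps
  have ce : ContinuousOn (fun p : ℝ × ℝ => e p.2) (J ×ˢ univ) :=
    (hec.comp continuous_snd).continuousOn
  have cp1 : ContinuousOn (fun p : ℝ × ℝ => p.1) (J ×ˢ univ) := continuousOn_fst
  -- derivatives in the radial direction
  have dz1 : ∀ r θ, HasDerivAt (fun r : ℝ => (r : ℂ) * e θ) (e θ) r := fun r θ => by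
    simpa using (Complex.ofRealCLM.hasDerivAt (x := r)).mul_const (e θ)
  have df : ∀ z ∈ B, HasFDerivAt f (fderiv ℝ f z) z := fun z hz =>
    (differentiableAt_of_contDiffOn hBo hz hf).hasFDerivAt
  have df1 : ∀ z ∈ B, HasFDerivAt (fderiv ℝ f) (fderiv ℝ (fderiv ℝ f) z) z := fun z hz =>
    (differentiableAt_of_contDiffOn hBo hz hf1).hasFDerivAt
  set m : ℝ → ℝ := fun r => ∫ θ in (0 : ℝ)..(2 * Real.pi), f ((r : ℂ) * e θ) with hm
  -- `N r` is `r` times the derivative of `m`. Adding the angular integral, which vanishes, to its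
  -- derivative gives `r` times an integral of the Laplacian of `f`. So `N` increases from `N 0 =
  -- 0`, and `m` increases too.
  set N : ℝ → ℝ := fun r => ∫ θ in (0 : ℝ)..(2 * Real.pi),
    r * fderiv ℝ f ((r : ℂ) * e θ) (e θ) with hN
  have hm' : ∀ r ∈ J, HasDerivAt m
      (∫ θ in (0 : ℝ)..(2 * Real.pi), fderiv ℝ f ((r : ℂ) * e θ) (e θ)) r := fun r hr =>
    hasDerivAt_intervalIntegral (G := fun r θ => f ((r : ℂ) * e θ))
      (G' := fun r θ => fderiv ℝ f ((r : ℂ) * e θ) (e θ)) isOpen_Ioo hr cf (cf1.clm_apply ce)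
      fun r hr θ => (df _ (hmem r hr θ)).comp_hasDerivAt r (dz1 r θ)
  have hN' : ∀ r ∈ J, HasDerivAt N (∫ θ in (0 : ℝ)..(2 * Real.pi),
      (1 * fderiv ℝ f ((r : ℂ) * e θ) (e θ)
        + r * fderiv ℝ (fderiv ℝ f) ((r : ℂ) * e θ) (e θ) (e θ))) r := fun r hr =>
    hasDerivAt_intervalIntegral (G := fun r θ => r * fderiv ℝ f ((r : ℂ) * e θ) (e θ))
      (G' := fun r θ => 1 * fderiv ℝ f ((r : ℂ) * e θ) (e θ)
        + r * fderiv ℝ (fderiv ℝ f) ((r : ℂ) * e θ) (e θ) (e θ)) isOpen_Ioo hr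
      (cp1.mul (cf1.clm_apply ce))
      ((continuousOn_const.mul (cf1.clm_apply ce)).add
        (cp1.mul ((cf2.clm_apply ce).clm_apply ce)))
      fun r hr θ => by
        have h1 : HasDerivAt (fun r : ℝ => fderiv ℝ f ((r : ℂ) * e θ))
            (fderiv ℝ (fderiv ℝ f) ((r : ℂ) * e θ) (e θ)) r :=
          (df1 _ (hmem r hr θ)).comp_hasDerivAt r (dz1 r θ)
        have h2 : HasDerivAt (fun r : ℝ => fderiv ℝ f ((r : ℂ) * e θ) (e θ))
            (fderiv ℝ (fderiv ℝ f) ((r : ℂ) * e θ) (e θ) (e θ)) r :=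
          (h1.clm_apply (hasDerivAt_const r (e θ))).congr_deriv (by simp)
        exact (hasDerivAt_id r).mul h2
  -- the angular derivative integrates to zero
  have hang : ∀ r ∈ J, ∫ θ in (0 : ℝ)..(2 * Real.pi),
      (r * fderiv ℝ (fderiv ℝ f) ((r : ℂ) * e θ) (Complex.I * e θ) (Complex.I * e θ)
        - fderiv ℝ f ((r : ℂ) * e θ) (e θ)) = 0 := fun r hr => by
    have hcr : Continuous fun θ : ℝ => (r : ℂ) * e θ := by fun_prop
    have c1 : Continuous fun θ : ℝ => fderiv ℝ f ((r : ℂ) * e θ) := by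
      rw [← continuousOn_univ]
      exact hf1.continuousOn.comp hcr.continuousOn fun θ _ => hmem r hr θ
    have c2 : Continuous fun θ : ℝ => fderiv ℝ (fderiv ℝ f) ((r : ℂ) * e θ) := by
      rw [← continuousOn_univ]
      exact hf2.continuousOn.comp hcr.continuousOn fun θ _ => hmem r hr θ
    have hIe : Continuous fun θ : ℝ => Complex.I * e θ := by fun_prop
    have hder : ∀ θ : ℝ, HasDerivAt (fun θ => fderiv ℝ f ((r : ℂ) * e θ) (Complex.I * e θ))
        (r * fderiv ℝ (fderiv ℝ f) ((r : ℂ) * e θ) (Complex.I * e θ) (Complex.I * e θ)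
        - fderiv ℝ f ((r : ℂ) * e θ) (e θ)) θ := fun θ => by
      have h1 : HasDerivAt (fun θ : ℝ => (r : ℂ) * e θ) ((r : ℂ) * (Complex.I * e θ)) θ :=
        (hed θ).const_mul _
      have h2 : HasDerivAt (fun θ : ℝ => fderiv ℝ f ((r : ℂ) * e θ))
          (fderiv ℝ (fderiv ℝ f) ((r : ℂ) * e θ) ((r : ℂ) * (Complex.I * e θ))) θ :=
        (df1 _ (hmem r hr θ)).comp_hasDerivAt θ h1
      have h3 : HasDerivAt (fun θ : ℝ => Complex.I * e θ) (Complex.I * (Complex.I * e θ)) θ :=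
        (hed θ).const_mul _
      refine (h2.clm_apply h3).congr_deriv ?_
      have e1 : (r : ℂ) * (Complex.I * e θ) = r • (Complex.I * e θ) := by simp
      have e2 : Complex.I * (Complex.I * e θ) = -e θ := by
        linear_combination (e θ) * Complex.I_mul_I
      rw [e1, e2, map_smul, map_neg, smul_apply, smul_eq_mul, sub_eq_add_neg]
    rw [intervalIntegral.integral_eq_sub_of_hasDerivAt (fun θ _ => hder θ)]
    · have : e (2 * Real.pi) = e 0 := by
        simp only [he]; push_cast
        rw [Complex.exp_two_pi_mul_I]; simp
      rw [this, sub_self]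
    · exact ((continuous_const.mul ((c2.clm_apply hIe).clm_apply hIe)).sub
        (c1.clm_apply hec)).intervalIntegrable _ _
  have hint : ∀ {H : ℝ → ℝ → ℝ}, ContinuousOn (fun p : ℝ × ℝ => H p.1 p.2) (J ×ˢ univ) →
      ∀ r ∈ J, IntervalIntegrable (H r) volume 0 (2 * Real.pi) := fun {H} hH r hr => by
    have : ContinuousOn (fun θ : ℝ => H r θ) univ :=
      hH.comp (f := fun θ : ℝ => (r, θ)) (by fun_prop) fun θ _ => ⟨hr, mem_univ _⟩
    rw [continuousOn_univ] at this
    exact this.intervalIntegrable _ _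
  have cIe : ContinuousOn (fun p : ℝ × ℝ => Complex.I * e p.2) (J ×ˢ univ) :=
    continuousOn_const.mul ce
  have hN'' : ∀ r ∈ J, 0 ≤ r → 0 ≤ deriv N r := fun r hr hr0 => by
    rw [(hN' r hr).deriv]
    have i1 := hint (H := fun r θ => 1 * fderiv ℝ f ((r : ℂ) * e θ) (e θ)
        + r * fderiv ℝ (fderiv ℝ f) ((r : ℂ) * e θ) (e θ) (e θ))
      ((continuousOn_const.mul (cf1.clm_apply ce)).add
        (cp1.mul ((cf2.clm_apply ce).clm_apply ce))) r hr
    have i2 := hint (H := fun r θ =>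
        r * fderiv ℝ (fderiv ℝ f) ((r : ℂ) * e θ) (Complex.I * e θ) (Complex.I * e θ)
        - fderiv ℝ f ((r : ℂ) * e θ) (e θ))
      ((cp1.mul ((cf2.clm_apply cIe).clm_apply cIe)).sub (cf1.clm_apply ce)) r hr
    have hsum := intervalIntegral.integral_add i1 i2
    rw [hang r hr, add_zero] at hsum
    rw [← hsum]
    refine intervalIntegral.integral_nonneg (by positivity) fun θ _ => ?_
    have := mul_nonneg hr0 (hsub _ (hmem r hr θ) (e θ))
    linarith
  have hJ0 : (0 : ℝ) ∈ J := ⟨by linarith, by linarith⟩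
  have hsubJ : ∀ r ∈ Icc (0 : ℝ) 1, r ∈ J := fun r hr => ⟨by linarith [hr.1], by linarith [hr.2]⟩
  have hNmono : MonotoneOn N (Icc 0 1) := by
    refine monotoneOn_of_deriv_nonneg (convex_Icc 0 1)
      (fun r hr => (hN' r (hsubJ r hr)).continuousAt.continuousWithinAt)
      (fun r hr => (hN' r (hsubJ r (interior_subset hr))).differentiableAt.differentiableWithinAt)
      fun r hr => hN'' r (hsubJ r (interior_subset hr)) (interior_subset hr).1
  have hN0 : N 0 = 0 := by simp [hN]
  have hmmono : MonotoneOn m (Icc 0 1) := by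
    refine monotoneOn_of_deriv_nonneg (convex_Icc 0 1)
      (fun r hr => (hm' r (hsubJ r hr)).continuousAt.continuousWithinAt)
      (fun r hr => (hm' r (hsubJ r (interior_subset hr))).differentiableAt.differentiableWithinAt)
      fun r hr => ?_
    rw [interior_Icc] at hr
    rw [(hm' r (hsubJ r ⟨hr.1.le, hr.2.le⟩)).deriv]
    have h1 := hNmono (left_mem_Icc.2 zero_le_one) ⟨hr.1.le, hr.2.le⟩ hr.1.le
    rw [hN0] at h1
    simp only [hN, intervalIntegral.integral_const_mul] at h1
    exact nonneg_of_mul_nonneg_right h1 hr.1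
  have h := hmmono (left_mem_Icc.2 zero_le_one) (right_mem_Icc.2 zero_le_one) zero_le_one
  simpa [hm] using h

variable {n : ℕ}

lemma measurePreserving_rotation (θ : ℝ) : MeasurePreserving
    (fun z : Cn n => Complex.exp (θ * Complex.I) • z) volume volume := by
  have h1 : MeasurePreserving (fun z : ℂ => Complex.exp (θ * Complex.I) * z) volume volume :=
    (rotation (Circle.exp θ)).measurePreserving
  exact volume_preserving_pi fun _ => h1

/-- The sub-mean value inequality for smooth plurisubharmonic functions on polydiscs. -/
lemma ball_mean_value {u : Cn n → ℝ} {a : Cn n} {ρ ρ' : ℝ} (hρ : 0 < ρ) (hρ' : ρ < ρ')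
    (hu : ContDiffOn ℝ ∞ u (Metric.ball a ρ'))
    (hsub : ∀ z ∈ Metric.ball a ρ', ∀ w : Cn n, 0 ≤ fderiv ℝ (fderiv ℝ u) z w w
      + fderiv ℝ (fderiv ℝ u) z (Complex.I • w) (Complex.I • w)) :
    volume.real (Metric.closedBall a ρ) * u a ≤ ∫ z in Metric.closedBall a ρ, u z := by
  set e : ℝ → ℂ := fun θ => Complex.exp (θ * Complex.I) with he
  have hen : ∀ θ, ‖e θ‖ = 1 := fun θ => Complex.norm_exp_ofReal_mul_I θ
  have hec : Continuous e := by simp only [he]; fun_prop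
  set D := Metric.closedBall (0 : Cn n) ρ with hD
  have hDc : IsCompact D := isCompact_closedBall _ _
  have hDm : MeasurableSet D := hDc.measurableSet
  -- shift to the origin
  have hshift : ∫ z in Metric.closedBall a ρ, u z = ∫ ζ in D, u (a + ζ) := by
    have hpre : (fun ζ => a + ζ) ⁻¹' Metric.closedBall a ρ = D := by
      ext ζ; simp [hD]
    rw [← hpre]
    exact ((measurePreserving_add_left volume a).setIntegral_preimage_emb
      (measurableEmbedding_addLeft a) u _).symm
  have hvol : volume.real (Metric.closedBall a ρ) = volume.real D := by
    simp only [Measure.real, hD]; rw [Measure.addHaar_closedBall_center]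
  -- The norm of `ℂⁿ` is the sup norm, so `D` is a polydisc; it is invariant under multiplication by
  -- `e θ`, which preserves volume.
  have hrot : ∀ θ, ∫ ζ in D, u (a + e θ • ζ) = ∫ ζ in D, u (a + ζ) := fun θ => by
    have hpre : (fun ζ : Cn n => e θ • ζ) ⁻¹' D = D := by
      ext ζ; simp [hD, norm_smul, hen]
    conv_lhs => rw [← hpre]
    exact (measurePreserving_rotation θ).setIntegral_preimage_emb
      (Homeomorph.smulOfNeZero (e θ) (by rw [← norm_ne_zero_iff, hen]; simp)).measurableEmbedding
      (fun ζ => u (a + ζ)) D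
  have hmem : ∀ ζ ∈ D, ∀ l : ℂ, ‖l‖ ≤ 1 → a + l • ζ ∈ Metric.ball a ρ' := fun ζ hζ l hl => by
    rw [mem_ball_iff_norm, add_sub_cancel_left, norm_smul]
    rw [hD, mem_closedBall_zero_iff] at hζ
    calc ‖l‖ * ‖ζ‖ ≤ 1 * ρ := mul_le_mul hl hζ (norm_nonneg _) zero_le_one
      _ < ρ' := by linarith
  have hcont : ContinuousOn (fun p : Cn n × ℝ => u (a + e p.2 • p.1)) (D ×ˢ univ) :=
    hu.continuousOn.comp (by fun_prop) fun p hp => hmem p.1 hp.1 _ (hen _).le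
  -- The circle inequality on the complex line through `a` in the direction `ζ`. Integrated over `ζ
  -- ∈ D`, with the two integrals exchanged, it yields the claim by `hrot`.
  have hline : ∀ ζ ∈ D, 2 * Real.pi * u a ≤ ∫ θ in (0 : ℝ)..(2 * Real.pi), u (a + e θ • ζ) := by
    intro ζ hζ
    set A : ℂ →L[ℝ] Cn n := (ContinuousLinearMap.toSpanSingleton ℂ ζ).restrictScalars ℝ with hA
    have hAa : ∀ l : ℂ, A l = l • ζ := fun l => by simp [hA]
    have hmaps : ∀ l ∈ Metric.ball (0 : ℂ) (ρ' / ρ), a + A l ∈ Metric.ball a ρ' := by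
      intro l hl
      rw [mem_ball_zero_iff, lt_div_iff₀ hρ] at hl
      rw [hD, mem_closedBall_zero_iff] at hζ
      rw [mem_ball_iff_norm, add_sub_cancel_left, hAa, norm_smul]
      exact lt_of_le_of_lt (mul_le_mul_of_nonneg_left hζ (norm_nonneg _)) hl
    have hfd : ∀ l, HasFDerivAt (fun l : ℂ => a + A l) A l := fun l =>
      (A.hasFDerivAt).const_add a
    have hcd : ContDiff ℝ ∞ (fun l : ℂ => a + A l) := contDiff_const.add A.contDiff
    have hf : ContDiffOn ℝ ∞ (fun l : ℂ => u (a + A l)) (Metric.ball 0 (ρ' / ρ)) :=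
      hu.comp hcd.contDiffOn hmaps
    have hu1 : ContDiffOn ℝ ∞ (fderiv ℝ u) (Metric.ball a ρ') :=
      hu.fderiv_of_isOpen Metric.isOpen_ball (by simp)
    have key := circle_mean_value (f := fun l : ℂ => u (a + A l)) ((one_lt_div hρ).2 hρ') hf ?_
    · simpa [hAa, he] using key
    · intro l hl v
      have h1 : ∀ l ∈ Metric.ball (0 : ℂ) (ρ' / ρ), fderiv ℝ (fun l : ℂ => u (a + A l)) l
          = (fderiv ℝ u (a + A l)).comp A := fun l hl =>
        ((differentiableAt_of_contDiffOn Metric.isOpen_ball (hmaps l hl) hu).hasFDerivAt.comp l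
          (hfd l)).fderiv
      have h2 : HasFDerivAt (fun l : ℂ => fderiv ℝ u (a + A l))
          ((fderiv ℝ (fderiv ℝ u) (a + A l)).comp A) l :=
        (differentiableAt_of_contDiffOn Metric.isOpen_ball (hmaps l hl) hu1).hasFDerivAt.comp l
          (hfd l)
      have hl2 : ContDiffAt ℝ 2 (fun l : ℂ => u (a + A l)) l :=
        (hf.contDiffAt (Metric.isOpen_ball.mem_nhds hl)).of_le two_le_infty
      have h3 : ∀ v w, fderiv ℝ (fderiv ℝ (fun l : ℂ => u (a + A l))) l v w
          = fderiv ℝ (fderiv ℝ u) (a + A l) (A v) (A w) := fun v w => by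
        rw [← fderiv_fderiv_apply hl2]
        have e1 : (fun l : ℂ => fderiv ℝ (fun l : ℂ => u (a + A l)) l w)
            =ᶠ[nhds l] fun l => fderiv ℝ u (a + A l) (A w) := by
          filter_upwards [Metric.isOpen_ball.mem_nhds hl] with q hq
          rw [h1 q hq]; rfl
        rw [e1.fderiv_eq, (h2.clm_apply (hasFDerivAt_const (A w) l)).fderiv]
        simp
      rw [h3, h3]
      have hAI : A (Complex.I * v) = Complex.I • A v := by rw [hAa, hAa, mul_smul]
      rw [hAI]
      exact hsub _ (hmaps l hl) _
  have hint : IntegrableOn (fun p : Cn n × ℝ => u (a + e p.2 • p.1))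
      (D ×ˢ Icc 0 (2 * Real.pi)) (volume.prod volume) :=
    (hcont.mono (prod_mono subset_rfl (subset_univ _))).integrableOn_compact
      (hDc.prod isCompact_Icc)
  have hint' : Integrable (fun p : Cn n × ℝ => u (a + e p.2 • p.1))
      ((volume.restrict D).prod (volume.restrict (Ioc 0 (2 * Real.pi)))) := by
    rw [Measure.prod_restrict]
    exact hint.mono_set (prod_mono subset_rfl Ioc_subset_Icc_self)
  have hpi : (0 : ℝ) ≤ 2 * Real.pi := by positivity
  have hle : ∫ _ζ in D, 2 * Real.pi * u a
      ≤ ∫ ζ in D, ∫ θ in (0 : ℝ)..(2 * Real.pi), u (a + e θ • ζ) := by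
    refine setIntegral_mono_on ?_ ?_ hDm hline
    · exact integrableOn_const hDc.measure_lt_top.ne
    · simp only [intervalIntegral.integral_of_le hpi]
      exact hint'.integral_prod_left
  have hswap : ∫ ζ in D, ∫ θ in (0 : ℝ)..(2 * Real.pi), u (a + e θ • ζ)
      = 2 * Real.pi * ∫ ζ in D, u (a + ζ) := by
    simp only [intervalIntegral.integral_of_le hpi]
    rw [integral_integral_swap hint']
    simp only [hrot]
    rw [setIntegral_const]
    simp [Measure.real, Real.pi_pos.le]
  rw [setIntegral_const, smul_eq_mul, hswap] at hle
  rw [hvol, hshift]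
  have : 0 < 2 * Real.pi := by positivity
  nlinarith

end MeanValue

/-! ### The Euclidean quadratic form and ellipticity bounds -/

section Quadratic

open Matrix

variable {n : ℕ}

variable (n) in
/-- The real inner product of `ℂⁿ`, as a continuous bilinear form. -/
def sqForm : Cn n →L[ℝ] Cn n →L[ℝ] ℝ :=
  ∑ i : Fin n,
    ((ContinuousLinearMap.mul ℝ ℝ).bilinearComp
        (Complex.reCLM.comp (ContinuousLinearMap.proj (R := ℝ) (φ := fun _ : Fin n => ℂ) i))
        (Complex.reCLM.comp (ContinuousLinearMap.proj (R := ℝ) (φ := fun _ : Fin n => ℂ) i))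
      + (ContinuousLinearMap.mul ℝ ℝ).bilinearComp
        (Complex.imCLM.comp (ContinuousLinearMap.proj (R := ℝ) (φ := fun _ : Fin n => ℂ) i))
        (Complex.imCLM.comp (ContinuousLinearMap.proj (R := ℝ) (φ := fun _ : Fin n => ℂ) i)))

lemma sqForm_apply (v w : Cn n) :
    sqForm n v w = ∑ i, ((v i).re * (w i).re + (v i).im * (w i).im) := by
  simp [sqForm]

lemma sqForm_comm (v w : Cn n) : sqForm n v w = sqForm n w v := by
  simp only [sqForm_apply]
  exact Finset.sum_congr rfl fun i _ => by ring

lemma sqForm_self (w : Cn n) : sqForm n w w = ∑ i, ‖w i‖ ^ 2 := by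
  rw [sqForm_apply]
  refine Finset.sum_congr rfl fun i _ => ?_
  rw [← Complex.normSq_eq_norm_sq, Complex.normSq_apply]

lemma sqForm_I_smul (w : Cn n) : sqForm n (Complex.I • w) (Complex.I • w) = sqForm n w w := by
  simp [sqForm_self]

/-- The sup norm is not smooth, so barriers are built from `sqForm`; this bound and `sqForm_self_le`
convert between the two with constants `1` and `n`. -/
lemma norm_sq_le_sqForm (w : Cn n) : ‖w‖ ^ 2 ≤ sqForm n w w := by
  have h0 : 0 ≤ sqForm n w w := by rw [sqForm_self]; positivity
  have h : ‖w‖ ≤ Real.sqrt (sqForm n w w) := by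
    refine (pi_norm_le_iff_of_nonneg (Real.sqrt_nonneg _)).2 fun i => ?_
    refine Real.le_sqrt_of_sq_le ?_
    rw [sqForm_self]
    exact Finset.single_le_sum (f := fun i => ‖w i‖ ^ 2) (fun j _ => by positivity)
      (Finset.mem_univ i)
  calc ‖w‖ ^ 2 ≤ Real.sqrt (sqForm n w w) ^ 2 := by gcongr
    _ = _ := Real.sq_sqrt h0

lemma abs_sqForm_le (v w : Cn n) : |sqForm n v w| ≤ n * (‖v‖ * ‖w‖) := by
  rw [sqForm_apply]
  refine (Finset.abs_sum_le_sum_abs _ _).trans ?_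
  calc ∑ i : Fin n, |(v i).re * (w i).re + (v i).im * (w i).im|
      ≤ ∑ _i : Fin n, ‖v‖ * ‖w‖ := Finset.sum_le_sum fun i _ => ?_
    _ = _ := by simp
  have e : (v i).re * (w i).re + (v i).im * (w i).im = (v i * conj (w i)).re := by
    simp [Complex.mul_re]
  rw [e]
  refine (Complex.abs_re_le_norm _).trans ?_
  rw [norm_mul, RCLike.norm_conj]
  exact mul_le_mul (norm_le_pi_norm v i) (norm_le_pi_norm w i) (norm_nonneg _) (norm_nonneg _)

lemma sqForm_self_le (w : Cn n) : sqForm n w w ≤ n * ‖w‖ ^ 2 :=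
  (le_abs_self _).trans ((abs_sqForm_le w w).trans_eq (by ring))

/-- The squared Euclidean distance to `a`. -/
def sqDist (a z : Cn n) : ℝ := sqForm n (z - a) (z - a)

lemma contDiff_sqDist (a : Cn n) : ContDiff ℝ ∞ (sqDist a) := by
  unfold sqDist
  exact ((sqForm n).contDiff.comp (contDiff_id.sub contDiff_const)).clm_apply
    (contDiff_id.sub contDiff_const)

lemma hasFDerivAt_sqDist (a z : Cn n) : HasFDerivAt (sqDist a) ((2 : ℝ) • sqForm n (z - a)) z := by
  have h : HasFDerivAt (fun z : Cn n => z - a) (ContinuousLinearMap.id ℝ (Cn n)) z :=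
    (hasFDerivAt_id z).sub_const a
  have h2 := (((sqForm n).hasFDerivAt (x := z - a)).comp z h).clm_apply h
  refine h2.congr_fderiv ?_
  ext w
  simp [sqForm_comm w, two_mul]

lemma fderiv_sqDist (a : Cn n) : fderiv ℝ (sqDist a) = fun z => (2 : ℝ) • sqForm n (z - a) :=
  funext fun z => (hasFDerivAt_sqDist a z).fderiv

lemma fderiv_fderiv_sqDist (a z : Cn n) :
    fderiv ℝ (fderiv ℝ (sqDist a)) z = (2 : ℝ) • sqForm n := by
  rw [fderiv_sqDist]
  have h : HasFDerivAt (fun z : Cn n => z - a) (ContinuousLinearMap.id ℝ (Cn n)) z :=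
    (hasFDerivAt_id z).sub_const a
  exact ((((sqForm n).hasFDerivAt (x := z - a)).comp z h).const_smul (2 : ℝ)).fderiv

lemma fderiv_add_sqDist {U : Set (Cn n)} {u : Cn n → ℝ} (hU : IsOpen U) (hu : ContDiffOn ℝ ∞ u U)
    (a : Cn n) (s : ℝ) {z : Cn n} (hz : z ∈ U) :
    fderiv ℝ (fun q => u q + s * sqDist a q) z
      = fderiv ℝ u z + s • ((2 : ℝ) • sqForm n (z - a)) :=
  ((differentiableAt_of_contDiffOn hU hz hu).hasFDerivAt.add
    ((hasFDerivAt_sqDist a z).const_mul s)).fderiv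

lemma fderiv_fderiv_add_sqDist {U : Set (Cn n)} {u : Cn n → ℝ} (hU : IsOpen U)
    (hu : ContDiffOn ℝ ∞ u U) (a : Cn n) (s : ℝ) {z : Cn n} (hz : z ∈ U) (v w : Cn n) :
    fderiv ℝ (fderiv ℝ (fun q => u q + s * sqDist a q)) z v w
      = fderiv ℝ (fderiv ℝ u) z v w + 2 * s * sqForm n v w := by
  have e : fderiv ℝ (fun q => u q + s * sqDist a q) =ᶠ[nhds z]
      fun z => fderiv ℝ u z + s • fderiv ℝ (sqDist a) z := by
    filter_upwards [hU.mem_nhds hz] with q hq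
    rw [fderiv_add_sqDist hU hu a s hq, fderiv_sqDist]
  have hu1 : ContDiffOn ℝ ∞ (fderiv ℝ u) U := hu.fderiv_of_isOpen hU (by simp)
  have d2 : DifferentiableAt ℝ (fderiv ℝ (sqDist a)) z :=
    ((contDiff_sqDist a).fderiv_right (m := ∞) (by simp)).differentiable (by simp) z
  have h := (differentiableAt_of_contDiffOn hU hz hu1).hasFDerivAt.fun_add
    (d2.hasFDerivAt.fun_const_smul s)
  rw [e.fderiv_eq, h.fderiv, fderiv_fderiv_sqDist]
  simp
  ring

/-- The sub-mean value inequality for functions whose complex Hessian is bounded below. -/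
lemma ball_mean_value_of_ge {u : Cn n → ℝ} {a : Cn n} {ρ ρ' s : ℝ} (hρ : 0 < ρ) (hρ' : ρ < ρ')
    (hs : 0 ≤ s) (hu : ContDiffOn ℝ ∞ u (Metric.ball a ρ'))
    (hsub : ∀ z ∈ Metric.ball a ρ', ∀ w : Cn n, -(4 * s * ‖w‖ ^ 2) ≤ fderiv ℝ (fderiv ℝ u) z w w
      + fderiv ℝ (fderiv ℝ u) z (Complex.I • w) (Complex.I • w)) :
    volume.real (Metric.closedBall a ρ) * u a ≤ (∫ z in Metric.closedBall a ρ, u z)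
      + s * (n * ρ ^ 2) * volume.real (Metric.closedBall a ρ) := by
  -- The added term contributes `4 s * sqForm w w`, which compensates the lower bound for the
  -- Hessian and makes the sum plurisubharmonic.
  have hv : ContDiffOn ℝ ∞ (fun q => u q + s * sqDist a q) (Metric.ball a ρ') :=
    hu.add (contDiffOn_const.mul (contDiff_sqDist a).contDiffOn)
  have h := ball_mean_value hρ hρ' hv fun z hz w => by
    rw [fderiv_fderiv_add_sqDist Metric.isOpen_ball hu a s hz,
      fderiv_fderiv_add_sqDist Metric.isOpen_ball hu a s hz, sqForm_I_smul]
    have h1 := hsub z hz w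
    have h2 := mul_le_mul_of_nonneg_left (norm_sq_le_sqForm w) hs
    linarith
  have hc : IsCompact (Metric.closedBall a ρ) := isCompact_closedBall a ρ
  have hsubset : Metric.closedBall a ρ ⊆ Metric.ball a ρ' := Metric.closedBall_subset_ball hρ'
  have i1 : IntegrableOn u (Metric.closedBall a ρ) :=
    (hu.continuousOn.mono hsubset).integrableOn_compact hc
  have i2 : IntegrableOn (fun q => s * sqDist a q) (Metric.closedBall a ρ) :=
    (continuousOn_const.mul (contDiff_sqDist a).continuous.continuousOn).integrableOn_compact hc
  rw [integral_add i1 i2] at h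
  have h0 : sqDist a a = 0 := by simp [sqDist]
  have h3 : ∫ z in Metric.closedBall a ρ, s * sqDist a z
      ≤ ∫ _z in Metric.closedBall a ρ, s * (n * ρ ^ 2) := by
    refine setIntegral_mono_on i2 (integrableOn_const hc.measure_lt_top.ne) hc.measurableSet ?_
    intro z hz
    refine mul_le_mul_of_nonneg_left ?_ hs
    refine (sqForm_self_le _).trans ?_
    rw [mem_closedBall_iff_norm] at hz
    gcongr
  rw [setIntegral_const, smul_eq_mul] at h3
  rw [h0] at h
  linarith

/-- The value `∑ ζ̄_i a_{i j} ζ_j` of a Hermitian form. -/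
def qform (A : Matrix (Fin n) (Fin n) ℂ) (ζ : Cn n) : ℝ := (star ζ ⬝ᵥ (A *ᵥ ζ)).re

lemma qform_smul (A : Matrix (Fin n) (Fin n) ℂ) (r : ℝ) (ζ : Cn n) :
    qform A ((r : ℂ) • ζ) = r ^ 2 * qform A ζ := by
  have : star ((r : ℂ) • ζ) ⬝ᵥ (A *ᵥ ((r : ℂ) • ζ))
      = ((r ^ 2 : ℝ) : ℂ) * (star ζ ⬝ᵥ (A *ᵥ ζ)) := by
    rw [mulVec_smul, star_smul, smul_dotProduct, dotProduct_smul]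
    simp only [Complex.star_def, Complex.conj_ofReal, smul_eq_mul]
    push_cast
    ring
  rw [qform, this, Complex.re_ofReal_mul, qform]

lemma qform_add (A B : Matrix (Fin n) (Fin n) ℂ) (ζ : Cn n) :
    qform (A + B) ζ = qform A ζ + qform B ζ := by
  simp [qform, add_mulVec, dotProduct_add]

lemma qform_sub (A B : Matrix (Fin n) (Fin n) ℂ) (ζ : Cn n) :
    qform (A - B) ζ = qform A ζ - qform B ζ := by
  simp [qform, sub_mulVec, dotProduct_sub]

lemma qform_ofReal_smul (A : Matrix (Fin n) (Fin n) ℂ) (r : ℝ) (ζ : Cn n) :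
    qform ((r : ℂ) • A) ζ = r * qform A ζ := by
  rw [qform, smul_mulVec, dotProduct_smul, smul_eq_mul, Complex.re_ofReal_mul, qform]

lemma qform_nonneg {A : Matrix (Fin n) (Fin n) ℂ} (hA : A.PosSemidef) (ζ : Cn n) :
    0 ≤ qform A ζ := (Complex.le_def.1 (hA.dotProduct_mulVec_nonneg ζ)).1

lemma qform_pos {A : Matrix (Fin n) (Fin n) ℂ} (hA : A.PosDef) {ζ : Cn n} (hζ : ζ ≠ 0) :
    0 < qform A ζ := (Complex.lt_def.1 (hA.dotProduct_mulVec_pos hζ)).1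

lemma posSemidef_of_qform_nonneg {A : Matrix (Fin n) (Fin n) ℂ} (hA : A.IsHermitian)
    (h : ∀ ζ, 0 ≤ qform A ζ) : A.PosSemidef := by
  refine PosSemidef.of_dotProduct_mulVec_nonneg hA fun ζ => ?_
  rw [Complex.le_def]
  exact ⟨h ζ, (hA.im_star_dotProduct_mulVec_self ζ).symm⟩

lemma qform_hessF {u : Cn n → ℝ} {z : Cn n} (hu : ContDiffAt ℝ 2 u z) (w : Cn n) :
    qform (hessF basisVec u z) (star w) = (1 / 4) * (fderiv ℝ (fderiv ℝ u) z w w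
      + fderiv ℝ (fderiv ℝ u) z (Complex.I • w) (Complex.I • w)) := by
  rw [qform, dotProduct_hessF hu, star_star, re_dv_dvb_ofReal hu]

variable {M : Type*} [TopologicalSpace M] [ChartedSpace (Cn n) M] [IsManifold 𝓘(ℂ, Cn n) ω M]

/-- A Hermitian metric is uniformly elliptic on compact subsets of a chart. -/
lemma exists_ellipticity (g : HermitianMetric n M) (c : M) {K : Set (Cn n)} (hK : IsCompact K)
    (hsub : K ⊆ (chartAt (Cn n) c).target) :
    ∃ l s : ℝ, 0 < l ∧ 0 < s ∧ ∀ z ∈ K, ∀ ζ : Cn n,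
      l * ‖ζ‖ ^ 2 ≤ qform (g.coeff c z) ζ ∧ qform (g.coeff c z) ζ ≤ s * ‖ζ‖ ^ 2 := by
  set S := Metric.sphere (0 : Cn n) 1
  have hS : IsCompact S := isCompact_sphere 0 1
  have hcont : ContinuousOn (fun p : Cn n × Cn n => qform (g.coeff c p.1) p.2) (K ×ˢ S) := by
    have hc : ∀ i j, ContinuousOn (fun p : Cn n × Cn n => g.coeff c p.1 i j) (K ×ˢ S) :=
      fun i j => ((g.smooth c i j).continuousOn.mono hsub).comp continuousOn_fst fun p hp => hp.1
    have e : (fun p : Cn n × Cn n => qform (g.coeff c p.1) p.2)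
        = fun p => (∑ i, star (p.2 i) * ∑ j, g.coeff c p.1 i j * p.2 j).re := by
      funext p; rfl
    rw [e]
    refine Complex.continuous_re.comp_continuousOn ?_
    refine continuousOn_finsetSum _ fun i _ => ContinuousOn.mul (by fun_prop) ?_
    exact continuousOn_finsetSum _ fun j _ => (hc i j).mul (by fun_prop)
  obtain ⟨l, hl, hl'⟩ := (hK.prod hS).exists_forall_le' hcont (a := 0) fun p hp =>
    qform_pos (posDef_coeff g (hsub hp.1)) (ne_zero_of_mem_unit_sphere ⟨p.2, hp.2⟩)
  obtain ⟨s, hs⟩ := (hK.prod hS).exists_bound_of_continuousOn hcont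
  refine ⟨l, max s 1, hl, by positivity, fun z hz ζ => ?_⟩
  by_cases hζ : ζ = 0
  · simp [hζ, qform]
  have hn : ‖ζ‖ ≠ 0 := norm_ne_zero_iff.2 hζ
  set η : Cn n := (((‖ζ‖⁻¹ : ℝ)) : ℂ) • ζ with hη
  have hηS : η ∈ S := by
    rw [mem_sphere_zero_iff_norm, hη, norm_smul, Complex.norm_real, norm_inv, norm_norm,
      inv_mul_cancel₀ hn]
  have hζη : ζ = ((‖ζ‖ : ℝ) : ℂ) • η := by
    rw [hη, smul_smul, ← Complex.ofReal_mul, mul_inv_cancel₀ hn, Complex.ofReal_one, one_smul]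
  have e : qform (g.coeff c z) ζ = ‖ζ‖ ^ 2 * qform (g.coeff c z) η := by
    conv_lhs => rw [hζη]
    exact qform_smul _ _ _
  have h1 := hl' (z, η) ⟨hz, hηS⟩
  have h2 := (le_abs_self _).trans (hs (z, η) ⟨hz, hηS⟩)
  simp only at h1 h2
  rw [e, mul_comm l, mul_comm (max s 1)]
  exact ⟨by gcongr, by gcongr; exact h2.trans (le_max_left _ _)⟩

end Quadratic

/-! ### Integral bounds for quasi-plurisubharmonic functions -/

section ChartBalls

variable {n : ℕ} {M : Type*} [TopologicalSpace M] [ChartedSpace (Cn n) M]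

-- The factor six leaves room for polydiscs of radius `4 r` centred at any point within `r` of the
-- centre.
variable (n) in
lemma exists_chart_radius (c : M) :
    ∃ r : ℝ, 0 < r ∧ Metric.closedBall (chartAt (Cn n) c c) (6 * r) ⊆ (chartAt (Cn n) c).target := by
  obtain ⟨R, hR, h⟩ := Metric.nhds_basis_closedBall.mem_iff.1
    ((chartAt (Cn n) c).open_target.mem_nhds (mem_chart_target (Cn n) c))
  exact ⟨R / 6, by positivity, by rwa [mul_div_cancel₀ R (by norm_num : (6 : ℝ) ≠ 0)]⟩

variable (n) in
/-- A radius such that the ball of six times this radius around `c` is contained in the chart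
at `c`. -/
def chartRadius (c : M) : ℝ := (exists_chart_radius n c).choose

variable (n) in
lemma chartRadius_pos (c : M) : 0 < chartRadius n c := (exists_chart_radius n c).choose_spec.1

variable (n) in
lemma closedBall_subset_target (c : M) :
    Metric.closedBall (chartAt (Cn n) c c) (6 * chartRadius n c) ⊆ (chartAt (Cn n) c).target :=
  (exists_chart_radius n c).choose_spec.2

variable (n) in
/-- The coordinate ball around `c` of radius `chartRadius n c`. -/
def chartBall (c : M) : Set M :=
  (chartAt (Cn n) c).source ∩
    chartAt (Cn n) c ⁻¹' Metric.ball (chartAt (Cn n) c c) (chartRadius n c)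

variable (n) in
lemma isOpen_chartBall (c : M) : IsOpen (chartBall n c) :=
  (chartAt (Cn n) c).isOpen_inter_preimage Metric.isOpen_ball

variable (n) in
lemma mem_chartBall (c : M) : c ∈ chartBall n c :=
  ⟨mem_chart_source _ c, Metric.mem_ball_self (chartRadius_pos n c)⟩

variable (n M) in
lemma exists_finite_chartBall_cover [CompactSpace M] :
    ∃ J : Finset M, ∀ x : M, ∃ c ∈ J, x ∈ chartBall n c := by
  obtain ⟨J, hJ⟩ := CompactSpace.elim_nhds_subcover (fun c : M => chartBall n c)
    fun c => (isOpen_chartBall n c).mem_nhds (mem_chartBall n c)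
  refine ⟨J, fun x => ?_⟩
  have hx : x ∈ ⋃ c ∈ J, chartBall n c := hJ ▸ mem_univ x
  simpa using hx

/-- Nonpositive smooth functions `u` with `g_{i j̄} + ∂_i ∂_{j̄} u > 0`. -/
structure IsQuasiPsh (g : HermitianMetric n M) (u : M → ℝ) : Prop where
  smooth : ContMDiff 𝓘(ℝ, Cn n) 𝓘(ℝ, ℝ) ∞ u
  posDef : ∀ x, (g.perturbed u x).PosDef
  nonpos : ∀ x, u x ≤ 0

/-- The integral of `-u` over the coordinate ball of radius `2 * chartRadius n c`. -/
def chartIntegral (n : ℕ) {M : Type*} [TopologicalSpace M] [ChartedSpace (Cn n) M] (c : M)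
    (u : M → ℝ) : ℝ :=
  ∫ z in Metric.closedBall (chartAt (Cn n) c c) (2 * chartRadius n c),
    -u ((chartAt (Cn n) c).symm z)

variable [IsManifold 𝓘(ℂ, Cn n) ω M] {g : HermitianMetric n M}

lemma IsQuasiPsh.hessian_ge {u : M → ℝ} (hu : IsQuasiPsh g u) {c : M} {z : Cn n}
    (hz : z ∈ (chartAt (Cn n) c).target) (w : Cn n) :
    -(4 * qform (g.coeff c z) (star w)) ≤
      fderiv ℝ (fderiv ℝ fun q => u ((chartAt (Cn n) c).symm q)) z w w
      + fderiv ℝ (fderiv ℝ fun q => u ((chartAt (Cn n) c).symm q)) z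
        (Complex.I • w) (Complex.I • w) := by
  have h := qform_nonneg (posDef_pertC g hu.smooth hu.posDef hz).posSemidef (star w)
  rw [pertC, qform_add, qform_hessF (contDiffAt_chart_self hu.smooth c hz)] at h
  linarith

/-- The sub-mean value inequality at the point `x` bounds the integral of `-u` over the polydisc of
radius `3 r` about `x`, which contains the one of radius `2 r` about `c`; nonpositivity of `u`
allows shrinking the domain. -/
lemma chartIntegral_le_of_ge (g : HermitianMetric n M) (c : M) (C : ℝ) :
    ∃ C', ∀ u, IsQuasiPsh g u → (∃ x ∈ chartBall n c, -C ≤ u x) → chartIntegral n c u ≤ C' := by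
  set e := chartAt (Cn n) c
  set r := chartRadius n c with hrdef
  have hr : 0 < r := chartRadius_pos n c
  have hT := closedBall_subset_target n c
  obtain ⟨l, s, _, hs, hell⟩ := exists_ellipticity g c (isCompact_closedBall (e c) (6 * r)) hT
  set V := volume.real (Metric.closedBall (0 : Cn n) (3 * r)) with hV
  refine ⟨V * C + s * (n * (3 * r) ^ 2) * V, fun u hu ⟨x, hx, hxC⟩ => ?_⟩
  set a := e x with ha
  have hax : (chartAt (Cn n) c).symm a = x := e.left_inv hx.1
  have had : dist a (e c) < r := hx.2
  have hball : Metric.ball a (4 * r) ⊆ Metric.closedBall (e c) (6 * r) := fun z hz => by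
    rw [Metric.mem_ball] at hz
    rw [Metric.mem_closedBall]
    linarith [dist_triangle z a (e c)]
  have huc := contDiffOn_chart hu.smooth c
  have h := ball_mean_value_of_ge (ρ := 3 * r) (ρ' := 4 * r) (by linarith) (by linarith) hs.le
    (huc.mono (hball.trans hT)) fun z hz w => by
      refine le_trans ?_ (hu.hessian_ge (hT (hball hz)) w)
      have := (hell z (hball hz) (star w)).2
      rw [norm_star] at this
      linarith
  simp only [hax] at h
  have hvol : volume.real (Metric.closedBall a (3 * r)) = V := by
    simp only [hV, Measure.real]; rw [Measure.addHaar_closedBall_center]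
  rw [hvol] at h
  have h0 : 0 ≤ V := measureReal_nonneg
  have hsub : Metric.closedBall (e c) (2 * r) ⊆ Metric.closedBall a (3 * r) := fun z hz => by
    rw [Metric.mem_closedBall] at hz ⊢
    linarith [dist_triangle z (e c) a, dist_comm (e c) a]
  have hint : IntegrableOn (fun z => -u (e.symm z)) (Metric.closedBall a (3 * r)) :=
    ((huc.continuousOn.neg).mono (((Metric.closedBall_subset_ball (by linarith)).trans
      hball).trans hT)).integrableOn_compact (isCompact_closedBall _ _)
  have hmono : chartIntegral n c u ≤ ∫ z in Metric.closedBall a (3 * r), -u (e.symm z) :=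
    setIntegral_mono_set hint (Filter.Eventually.of_forall fun z => by
      simpa using hu.nonpos (e.symm z)) (Filter.Eventually.of_forall hsub)
  rw [integral_neg] at hmono
  have h4 := mul_le_mul_of_nonneg_left hxC h0
  linarith

/-- If `u` were below `-C'` on the whole ball at `d`, then `-u` would exceed `C'` on the overlap, an
open set of positive volume, and its integral would exceed `C`. -/
lemma exists_ge_of_chartIntegral_le {c d : M} (hcd : (chartBall n c ∩ chartBall n d).Nonempty)
    (C : ℝ) : ∃ C', ∀ u, IsQuasiPsh g u → chartIntegral n c u ≤ C →
      ∃ x ∈ chartBall n d, -C' ≤ u x := by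
  set e := chartAt (Cn n) c
  set r := chartRadius n c with hrdef
  have hr : 0 < r := chartRadius_pos n c
  have hT := closedBall_subset_target n c
  set O := chartBall n c ∩ chartBall n d with hO
  set V := e '' O with hV
  have hOs : O ⊆ e.source := fun x hx => hx.1.1
  have hVo : IsOpen V := e.isOpen_image_of_subset_source
    ((isOpen_chartBall n c).inter (isOpen_chartBall n d)) hOs
  have hVsub : V ⊆ Metric.closedBall (e c) (2 * r) := by
    rintro _ ⟨x, hx, rfl⟩
    have : dist (e x) (e c) < r := hx.1.2
    rw [Metric.mem_closedBall]; linarith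
  have hVpos : 0 < volume V := hVo.measure_pos _ (hcd.image e)
  have hVfin : volume V ≠ ⊤ :=
    ((measure_mono hVsub).trans_lt (isCompact_closedBall _ _).measure_lt_top).ne
  have hVr : 0 < volume.real V := ENNReal.toReal_pos hVpos.ne' hVfin
  refine ⟨C / volume.real V + 1, fun u hu hC => ?_⟩
  by_contra hcon
  push Not at hcon
  have huc := contDiffOn_chart hu.smooth c
  have hint : IntegrableOn (fun z => -u (e.symm z)) (Metric.closedBall (e c) (2 * r)) :=
    ((huc.continuousOn.neg).mono ((Metric.closedBall_subset_closedBall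
      (by linarith)).trans hT)).integrableOn_compact (isCompact_closedBall _ _)
  have h1 : ∫ z in V, -u (e.symm z) ≤ chartIntegral n c u :=
    setIntegral_mono_set hint (Filter.Eventually.of_forall fun z => by
      simpa using hu.nonpos (e.symm z)) (Filter.Eventually.of_forall hVsub)
  have h2 : ∫ _z in V, (C / volume.real V + 1) ≤ ∫ z in V, -u (e.symm z) := by
    refine setIntegral_mono_on (integrableOn_const hVfin) (hint.mono_set hVsub)
      hVo.measurableSet ?_
    rintro _ ⟨x, hx, rfl⟩
    rw [e.left_inv (hOs hx)]
    linarith [hcon x hx.2]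
  rw [setIntegral_const, smul_eq_mul, mul_add, mul_div_cancel₀ _ hVr.ne'] at h2
  linarith

variable [ConnectedSpace M]

/-- A centre with a uniform pointwise bound passes this property to every overlapping ball. The
balls about good centres and those about bad centres thus have disjoint open unions that cover `M`,
and connectedness rules out bad centres. -/
lemma chartIntegral_le_of_chain {𝓖 : Set (M → ℝ)} (h𝓖 : ∀ u ∈ 𝓖, IsQuasiPsh g u) {c : M} {C : ℝ}
    (hc : ∀ u ∈ 𝓖, ∃ x ∈ chartBall n c, -C ≤ u x) (d : M) :
    ∃ C', ∀ u ∈ 𝓖, chartIntegral n d u ≤ C' := by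
  set S : Set M := {d | ∃ C, ∀ u ∈ 𝓖, ∃ x ∈ chartBall n d, -C ≤ u x} with hS
  have step : ∀ d ∈ S, ∀ d', (chartBall n d ∩ chartBall n d').Nonempty → d' ∈ S := by
    rintro d ⟨C, hC⟩ d' hne
    obtain ⟨C', hC'⟩ := chartIntegral_le_of_ge g d C
    obtain ⟨C'', hC''⟩ := exists_ge_of_chartIntegral_le (g := g) hne C'
    exact ⟨C'', fun u hu => hC'' u (h𝓖 u hu) (hC' u (h𝓖 u hu) (hC u hu))⟩
  set A : Set M := ⋃ d ∈ S, chartBall n d with hA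
  set A' : Set M := ⋃ d ∈ Sᶜ, chartBall n d with hA'
  have hAo : IsOpen A := isOpen_biUnion fun d _ => isOpen_chartBall n d
  have hAo' : IsOpen A' := isOpen_biUnion fun d _ => isOpen_chartBall n d
  have hcompl : A' = Aᶜ := by
    refine Subset.antisymm ?_ ?_
    · intro x hx hxA
      simp only [hA, hA', mem_iUnion, exists_prop] at hx hxA
      obtain ⟨d', hd', hxd'⟩ := hx
      obtain ⟨d, hd, hxd⟩ := hxA
      exact hd' (step d hd d' ⟨x, hxd, hxd'⟩)
    · intro x hx
      simp only [hA', mem_iUnion, exists_prop]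
      refine ⟨x, fun hxS => hx ?_, mem_chartBall n x⟩
      exact mem_biUnion hxS (mem_chartBall n x)
  have hclopen : IsClopen A := ⟨⟨hcompl ▸ hAo'⟩, hAo⟩
  have huniv : A = univ := hclopen.eq_univ ⟨c, mem_biUnion (show c ∈ S from ⟨C, hc⟩)
    (mem_chartBall n c)⟩
  have hd : d ∈ S := by
    have : d ∈ A := huniv ▸ mem_univ d
    simp only [hA, mem_iUnion, exists_prop] at this
    obtain ⟨d', hd', hdd'⟩ := this
    exact step d' hd' d ⟨d, hdd', mem_chartBall n d⟩
  obtain ⟨C₁, hC₁⟩ := hd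
  obtain ⟨C', hC'⟩ := chartIntegral_le_of_ge g d C₁
  exact ⟨C', fun u hu => hC' u (h𝓖 u hu) (hC₁ u hu)⟩

/-- A uniform integral bound for quasi-plurisubharmonic functions normalized to have
maximum zero. -/
lemma exists_chartIntegral_le [CompactSpace M] (g : HermitianMetric n M) (d : M) :
    ∃ C, ∀ u, IsQuasiPsh g u → (∃ x, u x = 0) → chartIntegral n d u ≤ C := by
  obtain ⟨J, hJ⟩ := exists_finite_chartBall_cover n M
  -- The maximum point moves with `u`, but it lies in one of finitely many balls; each of them
  -- starts its own chain.
  have h : ∀ c : M, ∃ C, ∀ u, IsQuasiPsh g u → (∃ x ∈ chartBall n c, u x = 0) →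
      chartIntegral n d u ≤ C := fun c => by
    obtain ⟨C, hC⟩ := chartIntegral_le_of_chain (g := g)
      (𝓖 := {u | IsQuasiPsh g u ∧ ∃ x ∈ chartBall n c, u x = 0}) (fun u hu => hu.1) (c := c)
      (C := 0) (fun u ⟨_, x, hx, hx0⟩ => ⟨x, hx, by simp [hx0]⟩) d
    exact ⟨C, fun u hu hx => hC u ⟨hu, hx⟩⟩
  choose C hC using h
  obtain ⟨B, hB⟩ := (J.image C).bddAbove
  refine ⟨B, fun u hu ⟨x, hx⟩ => ?_⟩
  obtain ⟨c, hcJ, hxc⟩ := hJ x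
  exact (hC c u hu ⟨x, hxc, hx⟩).trans (hB (Finset.mem_coe.2 (Finset.mem_image_of_mem C hcJ)))

end ChartBalls

/-! ### The Alexandrov-Bakelman-Pucci argument -/

section ABP

variable {n : ℕ}

variable (n) in
/-- The identification of the real dual of `ℂⁿ` with `ℂⁿ` given by `sqForm`. -/
def gradIso : (Cn n →L[ℝ] ℝ) →L[ℝ] Cn n :=
  ContinuousLinearMap.pi fun i =>
    Complex.ofRealCLM.comp (ContinuousLinearMap.apply ℝ ℝ (basisVec i : Cn n))
      + Complex.I • Complex.ofRealCLM.comp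
          (ContinuousLinearMap.apply ℝ ℝ (Complex.I • basisVec i : Cn n))

lemma gradIso_apply (f : Cn n →L[ℝ] ℝ) (i : Fin n) :
    gradIso n f i = (f (basisVec i) : ℂ) + Complex.I * (f (Complex.I • basisVec i) : ℂ) := by
  simp [gradIso]

lemma gradIso_sqForm (p : Cn n) : gradIso n (sqForm n p) = p := by
  funext i
  have h1 : sqForm n p (basisVec i) = (p i).re := by
    rw [sqForm_apply, Finset.sum_eq_single i]
    · simp [basisVec]
    · intro j _ hj; simp [basisVec, Pi.single_eq_of_ne hj]
    · simp
  have h2 : sqForm n p (Complex.I • basisVec i) = (p i).im := by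
    rw [sqForm_apply, Finset.sum_eq_single i]
    · simp [basisVec]
    · intro j _ hj; simp [basisVec, Pi.single_eq_of_ne hj]
    · simp
  rw [gradIso_apply, h1, h2, mul_comm, Complex.re_add_im]

lemma norm_basisVec_le (i : Fin n) : ‖(basisVec i : Cn n)‖ ≤ 1 := by
  refine (pi_norm_le_iff_of_nonneg zero_le_one).2 fun j => ?_
  by_cases h : j = i
  · subst h; simp [basisVec]
  · simp [basisVec, Pi.single_eq_of_ne h]

/-- A bound of the determinant of a linear map by the size of the image of the unit ball. -/
lemma ofReal_abs_det_le (A : Cn n →L[ℝ] Cn n) {R : ℝ} (hA : ∀ w, ‖w‖ ≤ 1 → ‖A w‖ ≤ R) :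
    ENNReal.ofReal |A.det| ≤ volume (Metric.closedBall (0 : Cn n) R)
      / volume (Metric.ball (0 : Cn n) 1) := by
  have h1 : A '' Metric.ball 0 1 ⊆ Metric.closedBall 0 R := by
    rintro _ ⟨w, hw, rfl⟩
    rw [mem_ball_zero_iff] at hw
    exact mem_closedBall_zero_iff.2 (hA w hw.le)
  have h2 := measure_mono (μ := volume) h1
  rw [Measure.addHaar_image_continuousLinearMap] at h2
  exact (ENNReal.le_div_iff_mul_le (Or.inl (Metric.measure_ball_pos _ _ one_pos).ne')
    (Or.inl measure_ball_lt_top.ne)).2 h2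

variable {U : Set (Cn n)} {v : Cn n → ℝ} {a : Cn n} {r ε B : ℝ}

/-- The set of almost minimal points at which the real Hessian is nonnegative. -/
def contactSet (v : Cn n → ℝ) (a : Cn n) (r ε : ℝ) : Set (Cn n) :=
  {z | z ∈ Metric.closedBall a r ∧ v z ≤ v a + ε * r ^ 2 ∧
    ∀ w, 0 ≤ fderiv ℝ (fderiv ℝ v) z w w}

/-- Every `w` gives a separate closed condition. Closedness supplies the measurability that the area
inequality needs. -/
lemma isClosed_contactSet (hU : IsOpen U) (hv : ContDiffOn ℝ ∞ v U)
    (hsub : Metric.closedBall a r ⊆ U) : IsClosed (contactSet v a r ε) := by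
  have hv1 : ContDiffOn ℝ ∞ (fderiv ℝ v) U := hv.fderiv_of_isOpen hU (by simp)
  have hv2 : ContDiffOn ℝ ∞ (fderiv ℝ (fderiv ℝ v)) U := hv1.fderiv_of_isOpen hU (by simp)
  have e : contactSet v a r ε = (Metric.closedBall a r ∩ v ⁻¹' Iic (v a + ε * r ^ 2)) ∩
      ⋂ w : Cn n, (Metric.closedBall a r ∩ (fun z => fderiv ℝ (fderiv ℝ v) z w w) ⁻¹' Ici 0) := by
    ext z
    simp only [contactSet, mem_ofPred_eq, mem_inter_iff, mem_iInter, mem_preimage, mem_Iic, mem_Ici]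
    exact ⟨fun h => ⟨⟨h.1, h.2.1⟩, fun w => ⟨h.1, h.2.2 w⟩⟩, fun h => ⟨h.1.1, h.1.2,
      fun w => (h.2 w).2⟩⟩
  rw [e]
  refine ((hv.continuousOn.mono hsub).preimage_isClosed_of_isClosed Metric.isClosed_closedBall
    isClosed_Iic).inter (isClosed_iInter fun w => ?_)
  refine ContinuousOn.preimage_isClosed_of_isClosed ?_ Metric.isClosed_closedBall isClosed_Ici
  exact (((hv2.continuousOn).mono hsub).clm_apply continuousOn_const).clm_apply continuousOn_const

/-- For a slope `p` this small, the linear term varies by less than the gap `ε r²` on the sphere.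
The minimum of `v` minus the linear function is thus interior: the gradient of `v` there is `p`, the
Hessian is nonnegative, and `v` is within `ε r²` of its value at `a`. -/
lemma ball_subset_image_contactSet (hU : IsOpen U) (hv : ContDiffOn ℝ ∞ v U)
    (hsub : Metric.closedBall a r ⊆ U) (hr : 0 < r)
    (hbd : ∀ z, ‖z - a‖ = r → v a + ε * r ^ 2 ≤ v z) :
    Metric.ball (0 : Cn n) (ε * r / (n + 1)) ⊆
      (fun z => gradIso n (fderiv ℝ v z)) '' contactSet v a r ε := by
  intro p hp
  rw [mem_ball_zero_iff, lt_div_iff₀ (by positivity)] at hp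
  have hlin : ∀ z ∈ Metric.closedBall a r, |sqForm n p (z - a)| < ε * r ^ 2 := fun z hz => by
    rw [mem_closedBall_iff_norm] at hz
    calc |sqForm n p (z - a)| ≤ n * (‖p‖ * ‖z - a‖) := abs_sqForm_le _ _
      _ ≤ (n + 1) * (‖p‖ * r) := by gcongr; linarith
      _ = (‖p‖ * (n + 1)) * r := by ring
      _ < ε * r * r := by gcongr
      _ = ε * r ^ 2 := by ring
  set f : Cn n → ℝ := fun z => v z - sqForm n p (z - a) with hf
  have hac : a ∈ Metric.closedBall a r := Metric.mem_closedBall_self hr.le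
  have hlc : ContDiff ℝ ∞ fun z : Cn n => sqForm n p (z - a) :=
    (sqForm n p).contDiff.comp (contDiff_id.sub contDiff_const)
  have hfs : ContDiffOn ℝ ∞ f U := hv.sub hlc.contDiffOn
  obtain ⟨z, hz, hmin⟩ := (isCompact_closedBall a r).exists_isMinOn ⟨a, hac⟩
    (hfs.continuousOn.mono hsub)
  have hfa : f z ≤ v a := by
    have := hmin hac
    simpa [hf] using this
  have hlz := abs_lt.1 (hlin z hz)
  have hzr : ‖z - a‖ < r := by
    rcases lt_or_eq_of_le (mem_closedBall_iff_norm.1 hz) with h | h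
    · exact h
    · have h1 := hbd z h
      simp only [hf] at hfa
      linarith [hlz.2]
  have hzU : z ∈ U := hsub hz
  have hloc : IsLocalMin f z := by
    filter_upwards [Metric.isOpen_ball.mem_nhds (mem_ball_iff_norm.2 hzr)] with q hq
    exact hmin (Metric.ball_subset_closedBall hq)
  have hdl : ∀ q, HasFDerivAt (fun z : Cn n => sqForm n p (z - a)) (sqForm n p) q := fun q =>
    ((sqForm n p).hasFDerivAt (x := q - a)).comp q ((hasFDerivAt_id q).sub_const a)
  have hdf : ∀ q ∈ U, fderiv ℝ f q = fderiv ℝ v q - sqForm n p := fun q hq =>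
    ((differentiableAt_of_contDiffOn hU hq hv).hasFDerivAt.sub (hdl q)).fderiv
  have hgrad : fderiv ℝ v z = sqForm n p := by
    have := hloc.fderiv_eq_zero
    rw [hdf z hzU] at this
    exact sub_eq_zero.1 this
  have hdd : fderiv ℝ (fderiv ℝ f) z = fderiv ℝ (fderiv ℝ v) z := by
    have e : fderiv ℝ f =ᶠ[nhds z] fun q => fderiv ℝ v q - sqForm n p := by
      filter_upwards [hU.mem_nhds hzU] with q hq using hdf q hq
    rw [e.fderiv_eq, fderiv_sub_const]
  refine ⟨z, ⟨hz, ?_, fun w => ?_⟩, ?_⟩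
  · simp only [hf] at hfa
    linarith [hlz.2]
  · rw [← hdd]
    exact fderiv_fderiv_nonneg_of_isLocalMin
      ((hfs.contDiffAt (hU.mem_nhds hzU)).of_le two_le_infty) hloc w
  · simp only [hgrad, gradIso_sqForm]

/-- A lower bound for the measure of the contact set. -/
lemma measure_contactSet_ge (hU : IsOpen U) (hv : ContDiffOn ℝ ∞ v U)
    (hsub : Metric.closedBall a r ⊆ U) (hr : 0 < r)
    (hbd : ∀ z, ‖z - a‖ = r → v a + ε * r ^ 2 ≤ v z) (hB0 : 0 ≤ B)
    (hB : ∀ z ∈ contactSet v a r ε, ∀ w, fderiv ℝ (fderiv ℝ v) z w w ≤ B * ‖w‖ ^ 2) :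
    volume (Metric.ball (0 : Cn n) (ε * r / (n + 1))) ≤
      volume (Metric.closedBall (0 : Cn n) (2 * B)) / volume (Metric.ball (0 : Cn n) 1)
        * volume (contactSet v a r ε) := by
  have hPm := (isClosed_contactSet (ε := ε) hU hv hsub).measurableSet
  have hv1 : ContDiffOn ℝ ∞ (fderiv ℝ v) U := hv.fderiv_of_isOpen hU (by simp)
  have hG : ∀ z ∈ contactSet v a r ε, HasFDerivWithinAt (fun z => gradIso n (fderiv ℝ v z))
      ((gradIso n).comp (fderiv ℝ (fderiv ℝ v) z)) (contactSet v a r ε) z := fun z hz =>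
    ((gradIso n).hasFDerivAt.comp z
      (differentiableAt_of_contDiffOn hU (hsub hz.1) hv1).hasFDerivAt).hasFDerivWithinAt
  have h1 := (measure_mono (μ := volume) (ball_subset_image_contactSet hU hv hsub hr hbd)).trans
    (addHaar_image_le_lintegral_abs_det_fderiv volume hPm hG)
  refine h1.trans ?_
  rw [← setLIntegral_const]
  refine setLIntegral_mono' hPm fun z hz => ofReal_abs_det_le _ fun w hw => ?_
  have hsym := isSymm_fderiv_fderiv (f := v) ((hv.contDiffAt (hU.mem_nhds (hsub hz.1))).of_le
    two_le_infty)
  -- Polarization: nonnegativity on `w ± w'` together with the bound `B` on squares controls mixed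
  -- entries.
  have hpol : ∀ w' : Cn n, ‖w'‖ ≤ 1 → |fderiv ℝ (fderiv ℝ v) z w w'| ≤ B := fun w' hw' => by
    have p1 := hz.2.2 (w + w')
    have p2 := hz.2.2 (w - w')
    simp only [map_add, map_sub, add_apply, sub_apply] at p1 p2
    have s := hsym w w'
    have b1 : fderiv ℝ (fderiv ℝ v) z w w ≤ B := (hB z hz w).trans
      (mul_le_of_le_one_right hB0 (pow_le_one₀ (norm_nonneg _) hw))
    have b2 : fderiv ℝ (fderiv ℝ v) z w' w' ≤ B := (hB z hz w').trans
      (mul_le_of_le_one_right hB0 (pow_le_one₀ (norm_nonneg _) hw'))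
    exact abs_le.2 ⟨by linarith, by linarith⟩
  -- Each complex component of the gradient combines two real entries, whence `2 * B`.
  refine (pi_norm_le_iff_of_nonneg (by positivity)).2 fun i => ?_
  rw [ContinuousLinearMap.comp_apply, gradIso_apply]
  refine (norm_add_le _ _).trans ?_
  rw [norm_mul, Complex.norm_I, one_mul, Complex.norm_real, Complex.norm_real, Real.norm_eq_abs,
    Real.norm_eq_abs]
  have hI : ‖(Complex.I • basisVec i : Cn n)‖ ≤ 1 := by
    rw [norm_smul, Complex.norm_I, one_mul]; exact norm_basisVec_le i
  linarith [hpol _ (norm_basisVec_le i), hpol _ hI]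

end ABP

/-! ### The oscillation bound -/

section Oscillation

variable {n : ℕ} {M : Type*} [TopologicalSpace M] [ChartedSpace (Cn n) M]
  [IsManifold 𝓘(ℂ, Cn n) ω M]

lemma det_ratio_eq_exp {g : HermitianMetric n M} {u : M → ℝ} {x : M}
    (hp : (g.perturbed u x).PosDef) :
    ((g.perturbed u x).det / (g.matrixAt x).det).re = Real.exp (logRatio g u x) := by
  obtain ⟨W, l, -, -, -, -, -, h1, -, -, hl⟩ :=
    exists_relative_eigenvalues (posDef_matrixAt g x) hp.isHermitian
  rw [logRatio, h1, Complex.ofReal_re, Real.exp_log (Finset.prod_pos fun i _ => hl hp i)]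

/-- At points where `g' ≥ g / 2` and the volume ratio is bounded, `g'` is bounded above. -/
lemma qform_hessF_le {g : HermitianMetric n M} {u : M → ℝ} (hu : IsQuasiPsh g u) {c : M}
    {z : Cn n} (hz : z ∈ (chartAt (Cn n) c).target) {K : ℝ} (hK : ∀ x, logRatio g u x ≤ K)
    (hge : ∀ ζ, -(1 / 2 * qform (g.coeff c z) ζ)
      ≤ qform (hessF basisVec (fun w => u ((chartAt (Cn n) c).symm w)) z) ζ) (ζ : Cn n) :
    qform (hessF basisVec (fun w => u ((chartAt (Cn n) c).symm w)) z) ζ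
      ≤ Real.exp K * 2 ^ (n - 1) * qform (g.coeff c z) ζ := by
  have hg := posDef_coeff g hz
  have hm := posDef_pertC g hu.smooth hu.posDef hz
  obtain ⟨W, l, -, -, -, -, -, hdet, hlow, hup, hl⟩ :=
    exists_relative_eigenvalues hg hm.isHermitian
  have hhalf : ∀ i, (1 / 2 : ℝ) ≤ l i := by
    refine (hlow (1 / 2)).1 (posSemidef_of_qform_nonneg ?_ fun ζ => ?_)
    · refine hm.isHermitian.sub ?_
      rw [Matrix.IsHermitian, Matrix.conjTranspose_smul, hg.isHermitian.eq]
      simp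
    · rw [qform_sub, qform_ofReal_smul, pertC, qform_add]
      linarith [hge ζ]
  have hprod : ∏ i, l i ≤ Real.exp K := by
    have h1 := det_ratio_eq_exp (hu.posDef ((chartAt (Cn n) c).symm z))
    rw [← det_div_pertC g hu.smooth hz, hdet, Complex.ofReal_re] at h1
    rw [h1]
    exact Real.exp_le_exp.2 (hK _)
  -- Eigenvalues at least `1/2` with product at most `exp K` are at most `exp K * 2 ^ (n - 1)`.
  have hle : ∀ i, l i ≤ Real.exp K * 2 ^ (n - 1) := fun i => by
    refine (le_prod_mul_pow (hl hm) (σ := 2) (fun j => ?_) i).trans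
      (mul_le_mul_of_nonneg_right hprod (by positivity))
    rw [inv_le_comm₀ (hl hm j) two_pos]
    linarith [hhalf j]
  have h := qform_nonneg ((hup _).2 hle) ζ
  rw [qform_sub, qform_ofReal_smul, pertC, qform_add] at h
  linarith [qform_nonneg hg.posSemidef ζ]

/-- The contact set of `u + ε |z - a|²` has measure bounded below, and there `-u` is almost as large
as at the minimum point `a`; the integral bound for `-u` then limits the depth of the minimum. -/
lemma exists_lower_bound_chartBall [CompactSpace M] [ConnectedSpace M] (g : HermitianMetric n M)
    (K : ℝ) (d : M) : ∃ C, ∀ u, IsQuasiPsh g u → (∃ x, u x = 0) → (∀ x, logRatio g u x ≤ K) →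
      ∀ x ∈ chartBall n d, (∀ y, u x ≤ u y) → -C ≤ u x := by
  obtain ⟨C', hC'⟩ := exists_chartIntegral_le g d
  set r := chartRadius n d with hrdef
  have hr : 0 < r := chartRadius_pos n d
  have hT := closedBall_subset_target n d
  have hU := (chartAt (Cn n) d).open_target
  obtain ⟨l, s, hl, hs, hell⟩ := exists_ellipticity g d (isCompact_closedBall _ _) hT
  -- Chosen so that the Hessian of the quadratic barrier costs at most half of the metric.
  set ε : ℝ := l / (2 * (n + 1)) with hε
  have hε0 : 0 < ε := by positivity
  have hεn : ε * n ≤ l / 2 := by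
    rw [hε, div_mul_eq_mul_div, div_le_div_iff₀ (by positivity) two_pos]
    nlinarith
  set G := Real.exp K * 2 ^ (n - 1) with hG
  have hG0 : 0 < G := by positivity
  set B := 4 * (G * s) + 4 * (ε * n) with hB
  have hB0 : 0 ≤ B := by positivity
  set D := volume (Metric.closedBall (0 : Cn n) (2 * B)) / volume (Metric.ball (0 : Cn n) 1)
    with hD
  have hDfin : D ≠ ⊤ := ENNReal.div_ne_top (isCompact_closedBall _ _).measure_lt_top.ne
    (Metric.measure_ball_pos _ _ one_pos).ne'
  set V := volume.real (Metric.ball (0 : Cn n) (ε * r / (n + 1))) with hV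
  have hV0 : 0 < V := ENNReal.toReal_pos (Metric.measure_ball_pos _ _ (by positivity)).ne'
    measure_ball_lt_top.ne
  refine ⟨ε * r ^ 2 + D.toReal * max C' 0 / V, fun u hu hzero hK x hx hmin => ?_⟩
  set uc : Cn n → ℝ := fun z => u ((chartAt (Cn n) d).symm z) with huc
  have hus : ContDiffOn ℝ ∞ uc (chartAt (Cn n) d).target := contDiffOn_chart hu.smooth d
  set a := chartAt (Cn n) d x with ha
  have hax : uc a = u x := by rw [huc, ha]; simp only [(chartAt (Cn n) d).left_inv hx.1]
  have had : dist a (chartAt (Cn n) d d) < r := hx.2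
  have hsub2 : Metric.closedBall a r ⊆ Metric.closedBall (chartAt (Cn n) d d) (2 * r) :=
    fun z hz => by
      rw [Metric.mem_closedBall] at hz ⊢
      linarith [dist_triangle z a (chartAt (Cn n) d d)]
  have hsub6 : Metric.closedBall a r ⊆ Metric.closedBall (chartAt (Cn n) d d) (6 * r) :=
    hsub2.trans (Metric.closedBall_subset_closedBall (by linarith))
  set v : Cn n → ℝ := fun q => uc q + ε * sqDist a q with hv
  have hvs : ContDiffOn ℝ ∞ v (chartAt (Cn n) d).target :=
    hus.add (contDiffOn_const.mul (contDiff_sqDist a).contDiffOn)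
  have hva : v a = u x := by simp [hv, hax, sqDist]
  have hbd : ∀ z, ‖z - a‖ = r → v a + ε * r ^ 2 ≤ v z := fun z hz => by
    have h1 : u x ≤ uc z := hmin _
    have h2 := mul_le_mul_of_nonneg_left (norm_sq_le_sqForm (z - a)) hε0.le
    rw [hz] at h2
    rw [hva]
    simp only [hv, sqDist]
    linarith
  -- On the contact set the Hessian of `v` is nonnegative, so its value on `w` is at most the sum of
  -- its values on `w` and `√-1 w`. That sum is a complex Hessian, bounded through `qform_hessF_le`.
  have hBv : ∀ z ∈ contactSet v a r ε, ∀ w, fderiv ℝ (fderiv ℝ v) z w w ≤ B * ‖w‖ ^ 2 := by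
    intro z hz w
    have hz6 := hsub6 hz.1
    have hzT := hT hz6
    have hu2 : ContDiffAt ℝ 2 uc z := contDiffAt_chart_self hu.smooth d hzT
    have hdd := fun w : Cn n => fderiv_fderiv_add_sqDist hU hus a ε hzT w w
    have hgen : ∀ w : Cn n, qform (hessF basisVec uc z) (star w) + ε * sqForm n w w
        = (1 / 4) * (fderiv ℝ (fderiv ℝ v) z w w
          + fderiv ℝ (fderiv ℝ v) z (Complex.I • w) (Complex.I • w)) := fun w => by
      rw [qform_hessF hu2, hv, hdd, hdd, sqForm_I_smul]
      ring
    have hge : ∀ ζ, -(1 / 2 * qform (g.coeff d z) ζ) ≤ qform (hessF basisVec uc z) ζ := fun ζ => by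
      have h1 := hgen (star ζ)
      rw [star_star] at h1
      have h2 := hz.2.2 (star ζ)
      have h3 := hz.2.2 (Complex.I • star ζ)
      have h4 := mul_le_mul_of_nonneg_left (sqForm_self_le (star ζ)) hε0.le
      rw [norm_star] at h4
      have h5 := (hell z hz6 ζ).1
      have h6 := mul_le_mul_of_nonneg_right hεn (sq_nonneg ‖ζ‖)
      linarith
    have h1 := qform_hessF_le hu hzT hK hge (star w)
    have h2 := (hell z hz6 (star w)).2
    rw [norm_star] at h2
    have h3 := mul_le_mul_of_nonneg_left h2 hG0.le
    have h4 := mul_le_mul_of_nonneg_left (sqForm_self_le w) hε0.le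
    have h5 := hgen w
    have h6 := hz.2.2 (Complex.I • w)
    have e : B * ‖w‖ ^ 2 = 4 * (G * (s * ‖w‖ ^ 2)) + 4 * (ε * (n * ‖w‖ ^ 2)) := by
      rw [hB]; ring
    rw [e]
    linarith
  have hmeas := measure_contactSet_ge hU hvs (hsub6.trans hT) hr hbd hB0 hBv
  set P := contactSet v a r ε with hP
  have hPsub : P ⊆ Metric.closedBall (chartAt (Cn n) d d) (2 * r) := fun z hz => hsub2 hz.1
  have hPfin : volume P ≠ ⊤ :=
    ((measure_mono hPsub).trans_lt (isCompact_closedBall _ _).measure_lt_top).ne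
  have hVP : V ≤ D.toReal * volume.real P := by
    have := ENNReal.toReal_mono (ENNReal.mul_ne_top hDfin hPfin) hmeas
    rwa [ENNReal.toReal_mul] at this
  have hPm : MeasurableSet P :=
    (isClosed_contactSet (ε := ε) hU hvs (hsub6.trans hT)).measurableSet
  have hint : IntegrableOn (fun z => -uc z)
      (Metric.closedBall (chartAt (Cn n) d d) (2 * r)) :=
    ((hus.continuousOn.neg).mono ((Metric.closedBall_subset_closedBall
      (by linarith)).trans hT)).integrableOn_compact (isCompact_closedBall _ _)
  have h1 : ∫ z in P, -uc z ≤ chartIntegral n d u :=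
    setIntegral_mono_set hint (Filter.Eventually.of_forall fun z => by
      simpa [huc] using hu.nonpos ((chartAt (Cn n) d).symm z)) (Filter.Eventually.of_forall hPsub)
  have h2 : ∫ _z in P, (-u x - ε * r ^ 2) ≤ ∫ z in P, -uc z := by
    refine setIntegral_mono_on (integrableOn_const hPfin) (hint.mono_set hPsub) hPm fun z hz => ?_
    have h3 := hz.2.1
    rw [hva] at h3
    have h4 : 0 ≤ ε * sqDist a z :=
      mul_nonneg hε0.le ((sq_nonneg _).trans (norm_sq_le_sqForm (z - a)))
    simp only [hv] at h3
    linarith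
  rw [setIntegral_const, smul_eq_mul] at h2
  have h3 := (h2.trans h1).trans ((hC' u hu hzero).trans (le_max_left C' 0))
  by_contra hcon
  push Not at hcon
  have h4 : D.toReal * max C' 0 / V < -u x - ε * r ^ 2 := by linarith
  rw [div_lt_iff₀ hV0] at h4
  have h0 : 0 ≤ D.toReal * max C' 0 := by positivity
  have h5 : 0 ≤ -u x - ε * r ^ 2 := by
    by_contra hneg
    push Not at hneg
    linarith [mul_neg_of_neg_of_pos hneg hV0]
  have h6 := mul_le_mul_of_nonneg_left hVP h5
  have h7 := mul_le_mul_of_nonneg_left h3 (ENNReal.toReal_nonneg (a := D))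
  have e : (-u x - ε * r ^ 2) * (D.toReal * volume.real P)
      = D.toReal * (volume.real P * (-u x - ε * r ^ 2)) := by ring
  linarith

/-- The oscillation of a solution of the Monge-Ampère equation is controlled by the volume
ratio. -/
lemma exists_oscillation_bound [CompactSpace M] [ConnectedSpace M] (g : HermitianMetric n M)
    (K : ℝ) : ∃ C, 0 < C ∧ ∀ u : M → ℝ, ContMDiff 𝓘(ℝ, Cn n) 𝓘(ℝ, ℝ) ∞ u →
      (∀ x, (g.perturbed u x).PosDef) → (∀ x, logRatio g u x ≤ K) → ∀ x y, u x - u y ≤ C := by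
  obtain ⟨J, hJ⟩ := exists_finite_chartBall_cover n M
  choose C hC using exists_lower_bound_chartBall g K
  obtain ⟨B, hB⟩ := (J.image C).bddAbove
  refine ⟨max B 1, by positivity, fun u hu hpos hK x y => ?_⟩
  obtain ⟨x₁, -, hx₁⟩ := isCompact_univ.exists_isMaxOn ⟨x, mem_univ x⟩ hu.continuous.continuousOn
  obtain ⟨y₁, -, hy₁⟩ := isCompact_univ.exists_isMinOn ⟨x, mem_univ x⟩ hu.continuous.continuousOn
  have hx₁' : ∀ q, u q ≤ u x₁ := fun q => hx₁ (mem_univ q)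
  have hy₁' : ∀ q, u y₁ ≤ u q := fun q => hy₁ (mem_univ q)
  have hcx : ∀ q, complexHessian n (fun p => u p - u x₁) q = complexHessian n u q := fun q => by
    ext i j
    simp only [complexHessian, Matrix.of_apply]
    congr 1
    funext z
    simp only [dzbar, Complex.ofReal_sub, fderiv_sub_const]
  have hper : ∀ q, g.perturbed (fun p => u p - u x₁) q = g.perturbed u q := fun q => by
    rw [HermitianMetric.perturbed, HermitianMetric.perturbed, hcx]
  have hq : IsQuasiPsh g fun p => u p - u x₁ :=
    ⟨hu.sub contMDiff_const, fun q => by rw [hper]; exact hpos q, fun q => by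
      linarith [hx₁' q]⟩
  obtain ⟨d, hdJ, hyd⟩ := hJ y₁
  have h := hC d _ hq ⟨x₁, sub_self _⟩ (fun q => by rw [logRatio, hper]; exact hK q) y₁ hyd
    fun q => by linarith [hy₁' q]
  have hBd : C d ≤ B := hB (Finset.mem_coe.2 (Finset.mem_image_of_mem C hdJ))
  linarith [hx₁' x, hy₁' y, le_max_left B 1]

end Oscillation

/-! ### Orthonormal frames with uniform bounds -/

section FrameBounds

open Matrix

variable {n : ℕ}

/-- The frame of `ℂⁿ` given by the conjugated columns of a matrix. -/
def frameOf (W : Matrix (Fin n) (Fin n) ℂ) (i : Fin n) : Cn n := fun k => conj (W k i)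

lemma hessF_frameOf (W : Matrix (Fin n) (Fin n) ℂ) {u : Cn n → ℝ} {z : Cn n}
    (hu : ContDiffAt ℝ 2 u z) :
    hessF (frameOf W) u z = Wᴴ * hessF basisVec u z * W := by
  have e : (Matrix.of fun k i => conj (frameOf W i k)) = W := by
    ext k i; simp [frameOf]
  rw [hessF_eq_conj _ hu, e]

lemma norm_conj_entry_le {W X : Matrix (Fin n) (Fin n) ℂ} {b β : ℝ} (hb : 0 ≤ b) (hβ : 0 ≤ β)
    (hW : ∀ k i, ‖W k i‖ ≤ b) (hX : ∀ k l, ‖X k l‖ ≤ β) (i j : Fin n) :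
    ‖(Wᴴ * X * W) i j‖ ≤ n * (n * (b * β) * b) := by
  have hsum : ∀ (f : Fin n → ℂ) (C : ℝ), (∀ k, ‖f k‖ ≤ C) → ‖∑ k, f k‖ ≤ n * C := fun f C hf =>
    (norm_sum_le_of_le _ fun k _ => hf k).trans_eq (by simp)
  rw [mul_apply]
  refine hsum _ _ fun l => ?_
  rw [norm_mul, mul_apply]
  refine mul_le_mul (hsum _ _ fun k => ?_) (hW l j) (norm_nonneg _) (by positivity)
  rw [norm_mul, conjTranspose_apply, norm_star]
  exact mul_le_mul (hW k i) (hX k l) (norm_nonneg _) hb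

lemma cdM_conj {U : Set (Cn n)} {z : Cn n} {X : Cn n → Matrix (Fin n) (Fin n) ℂ}
    (hU : IsOpen U) (hz : z ∈ U) (hX : SmoothM X U) (W : Matrix (Fin n) (Fin n) ℂ) (a b : Cn n) :
    cdM a b (fun q => Wᴴ * X q * W) z = Wᴴ * cdM a b X z * W := by
  have hW : SmoothM (fun _ : Cn n => W) U := SmoothM.const W
  have hW' : SmoothM (fun _ : Cn n => Wᴴ) U := SmoothM.const Wᴴ
  rw [cdM_mul hU hz (hW'.mul hX) hW, cdM_mul hU hz hW' hX, cdM_const, cdM_const]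
  simp

lemma norm_dv_le {f : Cn n → ℂ} {v z : Cn n} {b β : ℝ} (hb : 0 ≤ b) (hv : ∀ k, ‖v k‖ ≤ b)
    (hf : ∀ k, ‖dz k f z‖ ≤ β) : ‖dv v f z‖ ≤ n * (b * β) := by
  rw [dv_eq_sum]
  refine (norm_sum_le_of_le (n := fun _ => b * β) _ fun k _ => ?_).trans_eq (by simp)
  rw [norm_mul]
  exact mul_le_mul (hv k) (hf k) (norm_nonneg _) hb

lemma norm_dv_dvb_le {f : Cn n → ℂ} {v z : Cn n} {b β : ℝ} (hb : 0 ≤ b)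
    (hv : ∀ k, ‖v k‖ ≤ b) (hfz : ContDiffAt ℝ 2 f z)
    (hf : ∀ k l, ‖dz k (dzbar l f) z‖ ≤ β) : ‖dv v (dvb v f) z‖ ≤ n * (b * (n * (b * β))) := by
  rw [dv_dvb_eq_sum _ _ hfz]
  refine (norm_sum_le_of_le (n := fun _ => b * (n * (b * β))) _ fun l _ => ?_).trans_eq (by simp)
  rw [norm_mul, RCLike.norm_conj]
  exact mul_le_mul (hv l) (norm_dv_le hb hv fun k => hf k l) (norm_nonneg _) hb

variable {M : Type*} [TopologicalSpace M] [ChartedSpace (Cn n) M] [IsManifold 𝓘(ℂ, Cn n) ω M]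

lemma exists_norm_bound {ι : Type*} [Finite ι] {f : ι → Cn n → ℂ} {U K : Set (Cn n)}
    (hf : ∀ i, ContDiffOn ℝ ∞ (f i) U) (hK : IsCompact K) (hKU : K ⊆ U) :
    ∃ β, 0 ≤ β ∧ ∀ i, ∀ z ∈ K, ‖f i z‖ ≤ β := by
  choose β hβ using fun i =>
    hK.exists_bound_of_continuousOn ((hf i).continuousOn.mono hKU)
  obtain ⟨b, hb⟩ := (Set.finite_range β).bddAbove
  exact ⟨max b 0, le_max_right _ _, fun i z hz =>
    (hβ i z hz).trans ((hb (mem_range_self i)).trans (le_max_left _ _))⟩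

/-- Uniform bounds for the derivatives of the metric in frames which are orthonormal at a
point. -/
lemma exists_frame_bounds (g : HermitianMetric n M) (c : M) {K : Set (Cn n)} (hK : IsCompact K)
    (hsub : K ⊆ (chartAt (Cn n) c).target) :
    ∃ B, 0 ≤ B ∧ ∀ z ∈ K, ∀ W : Matrix (Fin n) (Fin n) ℂ, Wᴴ * g.coeff c z * W = 1 →
      ∀ p i j, ‖dvM (frameOf W p) (fun q => Wᴴ * g.coeff c q * W) z i j‖ ≤ B ∧
        ‖dvM (frameOf W p) (dvbM (frameOf W p) fun q => Wᴴ * g.coeff c q * W) z i j‖ ≤ B := by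
  have hU := (chartAt (Cn n) c).open_target
  have sg : SmoothM (g.coeff c) (chartAt (Cn n) c).target := fun i j => g.smooth c i j
  obtain ⟨l, s, hl, -, hell⟩ := exists_ellipticity g c hK hsub
  obtain ⟨β₁, hβ₁, h₁⟩ := exists_norm_bound
    (f := fun p : Fin n × Fin n × Fin n => dz p.1 fun q => g.coeff c q p.2.1 p.2.2)
    (fun p => by rw [dz_eq_dv]; exact contDiffOn_cd hU (sg _ _)) hK hsub
  obtain ⟨β₂, hβ₂, h₂⟩ := exists_norm_bound
    (f := fun p : (Fin n × Fin n) × Fin n × Fin n =>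
      dz p.1.1 (dzbar p.1.2 fun q => g.coeff c q p.2.1 p.2.2))
    (fun p => by
      rw [dz_eq_dv, dzbar_eq_dvb]; exact contDiffOn_cd hU (contDiffOn_cd hU (sg _ _))) hK hsub
  set b := Real.sqrt (1 / l) with hb
  have hb0 : 0 ≤ b := Real.sqrt_nonneg _
  refine ⟨max (n * (n * (b * (n * (b * β₁))) * b)) (n * (n * (b * (n * (b * (n * (b * β₂))))) * b)),
    le_max_of_le_left (by positivity), fun z hz W hW p i j => ?_⟩
  -- The columns of `W` are unit vectors for the metric at `z`, so ellipticity bounds their entries.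
  have hWb : ∀ k i, ‖W k i‖ ≤ b := fun k i => by
    refine Real.le_sqrt_of_sq_le ?_
    have hq : qform (g.coeff c z) (fun k => W k i) = 1 := by
      have h := congrFun (congrFun hW i) i
      rw [one_apply_eq, Matrix.mul_assoc, mul_apply] at h
      rw [qform, dotProduct]
      have e : ∀ k, star (fun k => W k i) k * (g.coeff c z *ᵥ fun k => W k i) k
          = Wᴴ i k * (g.coeff c z * W) k i := fun k => rfl
      rw [Finset.sum_congr rfl fun k _ => e k, h, Complex.one_re]
    have h2 := (hell z hz fun k => W k i).1
    rw [hq] at h2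
    rw [le_div_iff₀ hl, mul_comm]
    refine le_trans ?_ h2
    gcongr
    exact norm_le_pi_norm (fun k => W k i) k
  have hvb : ∀ k, ‖frameOf W p k‖ ≤ b := fun k => by
    rw [frameOf, RCLike.norm_conj]; exact hWb k p
  have hzU := hsub hz
  constructor
  · refine le_trans ?_ (le_max_left _ _)
    rw [dvM, cdM_conj hU hzU sg]
    refine norm_conj_entry_le hb0 (by positivity) hWb (fun k l => ?_) i j
    exact norm_dv_le hb0 hvb fun k' => h₁ (k', k, l) z hz
  · refine le_trans ?_ (le_max_right _ _)
    rw [dvM, dvbM, cdM_congr_on hU hzU fun q hq => cdM_conj hU hq sg W _ _,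
      cdM_conj hU hzU (sg.cdM hU)]
    refine norm_conj_entry_le hb0 (by positivity) hWb (fun k l => ?_) i j
    exact norm_dv_dvb_le hb0 hvb (((sg k l).contDiffAt (hU.mem_nhds hzU)).of_le two_le_infty)
      fun k' l' => h₂ ((k', l'), k, l) z hz

end FrameBounds

/-! ### The trace as a function on space-time -/

section Trace

open Matrix

variable {n : ℕ} {M : Type*} [TopologicalSpace M] [ChartedSpace (Cn n) M]

/-- The trace `tr_g g'` at a point of `M`. -/
def traceAt (g : HermitianMetric n M) (u : M → ℝ) (x : M) : ℝ :=
  trWrt (g.matrixAt x) (g.perturbed u x)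

variable [IsManifold 𝓘(ℂ, Cn n) ω M]

lemma continuousOn_traceAt (g : HermitianMetric n M) {φ : M → ℝ → ℝ} {I : Set ℝ}
    (hφ : ContMDiffOn (𝓘(ℝ, Cn n).prod 𝓘(ℝ, ℝ)) 𝓘(ℝ, ℝ) ∞ (fun p : M × ℝ => φ p.1 p.2)
      (univ ×ˢ I)) (hI : UniqueDiffOn ℝ I) :
    ContinuousOn (fun p : M × ℝ => traceAt g (fun y => φ y p.2) p.1) (univ ×ˢ I) := by
  rintro ⟨x, t⟩ ⟨-, ht⟩
  set e := chartAt (Cn n) x with he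
  have hU := e.open_target
  set G : Cn n × ℝ → ℂ := fun p => ((φ (e.symm p.1) p.2 : ℝ) : ℂ) with hG
  have hGs : ContDiffOn ℝ ∞ G (e.target ×ˢ I) :=
    Complex.ofRealCLM.contDiff.comp_contDiffOn (contDiffOn_chart_prod hφ x)
  have sg : SmoothM (g.coeff x) e.target := fun i j => g.smooth x i j
  have sgi := sg.inv fun q hq => (posDef_coeff g hq).det_pos.ne'
  have hh : ∀ i j, ContinuousOn (fun p : Cn n × ℝ =>
      hessF basisVec (fun w => φ (e.symm w) p.2) p.1 i j) (e.target ×ˢ I) := fun i j =>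
    (contDiffOn_cd_slice hU hI (contDiffOn_cd_slice hU hI hGs _ _) _ _).continuousOn
  have hlift : ∀ {X : Cn n → Matrix (Fin n) (Fin n) ℂ}, SmoothM X e.target → ∀ i j,
      ContinuousOn (fun p : Cn n × ℝ => X p.1 i j) (e.target ×ˢ I) := fun hX i j =>
    (hX i j).continuousOn.comp continuousOn_fst fun p hp => hp.1
  have hH : ContinuousOn (fun p : Cn n × ℝ => trWrt (g.coeff x p.1)
      (pertC g x (fun y => φ y p.2) p.1)) (e.target ×ˢ I) := by
    simp only [trWrt, Matrix.trace, Matrix.diag_apply, mul_apply, pertC, Matrix.add_apply]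
    refine Complex.continuous_re.comp_continuousOn (continuousOn_finsetSum _ fun i _ =>
      continuousOn_finsetSum _ fun j _ => (hlift sgi i j).mul ((hlift sg j i).add (hh j i)))
  have hcomp : ContinuousOn (fun p : M × ℝ => trWrt (g.coeff x (e p.1))
      (pertC g x (fun y => φ y p.2) (e p.1))) (e.source ×ˢ I) :=
    hH.comp (f := fun p : M × ℝ => (e p.1, p.2))
      ((e.continuousOn.comp continuousOn_fst fun p hp => hp.1).prodMk continuousOn_snd)
      fun p hp => ⟨e.map_source hp.1, hp.2⟩
  have hS : ContinuousOn (fun p : M × ℝ => traceAt g (fun y => φ y p.2) p.1) (e.source ×ˢ I) := by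
    refine hcomp.congr fun p hp => ?_
    have := trWrt_pertC g (contMDiff_slice hφ hp.2) (e.map_source hp.1)
    refine Eq.trans ?_ this.symm
    rw [← he, e.left_inv hp.1]
    rfl
  refine (hS (x, t) ⟨mem_chart_source _ x, ht⟩).mono_of_mem_nhdsWithin ?_
  have ho : e.source ×ˢ (univ : Set ℝ) ∈ nhds (x, t) :=
    (e.open_source.prod isOpen_univ).mem_nhds ⟨mem_chart_source _ x, mem_univ _⟩
  filter_upwards [mem_nhdsWithin_of_mem_nhds ho, self_mem_nhdsWithin] with p h1 h2
  exact ⟨h1.1, h2.2⟩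

/-- The trace at a point, in a frame which is orthonormal there. -/
lemma traceAt_eq_of_frame (g : HermitianMetric n M) {u : M → ℝ}
    (hu : ContMDiff 𝓘(ℝ, Cn n) 𝓘(ℝ, ℝ) ∞ u) {c : M} {z : Cn n}
    (hz : z ∈ (chartAt (Cn n) c).target) {W : Matrix (Fin n) (Fin n) ℂ} (hW : IsUnit W)
    (h1 : Wᴴ * g.coeff c z * W = 1) :
    traceAt g u ((chartAt (Cn n) c).symm z) = n + ∑ i, (dv (frameOf W i) (dvb (frameOf W i)
      fun q => ((u ((chartAt (Cn n) c).symm q) : ℝ) : ℂ)) z).re := by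
  rw [traceAt, ← trWrt_pertC g hu hz, ← trWrt_conj hW, h1, pertC, Matrix.mul_add, Matrix.add_mul,
    h1, ← hessF_frameOf W (contDiffAt_chart_self hu c hz), trWrt, inv_one, one_mul, trace_add,
    trace_one, Complex.add_re]
  simp [Matrix.trace, hessF]

lemma laplacian_eq_of_frame (g : HermitianMetric n M) {u : M → ℝ}
    (hu : ContMDiff 𝓘(ℝ, Cn n) 𝓘(ℝ, ℝ) ∞ u) {c : M} {z : Cn n}
    (hz : z ∈ (chartAt (Cn n) c).target) {W : Matrix (Fin n) (Fin n) ℂ} (hW : IsUnit W)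
    (h1 : Wᴴ * g.coeff c z * W = 1) :
    g.laplacian u ((chartAt (Cn n) c).symm z) = ∑ i, (dv (frameOf W i) (dvb (frameOf W i)
      fun q => ((u ((chartAt (Cn n) c).symm q) : ℝ) : ℂ)) z).re := by
  rw [← trWrt_hessF g hu hz, ← trWrt_conj hW, h1,
    ← hessF_frameOf W (contDiffAt_chart_self hu c hz), trWrt, inv_one, one_mul]
  simp [Matrix.trace, hessF]

/-- Every eigenvalue is at most the trace `s`, so the determinant ratio is at most `s ^ n`, hence at
most `s` when `s < 1`. A lower bound for the ratio is thus one for `s`. -/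
lemma inv_traceAt_le (g : HermitianMetric n M) {u : M → ℝ} {x : M}
    (hp : (g.perturbed u x).PosDef) (hn : 0 < n) {K : ℝ} (hK0 : 0 ≤ K)
    (hK : -K ≤ logRatio g u x) : (traceAt g u x)⁻¹ ≤ Real.exp K := by
  obtain ⟨W, l, -, -, -, -, htr, hdet, -, -, hl⟩ :=
    exists_relative_eigenvalues (posDef_matrixAt g x) hp.isHermitian
  have hl := hl hp
  have hpos : 0 < traceAt g u x := trWrt_pos (posDef_matrixAt g x) hp hn
  have h1 := det_ratio_eq_exp hp
  rw [hdet, Complex.ofReal_re] at h1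
  have hle : ∀ i, l i ≤ traceAt g u x := fun i => by
    rw [traceAt, htr]
    exact Finset.single_le_sum (fun j _ => (hl j).le) (Finset.mem_univ i)
  have h2 : Real.exp (-K) ≤ traceAt g u x := by
    rcases le_or_gt 1 (traceAt g u x) with h | h
    · exact (Real.exp_le_one_iff.2 (by linarith)).trans h
    · calc Real.exp (-K) ≤ Real.exp (logRatio g u x) := Real.exp_le_exp.2 hK
        _ = ∏ i, l i := h1.symm
        _ ≤ ∏ _i : Fin n, traceAt g u x :=
          Finset.prod_le_prod (fun i _ => (hl i).le) fun i _ => hle i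
        _ = traceAt g u x ^ n := by simp
        _ ≤ traceAt g u x := pow_le_of_le_one hpos.le h.le hn.ne'
  rw [inv_le_comm₀ hpos (Real.exp_pos K), ← Real.exp_neg]
  exact h2

end Trace

/-! ### The trace bound along the flow -/

section TraceBound

open Matrix

variable {n : ℕ} {M : Type*} [TopologicalSpace M] [ChartedSpace (Cn n) M]

lemma isOpen_Ioo_time (T : EReal) : IsOpen {t : ℝ | 0 < t ∧ (t : EReal) < T} :=
  isOpen_Ioi.inter (isOpen_Iio.preimage continuous_coe_real_ereal)

lemma IsSolution.hasDerivAt {g : HermitianMetric n M} {F : M → ℝ} {T : EReal} {φ : M → ℝ → ℝ}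
    (h : IsSolution g F T φ) (x : M) {t : ℝ} (ht : 0 < t) (htT : (t : EReal) < T) :
    HasDerivAt (φ x) (logRatio g (fun y => φ y t) x - F x) t := by
  refine (h.equation x t ⟨ht.le, htT⟩).hasDerivAt ?_
  filter_upwards [(isOpen_Ioo_time T).mem_nhds ⟨ht, htT⟩] with s hs
  exact ⟨hs.1.le, hs.2⟩

variable [IsManifold 𝓘(ℂ, Cn n) ω M]

/-- In a frame that is fixed in time and orthonormal at the point, the trace is `n` plus second
derivatives of `φ`, and time differentiation passes through these. -/
lemma IsSolution.hasDerivAt_traceAt {g : HermitianMetric n M} {F : M → ℝ} {T : EReal}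
    {φ : M → ℝ → ℝ} (h : IsSolution g F T φ) {c : M} {z : Cn n}
    (hz : z ∈ (chartAt (Cn n) c).target) {W : Matrix (Fin n) (Fin n) ℂ} (hW : IsUnit W)
    (h1 : Wᴴ * g.coeff c z * W = 1) {t : ℝ} (ht : 0 < t) (htT : (t : EReal) < T) :
    HasDerivAt (fun s => traceAt g (fun y => φ y s) ((chartAt (Cn n) c).symm z))
      (∑ i, (dv (frameOf W i) (dvb (frameOf W i) fun q =>
        ((logRatio g (fun y => φ y t) ((chartAt (Cn n) c).symm q)
          - F ((chartAt (Cn n) c).symm q) : ℝ) : ℂ)) z).re) t := by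
  set I : Set ℝ := {t : ℝ | 0 < t ∧ (t : EReal) < T} with hI
  have hIo : IsOpen I := isOpen_Ioo_time T
  have hIT : I ⊆ timeInterval T := fun s hs => ⟨hs.1.le, hs.2⟩
  have hU := (chartAt (Cn n) c).open_target
  have hG : ContDiffOn ℝ ∞ (fun p : Cn n × ℝ => ((φ ((chartAt (Cn n) c).symm p.1) p.2 : ℝ) : ℂ))
      ((chartAt (Cn n) c).target ×ˢ I) :=
    Complex.ofRealCLM.contDiff.comp_contDiffOn
      ((contDiffOn_chart_prod h.smooth c).mono (prod_mono subset_rfl hIT))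
  have hd : ∀ i, HasDerivAt (fun s => (dv (frameOf W i) (dvb (frameOf W i)
      fun q => ((φ ((chartAt (Cn n) c).symm q) s : ℝ) : ℂ)) z).re)
      (dv (frameOf W i) (dvb (frameOf W i) fun q =>
        ((logRatio g (fun y => φ y t) ((chartAt (Cn n) c).symm q)
          - F ((chartAt (Cn n) c).symm q) : ℝ) : ℂ)) z).re t := fun i =>
    Complex.reCLM.hasFDerivAt.comp_hasDerivAt t (hasDerivAt_cd_cd hU hIo hG hz
      (show t ∈ I from ⟨ht, htT⟩)
      (fun q _ => (h.hasDerivAt ((chartAt (Cn n) c).symm q) ht htT).ofReal_comp) _ _ _ _)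
  refine ((HasDerivAt.fun_sum fun i _ => hd i).const_add (n : ℝ)).congr_of_eventuallyEq ?_
  filter_upwards [hIo.mem_nhds (show t ∈ I from ⟨ht, htT⟩)] with s hs
  exact traceAt_eq_of_frame g (contMDiff_slice h.smooth (hIT hs)) hz hW h1

/-- The estimate at an interior maximum point of `log tr_g g' + exp (-A w)`. -/
lemma IsSolution.traceAt_le_of_max {g : HermitianMetric n M} {F : M → ℝ} {T : EReal}
    {φ : M → ℝ → ℝ} [CompactSpace M] (h : IsSolution g F T φ) (hn : 0 < n)
    (hFs : ContMDiff 𝓘(ℝ, Cn n) 𝓘(ℝ, ℝ) ∞ F) {K : ℝ} (hK0 : 0 ≤ K) (hF : ∀ x, |F x| ≤ K)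
    (hFl : ∀ x, -K ≤ g.laplacian F x) {c x₁ : M} (hx₁ : x₁ ∈ (chartAt (Cn n) c).source)
    {B : ℝ} (hB : 0 ≤ B)
    (hfr : ∀ W : Matrix (Fin n) (Fin n) ℂ, Wᴴ * g.coeff c (chartAt (Cn n) c x₁) * W = 1 →
      ∀ p i j, ‖dvM (frameOf W p) (fun q => Wᴴ * g.coeff c q * W) (chartAt (Cn n) c x₁) i j‖ ≤ B ∧
        ‖dvM (frameOf W p) (dvbM (frameOf W p) fun q => Wᴴ * g.coeff c q * W)
          (chartAt (Cn n) c x₁) i j‖ ≤ B)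
    {A : ℝ} (hA : A = (2 * n * B ^ 2 + B + n * B ^ 2)
      + (4 * n ^ 2 * B ^ 2 + 2 * n * B) * Real.exp (2 * K)
      + (n ^ 2 * B + n ^ 3 * B ^ 2) + K + (n * (2 * B)) ^ 2 * Real.exp (2 * K) ^ 2 + 1)
    {t₁ C₀ : ℝ} (ht₁ : 0 < t₁) (ht₁T : (t₁ : EReal) < T) (p : M)
    (hosc : φ x₁ t₁ - φ p t₁ ≤ C₀)
    (hmax : ∀ y, ∀ s ∈ Icc 0 t₁,
      Real.log (traceAt g (fun y => φ y s) y) + Real.exp (-A * (φ y s - φ p s - C₀)) ≤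
      Real.log (traceAt g (fun y => φ y t₁) x₁) + Real.exp (-A * (φ x₁ t₁ - φ p t₁ - C₀))) :
    traceAt g (fun y => φ y t₁) x₁ ≤
      n * (Real.exp (2 * K) * (A * (n + 2 * K)) ^ (n - 1)) := by
  set e := chartAt (Cn n) c with he
  set z := e x₁ with hzdef
  have hU := e.open_target
  have hz : z ∈ e.target := e.map_source hx₁
  have hzx : e.symm z = x₁ := e.left_inv hx₁
  have ht₁I : t₁ ∈ timeInterval T := ⟨ht₁.le, ht₁T⟩
  have hφs := contMDiff_slice h.smooth ht₁I
  have hpd : ∀ x, (g.perturbed (fun y => φ y t₁) x).PosDef := fun x => h.posDef x t₁ ht₁I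
  have hspeed := fun x => abs_le.1 (h.abs_speed_le hF x ht₁I)
  have hFb := fun x => abs_le.1 (hF x)
  have hg := posDef_coeff g hz
  have hm := posDef_pertC g hφs hpd hz
  obtain ⟨W, l, hW, h1, h2, -, htr, hdet, -, -, hl⟩ :=
    exists_relative_eigenvalues hg hm.isHermitian
  have hl := hl hm
  have hS1 : traceAt g (fun y => φ y t₁) x₁ = ∑ i, l i := by
    rw [← htr, trWrt_pertC g hφs hz, ← he, hzx, traceAt]
  have hSpos : ∀ x, 0 < traceAt g (fun y => φ y t₁) x := fun x =>
    trWrt_pos (posDef_matrixAt g x) (hpd x) hn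
  have hu2 : ∀ q ∈ e.target, ContDiffAt ℝ 2 (fun w => φ (e.symm w) t₁) q := fun q hq =>
    contDiffAt_chart_self hφs c hq
  have hmW : ∀ q ∈ e.target, Wᴴ * g.coeff c q * W
      + hessF (frameOf W) (fun w => φ (e.symm w) t₁) q
      = Wᴴ * pertC g c (fun y => φ y t₁) q * W := fun q hq => by
    rw [hessF_frameOf W (hu2 q hq), pertC, Matrix.mul_add, Matrix.add_mul]
  have sg : SmoothM (g.coeff c) e.target := fun i j => g.smooth c i j
  have hder := h.hasDerivAt_traceAt hz hW h1 ht₁ ht₁T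
  -- The time derivative at the maximum, comparing only with earlier times. The exponent contributes
  -- the difference of the speeds at `x₁` and `p`, which is at least `-2K`.
  have ht := deriv_nonneg_of_max_left (f := fun s => Real.log (traceAt g (fun y => φ y s) x₁)
      + Real.exp (-A * (φ x₁ s - φ p s - C₀))) (s := univ) ht₁ (subset_univ _)
    (HasDerivAt.hasDerivWithinAt (((hzx ▸ hder).log (hSpos x₁).ne').add
      ((((((h.hasDerivAt x₁ ht₁ ht₁T).sub (h.hasDerivAt p ht₁ ht₁T)).sub_const C₀).const_mul
        (-A)).exp)))) fun s hs => hmax x₁ s hs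
  have key := sum_inv_le_of_isLocalMax (h := fun q => Wᴴ * g.coeff c q * W)
    (m := fun q => Wᴴ * g.coeff c q * W + hessF (frameOf W) (fun w => φ (e.symm w) t₁) q)
    (v := frameOf W) (u := fun w => φ (e.symm w) t₁) (F := fun q => F (e.symm q))
    (f := fun q => logRatio g (fun y => φ y t₁) (e.symm q) - F (e.symm q)) (l := l) (z := z)
    (U := e.target) (S := fun q => traceAt g (fun y => φ y t₁) (e.symm q)) (c := φ p t₁ + C₀)
    (B := B) (K := K) (A := A) (E := Real.exp (2 * K))
    (ft := logRatio g (fun y => φ y t₁) x₁ - F x₁ - (logRatio g (fun y => φ y t₁) p - F p))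
    hU hz (((SmoothM.const Wᴴ).mul sg).mul (SmoothM.const W)) (contDiffOn_chart hφs c)
    (contDiffOn_chart hFs c)
    (fun q hq => (IsUnit.posDef_star_left_conjugate_iff hW).2 (posDef_coeff g hq))
    (fun q => rfl)
    (fun q hq => by
      simp only [hmW q hq]
      exact (IsUnit.posDef_star_left_conjugate_iff hW).2 (posDef_pertC g hφs hpd hq))
    (fun q hq => by
      simp only [hmW q hq]
      rw [det_div_conj hW, det_div_pertC g hφs hq, logRatio])
    h1 hl (by simp only [hmW z hz]; exact h2) hB
    (fun p i j => (hfr W h1 p i j).1) (fun p i j => (hfr W h1 p i j).2)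
    (fun q hq => by
      simp only [hmW q hq]
      rw [trace_inv_mul_conj hW, trace_inv_mul_eq (posDef_coeff g hq) (posDef_pertC g hφs hpd hq),
        trWrt_pertC g hφs hq, traceAt])
    (fun q _ => hSpos _) hK0
    (inv_traceAt_le g (hpd _) hn (by positivity) (by
      linarith [(hspeed (e.symm z)).1, (hFb (e.symm z)).1]))
    (by rw [← laplacian_eq_of_frame g hFs hz hW h1]; exact hFl _)
    hA (by simp only [hzx]; linarith) hn
    (Filter.Eventually.of_forall fun q => by
      have := hmax (e.symm q) t₁ ⟨ht₁.le, le_rfl⟩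
      simp only [hzx]
      rw [← sub_sub, ← sub_sub]
      exact this)
    (by linarith [(hspeed x₁).1, (hspeed p).2])
    (by
      simp only [hzx]
      rw [← sub_sub]
      rw [Pi.sub_apply, ← he] at ht
      refine ht.trans_eq ?_
      ring)
  have hσ0 : ∀ i, (l i)⁻¹ ≤ A * (n + 2 * K) := fun i =>
    (Finset.single_le_sum (f := fun i => (l i)⁻¹) (fun j _ => (inv_pos.2 (hl j)).le)
      (Finset.mem_univ i)).trans key
  have hA1 : 0 ≤ A := by rw [hA]; positivity
  -- Bounds for the product and for the inverses together bound each eigenvalue.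
  have hprod : ∏ i, l i ≤ Real.exp (2 * K) := by
    have h3 := det_ratio_eq_exp (hpd (e.symm z))
    rw [← det_div_pertC g hφs hz, hdet, Complex.ofReal_re] at h3
    rw [h3, Real.exp_le_exp]
    linarith [(hspeed (e.symm z)).2, (hFb (e.symm z)).2]
  rw [hS1]
  calc ∑ i, l i ≤ ∑ _i : Fin n, Real.exp (2 * K) * (A * (n + 2 * K)) ^ (n - 1) :=
        Finset.sum_le_sum fun i _ => (le_prod_mul_pow hl hσ0 i).trans
          (mul_le_mul_of_nonneg_right hprod (by positivity))
    _ = _ := by simp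

lemma traceAt_zero (g : HermitianMetric n M) (x : M) : traceAt g (fun _ => 0) x = n := by
  rw [traceAt, (logRatio_zero g x).1, trWrt, Matrix.nonsing_inv_mul _
    ((Matrix.isUnit_iff_isUnit_det _).1 (posDef_matrixAt g x).isUnit)]
  simp

/-- A uniform bound for `tr_g g'` along the flow. -/
theorem exists_traceAt_bound [CompactSpace M] [ConnectedSpace M] (g : HermitianMetric n M)
    (hn : 0 < n) {K : ℝ} (hK0 : 0 ≤ K) :
    ∃ C, 0 < C ∧ ∀ F : M → ℝ, ContMDiff 𝓘(ℝ, Cn n) 𝓘(ℝ, ℝ) ∞ F → (∀ x, |F x| ≤ K) →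
      (∀ x, -K ≤ g.laplacian F x) → ∀ (T : EReal) (φ : M → ℝ → ℝ), IsSolution g F T φ →
      ∀ x, ∀ t ∈ timeInterval T, traceAt g (fun y => φ y t) x ≤ C := by
  obtain ⟨C₀, hC₀, hosc⟩ := exists_oscillation_bound g (2 * K)
  obtain ⟨J, hJ⟩ := exists_finite_chartBall_cover n M
  choose B' hB'0 hB' using fun c : M => exists_frame_bounds g c
    (isCompact_closedBall (chartAt (Cn n) c c) (6 * chartRadius n c)) (closedBall_subset_target n c)
  obtain ⟨b, hb⟩ := (J.image B').bddAbove
  obtain ⟨B, hB0, hbB⟩ : ∃ B, 0 ≤ B ∧ b ≤ B := ⟨max b 0, le_max_right _ _, le_max_left _ _⟩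
  obtain ⟨A, hA⟩ : ∃ A : ℝ, A = (2 * n * B ^ 2 + B + n * B ^ 2)
      + (4 * n ^ 2 * B ^ 2 + 2 * n * B) * Real.exp (2 * K)
      + (n ^ 2 * B + n ^ 3 * B ^ 2) + K + (n * (2 * B)) ^ 2 * Real.exp (2 * K) ^ 2 + 1 := ⟨_, rfl⟩
  have hA0 : 0 ≤ A := by rw [hA]; positivity
  -- `N` covers both places where the maximum may occur: a positive time, and time zero, where `g' =
  -- g` has trace `n`.
  obtain ⟨N, hN1, hN2⟩ : ∃ N : ℝ, n * (Real.exp (2 * K) * (A * (n + 2 * K)) ^ (n - 1)) ≤ N ∧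
      (n : ℝ) ≤ N := ⟨_, le_max_left _ _, le_max_right _ _⟩
  have hN0 : 0 < N := lt_of_lt_of_le (by exact_mod_cast hn) hN2
  refine ⟨N * Real.exp (Real.exp (A * (2 * C₀))), by positivity,
    fun F hFs hF hFl T φ h x t ht => ?_⟩
  obtain ⟨t₀, ht₀, ht₀T⟩ : ∃ t₀ : ℝ, t < t₀ ∧ (t₀ : EReal) < T := by
    obtain ⟨q, hq1, hq2⟩ := EReal.exists_rat_btwn_of_lt ht.2
    exact ⟨q, EReal.coe_lt_coe_iff.1 hq1, hq2⟩
  have ht₀0 : 0 < t₀ := ht.1.trans_lt ht₀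
  have hIcc : Icc 0 t₀ ⊆ timeInterval T := fun s hs =>
    ⟨hs.1, (EReal.coe_le_coe_iff.2 hs.2).trans_lt ht₀T⟩
  have hosc' : ∀ s ∈ timeInterval T, ∀ y y', φ y s - φ y' s ≤ C₀ := fun s hs y y' =>
    hosc (fun y => φ y s) (contMDiff_slice h.smooth hs) (fun q => h.posDef q s hs)
      (fun q => by linarith [(abs_le.1 (h.abs_speed_le hF q hs)).2, (abs_le.1 (hF q)).2]) y y'
  have hSpos : ∀ y, ∀ s ∈ timeInterval T, 0 < traceAt g (fun y => φ y s) y := fun y s hs =>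
    trWrt_pos (posDef_matrixAt g y) (h.posDef y s hs) hn
  have hsm : ContMDiffOn (𝓘(ℝ, Cn n).prod 𝓘(ℝ, ℝ)) 𝓘(ℝ, ℝ) ∞ (fun p : M × ℝ => φ p.1 p.2)
      (univ ×ˢ Icc 0 t₀) := h.smooth.mono (prod_mono subset_rfl hIcc)
  have hcS := continuousOn_traceAt g hsm (uniqueDiffOn_Icc ht₀0)
  have hcφ : ContinuousOn (fun p : M × ℝ => φ p.1 p.2) (univ ×ˢ Icc 0 t₀) := hsm.continuousOn
  have hcφp : ContinuousOn (fun p : M × ℝ => φ x p.2) (univ ×ˢ Icc 0 t₀) :=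
    hcφ.comp (f := fun p : M × ℝ => (x, p.2)) (by fun_prop) fun p hp => ⟨mem_univ _, hp.2⟩
  -- The base point of the exponent is the point `x` at which the trace is to be bounded; no
  -- constant depends on it.
  have hcQ : ContinuousOn (fun p : M × ℝ => Real.log (traceAt g (fun y => φ y p.2) p.1)
      + Real.exp (-A * (φ p.1 p.2 - φ x p.2 - C₀))) (univ ×ˢ Icc 0 t₀) :=
    (hcS.log fun p hp => (hSpos p.1 p.2 (hIcc hp.2)).ne').add
      (continuousOn_const.mul ((hcφ.sub hcφp).sub continuousOn_const)).rexp
  obtain ⟨⟨x₁, t₁⟩, ⟨-, ht₁⟩, hmax⟩ := (isCompact_univ.prod isCompact_Icc).exists_isMaxOn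
    ⟨(x, t), mem_univ _, ht.1, ht₀.le⟩ hcQ
  rw [isMaxOn_iff] at hmax
  simp only [mem_prod, mem_univ, true_and, Prod.forall] at ht₁ hmax
  have hm : ∀ y, ∀ s ∈ Icc 0 t₀,
      Real.log (traceAt g (fun y => φ y s) y) + Real.exp (-A * (φ y s - φ x s - C₀)) ≤
      Real.log (traceAt g (fun y => φ y t₁) x₁) + Real.exp (-A * (φ x₁ t₁ - φ x t₁ - C₀)) :=
    hmax
  have ht₁I := hIcc ht₁
  have hSN : traceAt g (fun y => φ y t₁) x₁ ≤ N := by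
    rcases ht₁.1.eq_or_lt with h0 | h0
    · have e0 : (fun y => φ y t₁) = fun _ => 0 := by
        funext y; rw [← h0, h.initial]
      rw [e0, traceAt_zero]
      exact hN2
    · obtain ⟨c, hcJ, hxc⟩ := hJ x₁
      have hBc : B' c ≤ B :=
        (hb (Finset.mem_coe.2 (Finset.mem_image_of_mem B' hcJ))).trans hbB
      have hzc : chartAt (Cn n) c x₁ ∈
          Metric.closedBall (chartAt (Cn n) c c) (6 * chartRadius n c) := by
        have h3 : dist (chartAt (Cn n) c x₁) (chartAt (Cn n) c c) < chartRadius n c := hxc.2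
        rw [Metric.mem_closedBall]
        linarith [chartRadius_pos n c]
      refine le_trans ?_ hN1
      exact h.traceAt_le_of_max hn hFs hK0 hF hFl hxc.1 hB0
        (fun W hW p i j => ⟨((hB' c _ hzc W hW p i j).1).trans hBc,
          ((hB' c _ hzc W hW p i j).2).trans hBc⟩) hA h0 ht₁I.2 x (hosc' t₁ ht₁I x₁ x)
        fun y s hs => hm y s ⟨hs.1, hs.2.trans ht₁.2⟩
  -- The oscillation bound keeps the exponential bounded at the maximum; at `(x, t)` it is positive
  -- and can be dropped.
  have hexp : Real.exp (-A * (φ x₁ t₁ - φ x t₁ - C₀)) ≤ Real.exp (A * (2 * C₀)) := by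
    rw [Real.exp_le_exp]
    have := mul_le_mul_of_nonneg_left (hosc' t₁ ht₁I x x₁) hA0
    linarith
  have hlog : Real.log (traceAt g (fun y => φ y t) x) ≤ Real.log N + Real.exp (A * (2 * C₀)) := by
    have h4 := hm x t ⟨ht.1, ht₀.le⟩
    have h5 := Real.log_le_log (hSpos x₁ t₁ ht₁I) hSN
    linarith [Real.exp_pos (-A * (φ x t - φ x t - C₀))]
  rw [← Real.exp_log (hSpos x t ht)]
  calc Real.exp (Real.log (traceAt g (fun y => φ y t) x))
      ≤ Real.exp (Real.log N + Real.exp (A * (2 * C₀))) := Real.exp_le_exp.2 hlog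
    _ = _ := by rw [Real.exp_add, Real.exp_log hN0]

end TraceBound

/-! ### Consequences of the trace bound -/

section Consequences

variable {n : ℕ} {M : Type*} [TopologicalSpace M] [ChartedSpace (Cn n) M]

/-- Each relative eigenvalue is at most the trace. For the lower bound, `le_prod_mul_pow` is applied
to the inverse eigenvalues, whose product is at most `exp K` and whose own inverses are at most `S`.
-/
lemma posSemidef_of_traceAt_le [IsManifold 𝓘(ℂ, Cn n) ω M] (g : HermitianMetric n M)
    {u : M → ℝ} {x : M} (hp : (g.perturbed u x).PosDef) {K S C : ℝ} (hK : -K ≤ logRatio g u x)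
    (hS : traceAt g u x ≤ S) (hSC : S ≤ C)
    (hC : Real.exp K * S ^ (n - 1) ≤ C) :
    (g.perturbed u x - ((1 / C : ℝ) : ℂ) • g.matrixAt x).PosSemidef ∧
      ((C : ℂ) • g.matrixAt x - g.perturbed u x).PosSemidef := by
  obtain ⟨W, l, -, -, -, -, htr, hdet, hlow, hup, hl⟩ :=
    exists_relative_eigenvalues (posDef_matrixAt g x) hp.isHermitian
  have hl := hl hp
  have hle : ∀ i, l i ≤ S := fun i => by
    rw [traceAt, htr] at hS
    exact (Finset.single_le_sum (fun j _ => (hl j).le) (Finset.mem_univ i)).trans hS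
  refine ⟨(hlow _).2 fun i => ?_, (hup _).2 fun i => (hle i).trans hSC⟩
  have h1 := det_ratio_eq_exp hp
  rw [hdet, Complex.ofReal_re] at h1
  have hprod : ∏ j, (l j)⁻¹ ≤ Real.exp K := by
    rw [Finset.prod_inv_distrib, h1, ← Real.exp_neg, Real.exp_le_exp]
    linarith
  have hS0 : 0 ≤ S := (hl i).le.trans (hle i)
  have h2 := le_prod_mul_pow (l := fun j => (l j)⁻¹) (fun j => inv_pos.2 (hl j)) (σ := S)
    (fun j => by rw [inv_inv]; exact hle j) i
  have h3 : (l i)⁻¹ ≤ C :=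
    h2.trans ((mul_le_mul_of_nonneg_right hprod (by positivity)).trans hC)
  rw [one_div]
  exact inv_le_of_inv_le₀ (hl i) h3

/-- For a probability measure the mean lies within the oscillation of every value. -/
lemma abs_normalized_le [CompactSpace M] [MeasurableSpace M] [BorelSpace M]
    (g : HermitianMetric n M) (hvol : g.omegaPow univ = 1) {φ : M → ℝ → ℝ} {t C : ℝ}
    (hφ : Continuous fun x => φ x t) (hosc : ∀ x y, φ x t - φ y t ≤ C) (x : M) :
    |normalized g φ x t| ≤ C := by
  have : IsProbabilityMeasure g.omegaPow := ⟨hvol⟩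
  have hint : Integrable (fun y => φ y t) g.omegaPow :=
    hφ.integrable_of_hasCompactSupport (HasCompactSupport.of_compactSpace _)
  have h1 : ∫ y, φ y t ∂g.omegaPow ≤ ∫ _y, (φ x t + C) ∂g.omegaPow :=
    integral_mono hint (integrable_const _) fun y => by
      simp only
      linarith [hosc y x]
  have h2 : ∫ _y, (φ x t - C) ∂g.omegaPow ≤ ∫ y, φ y t ∂g.omegaPow :=
    integral_mono (integrable_const _) hint fun y => by
      simp only
      linarith [hosc x y]
  simp only [integral_const, probReal_univ, one_smul] at h1 h2
  rw [normalized, abs_le]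
  constructor <;> linarith

/-- The two-sided bound `C⁻¹ g ≤ g' ≤ C g` and the bounds for the trace and the oscillation. -/
theorem exists_metric_bounds [IsManifold 𝓘(ℂ, Cn n) ω M] [CompactSpace M] [ConnectedSpace M]
    (g : HermitianMetric n M) {K : ℝ} (hK0 : 0 ≤ K) :
    ∃ C₀ C : ℝ, 0 < C ∧ ∀ F : M → ℝ, ContMDiff 𝓘(ℝ, Cn n) 𝓘(ℝ, ℝ) ∞ F →
      (∀ x, |F x| ≤ K) → (∀ x, -K ≤ g.laplacian F x) →
      ∀ (T : EReal) (φ : M → ℝ → ℝ), IsSolution g F T φ → ∀ t ∈ timeInterval T,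
        (∀ x y, φ x t - φ y t ≤ C₀) ∧ ∀ x, traceAt g (fun y => φ y t) x ≤ C ∧
          (g.perturbed (fun y => φ y t) x - ((1 / C : ℝ) : ℂ) • g.matrixAt x).PosSemidef ∧
          ((C : ℂ) • g.matrixAt x - g.perturbed (fun y => φ y t) x).PosSemidef := by
  obtain ⟨C₀, -, hosc⟩ := exists_oscillation_bound g (2 * K)
  obtain ⟨S, hS0, hS⟩ : ∃ S, 0 < S ∧ ∀ F : M → ℝ, ContMDiff 𝓘(ℝ, Cn n) 𝓘(ℝ, ℝ) ∞ F →
      (∀ x, |F x| ≤ K) → (∀ x, -K ≤ g.laplacian F x) →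
      ∀ (T : EReal) (φ : M → ℝ → ℝ), IsSolution g F T φ →
      ∀ x, ∀ t ∈ timeInterval T, traceAt g (fun y => φ y t) x ≤ S := by
    -- In dimension zero the matrices are empty and the trace is zero.
    rcases Nat.eq_zero_or_pos n with rfl | hn
    · exact ⟨1, one_pos, fun _ _ _ _ _ _ _ _ _ _ => by simp [traceAt, trWrt, Matrix.trace]⟩
    · exact exists_traceAt_bound g hn hK0
  -- The sum dominates both the trace bound `S` and the bound for the inverse eigenvalues.
  refine ⟨C₀, S + Real.exp (2 * K) * S ^ (n - 1), by positivity,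
    fun F hFs hF hFl T φ h t ht => ?_⟩
  have hspeed := fun x => abs_le.1 (h.abs_speed_le hF x ht)
  have hFb := fun x => abs_le.1 (hF x)
  have hSC : S ≤ S + Real.exp (2 * K) * S ^ (n - 1) := le_add_of_nonneg_right (by positivity)
  refine ⟨hosc _ (contMDiff_slice h.smooth ht) (fun q => h.posDef q t ht) fun q => by
    linarith [(hspeed q).2, (hFb q).2], fun x => ?_⟩
  have hx := hS F hFs hF hFl T φ h x t ht
  exact ⟨hx.trans hSC, posSemidef_of_traceAt_le g (h.posDef x t ht) (K := 2 * K)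
    (by linarith [(hspeed x).1, (hFb x).1]) hx hSC
    (le_add_of_nonneg_left hS0.le)⟩

end Consequences

end HermitianFlow

end

/-! ### The theorem -/

open HermitianFlow in
theorem theorem3p1 {n : ℕ} {M : Type*} [TopologicalSpace M] [T2Space M] [CompactSpace M]
    [ConnectedSpace M] [MeasurableSpace M] [BorelSpace M]
    [ChartedSpace (Cn n) M] [IsManifold 𝓘(ℂ, Cn n) ω M]
    (g : HermitianMetric n M) (hvol : g.omegaPow univ = 1) (K : ℝ) :
    ∃ C₁ C₂ A C : ℝ, 0 < C₁ ∧ 0 < C₂ ∧ 0 < A ∧ 0 < C ∧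
      ∀ F : M → ℝ, ContMDiff 𝓘(ℝ, Cn n) 𝓘(ℝ, ℝ) ∞ F →
        (∀ x, |F x| ≤ K) → (∀ x, -K ≤ g.laplacian F x) →
      ∀ (T : EReal) (φ : M → ℝ → ℝ), 0 < T → IsSolution g F T φ →
        BddAbove (valuesOn T (normalized g φ)) ∧ BddBelow (valuesOn T (normalized g φ)) ∧
        ∀ x, ∀ t ∈ timeInterval T,
          trWrt (g.matrixAt x) (g.perturbed (fun y => φ y t) x) ≤
            C₁ * Real.exp (C₂ * (sSup (valuesOn T (normalized g φ))
                - sInf (valuesOn T (normalized g φ)))) *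
              Real.exp (Real.exp (A * (sSup (valuesOn T (normalized g φ))
                  - sInf (valuesOn T (normalized g φ))))
                - Real.exp (A * (sSup (valuesOn T (normalized g φ)) - normalized g φ x t))) ∧
          trWrt (g.matrixAt x) (g.perturbed (fun y => φ y t) x) ≤ C ∧
          (g.perturbed (fun y => φ y t) x - ((1 / C : ℝ) : ℂ) • g.matrixAt x).PosSemidef ∧
          ((C : ℂ) • g.matrixAt x - g.perturbed (fun y => φ y t) x).PosSemidef := by
  -- The estimates require a nonnegative constant, so `K` is enlarged to `max K 0`.
  obtain ⟨C₀, C, hC, h⟩ := exists_metric_bounds g (le_max_right K 0)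
  -- Any positive `C₂` and `A` would serve, since the exponential factors only need to be at least
  -- 1.
  refine ⟨C, 1, 1, C, hC, one_pos, one_pos, hC, fun F hFs hF hFl T φ _ hφ => ?_⟩
  have hb := h F hFs (fun x => (hF x).trans (le_max_left _ _))
    (fun x => (neg_le_neg (le_max_left K 0)).trans (hFl x)) T φ hφ
  have hnorm : ∀ x, ∀ t ∈ timeInterval T, |normalized g φ x t| ≤ C₀ := fun x t ht =>
    abs_normalized_le g hvol (contMDiff_slice hφ.smooth ht).continuous (hb t ht).1 x
  have hA : BddAbove (valuesOn T (normalized g φ)) := by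
    refine ⟨C₀, ?_⟩
    rintro _ ⟨x, -, t, ht, rfl⟩
    exact (abs_le.1 (hnorm x t ht)).2
  have hB : BddBelow (valuesOn T (normalized g φ)) := by
    refine ⟨-C₀, ?_⟩
    rintro _ ⟨x, -, t, ht, rfl⟩
    exact (abs_le.1 (hnorm x t ht)).1
  refine ⟨hA, hB, fun x t ht => ⟨?_, (hb t ht).2 x⟩⟩
  have hmem : normalized g φ x t ∈ valuesOn T (normalized g φ) := ⟨x, mem_univ x, t, ht, rfl⟩
  have h1 := le_csSup hA hmem
  have h2 := csInf_le hB hmem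
  have e1 : 1 ≤ Real.exp (1 * (sSup (valuesOn T (normalized g φ))
      - sInf (valuesOn T (normalized g φ)))) := Real.one_le_exp (by linarith)
  have e2 : 1 ≤ Real.exp (Real.exp (1 * (sSup (valuesOn T (normalized g φ))
      - sInf (valuesOn T (normalized g φ))))
      - Real.exp (1 * (sSup (valuesOn T (normalized g φ)) - normalized g φ x t))) :=
    Real.one_le_exp (sub_nonneg.2 (Real.exp_le_exp.2 (by linarith)))
  refine ((hb t ht).2 x).1.trans ?_
  rw [mul_assoc]
  exact le_mul_of_one_le_right hC.le (one_le_mul_of_one_le_of_one_le e1 e2)
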